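/- Let $r_\star=\sqrt{2/\sqrt3}$ and let $\mathsf A_2=\mathbb Z\sigma+\mathbb Z\tau\subset\mathbb R^2$, with $\sigma=r_\star(1,0)$ and $\tau=r_\star(\tfrac12,\tfrac{\sqrt3}{2})$, be the hexagonal lattice of covolume $1$. For $f:(0,\infty)\to\mathbb R$ and a locally finite $X\subset\mathbb R^2$ let $$E_f(X)=\liminf_{r\to\infty}\frac1{|X\cap B_r|}\sum_{x,y\in X\cap B_r,\;x\ne y}f(|x-y|)\in[-\infty,+\infty],$$ where $B_r$ is the disk of radius $r$ centred at $0$. For $\mathbf p:\mathsf A_2\to\mathbb R^2$ let $\mathsf A_2+\mathbf p=\{x+\mathbf p(x):x\in\mathsf A_2\}$ and $\|\mathbf p\|=\sup_{x\in\mathsf A_2}|\mathbf p(x)|$. A function $f:(0,\infty)\to\mathbb R$ is called c.m.s.d. if $f(r)=g(r^2)$ for all $r>0$, where $g:(0,\infty)\to\mathbb R$ is smooth and $(-1)^kg^{(k)}\ge0$ for all $k\ge0$. By Bernstein's theorem there is then a unique positive Borel measure $W_f$ on $[0,\infty)$ such that $\int_{[0,\infty)}e^{-\pi\alpha r^2}\,dW_f(\alpha)=f(r)<\infty$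 for all $r>0$. (1) For every c.m.s.d. function $f$ there exists $\epsilon>0$ such that every $\mathbf p:\mathsf A_2\to\mathbb R^2$ with $\|\mathbf p\|\le\epsilon$ satisfies $E_f(\mathsf A_2+\mathbf p)\ge E_f(\mathsf A_2)$. (2) Let $\mathcal F$ be a family of c.m.s.d. functions such that $$\lim_{\alpha_0\to0^+,\;\alpha_1\to\infty}\ \frac{\int_{\alpha_1}^{\infty}e^{-\frac{\pi\alpha}{2}r_\star^2}\,dW_f(\alpha)+\int_0^{\alpha_0}\alpha^{-1}\,dW_f(\alpha)}{\int_1^\infty e^{-\pi\alpha r_\star^2}\,dW_f(\alpha)+\int_0^1e^{-\frac{\pi}{\alpha}r_\star^2}\,dW_f(\alpha)}=0\quad\text{uniformly for } f\in\mathcal F$$ (the integrals include their endpoints, with $0^{-1}=+\infty$, $e^{-\infty}=0$; for $f=0$ the quotient is read as $0$). Then there exists $\epsilon>0$ such that every $\mathbf p:\mathsf A_2\to\mathbb R^2$ with $\|\mathbf p\|\le\epsilon$ satisfies $E_f(\mathsf A_2+\mathbf p)\ge E_f(\mathsf A_2)$ for all $f\in\mathcal F$. -/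

import Mathlib

open Filter Topology MeasureTheory Set
open scoped NNReal ENNReal ContDiff

noncomputable section

/-- The Euclidean plane. -/
abbrev Plane : Type := EuclideanSpace ℝ (Fin 2)

/-- The `f`-energy per point of a locally finite configuration `X`: the lower limit, as `r → ∞`,
of `1 / |X ∩ B_r|` times the sum of `f |x - y|` over ordered pairs of distinct points of
`X ∩ B_r`. It takes values in the extended reals, so that it may be `+∞`. -/
def energy (f : ℝ → ℝ) (X : Set Plane) : EReal :=
  liminf (fun r : ℝ =>
    (((∑ᶠ q ∈ (X ∩ Metric.closedBall 0 r).offDiag, f (dist q.1 q.2)) /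
      ((X ∩ Metric.closedBall 0 r).ncard : ℝ) : ℝ) : EReal)) atTop

/-- The minimal distance `r⋆ = √(2 / √3)` of the hexagonal lattice of covolume one. -/
def rStar : ℝ := √(2 / √3)

/-- First basis vector of the hexagonal lattice. -/
def hexSigma : Plane := rStar • !₂[1, 0]

/-- Second basis vector of the hexagonal lattice. -/
def hexTau : Plane := rStar • !₂[1 / 2, √3 / 2]

/-- The hexagonal lattice `A₂ = ℤ σ + ℤ τ`, as a set of points. -/
def hexLattice : Set Plane := {x | ∃ m n : ℤ, x = m • hexSigma + n • hexTau}

/-- The perturbed lattice `A₂ + p = {x + p x : x ∈ A₂}`. -/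
def perturbedLattice (p : hexLattice → Plane) : Set Plane :=
  Set.range fun x : hexLattice => (x : Plane) + p x

/-- The size `‖p‖ = sup_x |p x|` of a perturbation (`∞` if `p` is unbounded). -/
def perturbationSize (p : hexLattice → Plane) : ℝ≥0∞ := ⨆ x, ‖p x‖ₑ

/-- `g` is completely monotonic on `(0, ∞)`: it is smooth there and `(-1)ᵏ g⁽ᵏ⁾ ≥ 0` for
all `k ≥ 0`. -/
def CompletelyMonotonic (g : ℝ → ℝ) : Prop :=
  ContDiffOn ℝ ∞ g (Ioi 0) ∧ ∀ k : ℕ, ∀ t : ℝ, 0 < t → 0 ≤ (-1 : ℝ) ^ k * iteratedDeriv k g t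

/-- `f` is a completely monotonic function of the square distance: `f r = g (r²)` for `r > 0`,
with `g` completely monotonic. -/
def IsCMSD (f : ℝ → ℝ) : Prop :=
  ∃ g : ℝ → ℝ, CompletelyMonotonic g ∧ ∀ r : ℝ, 0 < r → f r = g (r ^ 2)

/-- `W` is the Gaussian mixture measure `W_f` of `f`: a positive Borel measure on `[0, ∞)` such
that, for every `r > 0`, the integral of `α ↦ exp (-π α r²)` against `W` is finite and equal to
`f r`. -/
def IsMixtureMeasure (W : Measure ℝ≥0) (f : ℝ → ℝ) : Prop :=
  ∀ r : ℝ, 0 < r →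
    Integrable (fun α : ℝ≥0 => Real.exp (-(Real.pi * α * r ^ 2))) W ∧
      ∫ α : ℝ≥0, Real.exp (-(Real.pi * α * r ^ 2)) ∂W = f r

/-- The numerator: the integral of `exp (-(π α / 2) r⋆²)` over `[α₁, ∞)` plus the integral of
`α⁻¹` over `[0, α₀]`, where `0⁻¹ = ∞`. -/
def ratioNum (W : Measure ℝ≥0) (α₀ α₁ : ℝ≥0) : ℝ≥0∞ :=
  (∫⁻ α in Ici α₁, ENNReal.ofReal (Real.exp (-(Real.pi * α / 2 * rStar ^ 2))) ∂W) +
    ∫⁻ α in Iic α₀, (α : ℝ≥0∞)⁻¹ ∂W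

/-- The denominator: the integral of `exp (-π α r⋆²)` over `[1, ∞)` plus the integral of
`exp (-(π / α) r⋆²)` over `[0, 1]`. The latter integrand vanishes (as a limit) at `α = 0`, so
that point is left out. -/
def ratioDen (W : Measure ℝ≥0) : ℝ≥0∞ :=
  (∫⁻ α in Ici (1 : ℝ≥0), ENNReal.ofReal (Real.exp (-(Real.pi * α * rStar ^ 2))) ∂W) +
    ∫⁻ α in Ioc (0 : ℝ≥0) 1, ENNReal.ofReal (Real.exp (-(Real.pi / α * rStar ^ 2))) ∂W

/-- The quotient `ratioNum / ratioDen` for the mixture measure of `f` tends to `0` as `α₀ → 0⁺`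
and `α₁ → ∞`, uniformly for `f ∈ F`. -/
def UniformRatioCondition (F : Set (ℝ → ℝ)) : Prop :=
  ∀ η : ℝ≥0∞, 0 < η → ∀ᶠ q : ℝ≥0 × ℝ≥0 in 𝓝[>] 0 ×ˢ atTop,
    ∀ f ∈ F, ∀ W : Measure ℝ≥0, IsMixtureMeasure W f →
      ratioNum W q.1 q.2 / ratioDen W ≤ η

end

/-! By Bernstein's theorem (proved here as `CompletelyMonotonic.exists_measure`) the interaction is
a mixture of Gaussians exp(-π α r²). It therefore suffices to bound the energy change of each
Gaussian from below in a way that can be integrated over α.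

Cut the displacement off outside a large disk and expand each pair interaction. The first order
terms telescope to zero (`tsum_dualPair_increment`). The second order part is a translation
invariant quadratic form, so Parseval on the torus reduces it to one 2×2 form per wave vector (s,
t), the lattice sum of `dynTerm`. The third order part is at most the size of the displacement times
`gaussLoss α` times the sum `edgeEnergy` of squared nearest neighbour increments.

The heart is `tsum_dynTerm_ge`: the 2×2 form is bounded below by a multiple of `gaussGap α` times
`hexWeight s t`, the symbol of the edge energy. If π α r⋆² > 2, every orbit of lattice vectors under
rotation by 120° already contributes nonnegatively, because the three factors 1 - cos of an orbit
satisfy a Heron type inequality (`dynTerm_orbit_ge`). If α is smaller, Poisson summation rewrites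
the form as a difference of second moments of a narrow Gaussian on the lattice shifted by the wave
vector and on the unshifted lattice (`tsum_dynamical_eq`). That the shift increases the second
moment is `hexMoment_gap`. For short wave vectors, opposite lattice points are paired, Jensen's
inequality is applied on rotation orbits, and the term of the origin pays for the losses. For long
ones, the three nearest lattice points alone exceed the unshifted moment. The two ranges of α barely
overlap.

Integrated over the mixture measure, the gaps dominate half of `ratioDen` and the losses are at most
`ratioNum` with both cut-offs equal to 1. Hence a displacement of size ε with ε K small does not
lower the energy when `ratioNum W 1 1 ≤ K * ratioDen W` (`exists_tsum_interaction_nonneg`). Disks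
form a Følner sequence, so truncation costs nothing in the limit (`exists_energy_le_of_ratio`).

A single interaction has such a K unless `ratioNum W 1 1` is infinite, and in that case the
perturbed energy is +∞. The uniform ratio condition gives one K for the whole family, because
changing the cut-offs costs only a multiple of the denominator (`exists_ratioNum_one_le`). -/

noncomputable section

/-! ### The hexagonal quadratic form and convergence of Gaussian lattice sums. -/

/-- The quadratic form `a² + a b + b²` of the hexagonal lattice. -/
def hexForm (a b : ℝ) : ℝ := a ^ 2 + a * b + b ^ 2

lemma half_le_hexForm (a b : ℝ) : (a ^ 2 + b ^ 2) / 2 ≤ hexForm a b := by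
  unfold hexForm; nlinarith [sq_nonneg (a + b)]

lemma hexForm_le (a b : ℝ) : hexForm a b ≤ 3 / 2 * (a ^ 2 + b ^ 2) := by
  unfold hexForm; nlinarith [sq_nonneg (a - b)]

lemma hexForm_nonneg (a b : ℝ) : 0 ≤ hexForm a b :=
  le_trans (by positivity) (half_le_hexForm a b)

lemma hexForm_zero : hexForm 0 0 = 0 := by simp [hexForm]

lemma one_le_hexForm {h : ℤ × ℤ} (hh : h ≠ 0) : 1 ≤ hexForm h.1 h.2 := by
  have h0 : (0 : ℝ) < hexForm h.1 h.2 := by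
    refine lt_of_lt_of_le ?_ (half_le_hexForm _ _)
    have : h.1 ≠ 0 ∨ h.2 ≠ 0 := by
      by_contra hc
      push Not at hc
      exact hh (Prod.ext hc.1 hc.2)
    rcases this with h1 | h1
    · have : ((h.1 : ℤ) : ℝ) ≠ 0 := by exact_mod_cast h1
      positivity
    · have : ((h.2 : ℤ) : ℝ) ≠ 0 := by exact_mod_cast h1
      positivity
  have h1 : (0 : ℤ) < h.1 ^ 2 + h.1 * h.2 + h.2 ^ 2 := by
    unfold hexForm at h0; exact_mod_cast h0
  unfold hexForm
  exact_mod_cast h1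

lemma summable_int_exp_neg_sq {c : ℝ} (hc : 0 < c) :
    Summable fun n : ℤ => Real.exp (-c * (n : ℝ) ^ 2) := by
  have key : Summable fun n : ℕ => Real.exp (-c * (n : ℝ) ^ 2) := by
    refine Summable.of_nonneg_of_le (fun n => (Real.exp_pos _).le) (fun n => ?_)
      (Real.summable_exp_nat_mul_iff.mpr (show -c < 0 by linarith))
    refine Real.exp_le_exp.mpr ?_
    have : (n : ℝ) ≤ (n : ℝ) ^ 2 := by
      have : n ≤ n ^ 2 := Nat.le_self_pow (by norm_num) n
      exact_mod_cast this
    nlinarith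
  exact Summable.of_nat_of_neg (by simpa using key) (by simpa using key)

lemma summable_exp_neg_sq_add_sq {c : ℝ} (hc : 0 < c) :
    Summable fun h : ℤ × ℤ => Real.exp (-c * ((h.1 : ℝ) ^ 2 + (h.2 : ℝ) ^ 2)) := by
  have := (summable_int_exp_neg_sq hc).mul_of_nonneg (summable_int_exp_neg_sq hc)
    (fun _ => (Real.exp_pos _).le) (fun _ => (Real.exp_pos _).le)
  refine this.congr fun h => ?_
  rw [← Real.exp_add]; ring_nf

/-- Half of the exponential decay absorbs the polynomial, by y ^ k / k! ≤ exp y at y = c (1 + x) /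
2. -/
lemma one_add_pow_mul_exp_neg_le {c : ℝ} (hc : 0 < c) (k : ℕ) :
    ∃ C : ℝ, 0 ≤ C ∧ ∀ x : ℝ, 0 ≤ x → (1 + x) ^ k * Real.exp (-c * x) ≤ C * Real.exp (-(c / 2) * x) := by
  refine ⟨(k.factorial : ℝ) * (2 / c) ^ k * Real.exp (c / 2), by positivity, fun x hx => ?_⟩
  have h1 := Real.pow_div_factorial_le_exp (c / 2 * (1 + x)) (by positivity) k
  have h2 : (1 + x) ^ k ≤ (k.factorial : ℝ) * (2 / c) ^ k * Real.exp (c / 2 * (1 + x)) := by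
    rw [div_le_iff₀ (by positivity), mul_pow] at h1
    have : (1 + x) ^ k = (2 / c) ^ k * ((c / 2) ^ k * (1 + x) ^ k) := by
      rw [← mul_assoc, ← mul_pow]; field_simp; simp
    rw [this]
    calc _ ≤ (2 / c) ^ k * (Real.exp (c / 2 * (1 + x)) * k.factorial) := by gcongr
      _ = _ := by ring
  calc (1 + x) ^ k * Real.exp (-c * x)
      ≤ (k.factorial : ℝ) * (2 / c) ^ k * Real.exp (c / 2 * (1 + x)) * Real.exp (-c * x) := by gcongr
    _ = (k.factorial : ℝ) * (2 / c) ^ k * Real.exp (c / 2) * Real.exp (-(c / 2) * x) := by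
      rw [mul_assoc, mul_assoc _ (Real.exp (c / 2)), ← Real.exp_add, ← Real.exp_add]; ring_nf

lemma summable_of_le_pow_mul_exp {f : ℤ × ℤ → ℝ} {c : ℝ} (hc : 0 < c) (k : ℕ) {C : ℝ}
    (hf : ∀ h, |f h| ≤ C * ((1 + ((h.1 : ℝ) ^ 2 + (h.2 : ℝ) ^ 2)) ^ k *
      Real.exp (-c * ((h.1 : ℝ) ^ 2 + (h.2 : ℝ) ^ 2)))) : Summable f := by
  obtain ⟨C', hC', h'⟩ := one_add_pow_mul_exp_neg_le hc k
  refine Summable.of_norm_bounded (g := fun h : ℤ × ℤ => (|C| * C') *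
    Real.exp (-(c / 2) * ((h.1 : ℝ) ^ 2 + (h.2 : ℝ) ^ 2)))
    ((summable_exp_neg_sq_add_sq (half_pos hc)).mul_left _) fun h => ?_
  rw [Real.norm_eq_abs]
  refine (hf h).trans ?_
  rw [mul_assoc]
  refine mul_le_mul (le_abs_self C) (h' _ (by positivity)) (by positivity) (abs_nonneg C)

/-- Separating the shift from the lattice vector makes Gaussian bounds uniform over bounded shifts,
which the dominated convergence arguments need. -/
lemma hexForm_shift_ge (m n s t : ℝ) :
    (m ^ 2 + n ^ 2) / 4 - (s ^ 2 + t ^ 2) / 2 ≤ hexForm (m + s) (n + t) := by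
  have := half_le_hexForm (m + s) (n + t)
  nlinarith [sq_nonneg (m + 2 * s), sq_nonneg (n + 2 * t)]

lemma exp_neg_hexForm_shift_le {c : ℝ} (hc : 0 ≤ c) (m n s t : ℝ) :
    Real.exp (-c * hexForm (m + s) (n + t)) ≤
      Real.exp (c * (s ^ 2 + t ^ 2) / 2) * Real.exp (-(c / 4) * (m ^ 2 + n ^ 2)) := by
  rw [← Real.exp_add]
  refine Real.exp_le_exp.mpr ?_
  nlinarith [hexForm_shift_ge m n s t]

lemma summable_exp_neg_hexForm_shift {c : ℝ} (hc : 0 < c) (s t : ℝ) :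
    Summable fun h : ℤ × ℤ => Real.exp (-c * hexForm (h.1 + s) (h.2 + t)) := by
  refine summable_of_le_pow_mul_exp (c := c / 4) (by positivity) 0 (C := Real.exp (c * (s ^ 2 + t ^ 2) / 2)) fun h => ?_
  rw [abs_of_pos (Real.exp_pos _)]
  simpa using exp_neg_hexForm_shift_le hc.le h.1 h.2 s t

lemma summable_exp_neg_hexForm {c : ℝ} (hc : 0 < c) :
    Summable fun h : ℤ × ℤ => Real.exp (-c * hexForm h.1 h.2) := by
  simpa using summable_exp_neg_hexForm_shift hc 0 0

/-! ### Poisson summation on the hexagonal lattice. -/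

/-- One-dimensional Poisson summation in n for fixed m. Completing the square, m² + m n + n² = (n +
m/2)² + 3m²/4, leaves the Gaussian of parameter 3a/4 in m. The dual of the form is a² - a b + b²;
the minus sign in the phase m s - n t turns it back into `hexForm`. -/
lemma tsum_cexp_hexForm_row {a : ℝ} (ha : 0 < a) (s t : ℝ) (m : ℤ) :
    ∑' n : ℤ, Complex.exp (-Real.pi * a * (hexForm m n : ℝ) +
        2 * Real.pi * Complex.I * (m * s - n * t)) =
      1 / (a : ℂ) ^ (1 / 2 : ℂ) * ∑' n : ℤ, Complex.exp (-(Real.pi / a) * (n + t) ^ 2 +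
      (-Real.pi * (3 * a / 4 : ℝ) * m ^ 2 + 2 * Real.pi * (Complex.I * (s + (n + t) / 2)) * m)) := by
  have hac : (a : ℂ) ≠ 0 := by exact_mod_cast ha.ne'
  have hb : (0 : ℝ) < 3 * a / 4 := by positivity
  have h1 := Complex.tsum_exp_neg_quadratic (a := (a : ℂ)) (by simpa using ha)
    (-Complex.I * t - a * m / 2)
  calc _ = Complex.exp (-Real.pi * a * m ^ 2 + 2 * Real.pi * Complex.I * m * s) *
        ∑' n : ℤ, Complex.exp (-Real.pi * a * n ^ 2 +
          2 * Real.pi * (-Complex.I * t - a * m / 2) * n) := by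
        rw [← tsum_mul_left]
        refine tsum_congr fun n => ?_
        rw [← Complex.exp_add]
        congr 1
        simp only [hexForm]; push_cast; ring
    _ = _ := by
        rw [h1, mul_left_comm, ← tsum_mul_left]
        congr 1
        refine tsum_congr fun n => ?_
        rw [← Complex.exp_add]
        congr 1
        have hI : Complex.I * (-Complex.I * t - a * m / 2) = t - Complex.I * a * m / 2 := by
          linear_combination (-(t : ℂ)) * Complex.I_sq
        rw [hI]
        push_cast
        field_simp
        linear_combination ((-(m : ℂ) ^ 2 * a ^ 2 * 4)) * Complex.I_sq

/-- The second one-dimensional Poisson summation, now in m. The reflection m ↦ -m restores the sign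
of the shift. -/
lemma tsum_cexp_hexForm_column {a : ℝ} (ha : 0 < a) (s t : ℝ) (n : ℤ) :
    ∑' m : ℤ, Complex.exp (-(Real.pi / a) * (n + t) ^ 2 +
      (-Real.pi * (3 * a / 4 : ℝ) * m ^ 2 + 2 * Real.pi * (Complex.I * (s + (n + t) / 2)) * m)) =
      1 / ((3 * a / 4 : ℝ) : ℂ) ^ (1 / 2 : ℂ) * ∑' m : ℤ,
        (Real.exp (-(4 * Real.pi / (3 * a)) * hexForm (m + s) (n + t)) : ℂ) := by
  have hac : (a : ℂ) ≠ 0 := by exact_mod_cast ha.ne'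
  have hb : (0 : ℝ) < 3 * a / 4 := by positivity
  have h1 := Complex.tsum_exp_neg_quadratic (a := ((3 * a / 4 : ℝ) : ℂ)) (by rw [Complex.ofReal_re]; exact hb)
    (Complex.I * (s + (n + t) / 2))
  calc _ = Complex.exp (-(Real.pi / a) * (n + t) ^ 2) *
        ∑' m : ℤ, Complex.exp (-Real.pi * ((3 * a / 4 : ℝ) : ℂ) * m ^ 2 +
          2 * Real.pi * (Complex.I * (s + (n + t) / 2)) * m) := by
        rw [← tsum_mul_left]
        refine tsum_congr fun m => ?_
        rw [← Complex.exp_add]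
    _ = _ := by
        rw [h1, mul_left_comm, ← tsum_mul_left]
        congr 1
        rw [← (Equiv.neg ℤ).tsum_eq]
        refine tsum_congr fun m => ?_
        rw [← Complex.exp_add, Complex.ofReal_exp]
        congr 1
        have hI : Complex.I * (Complex.I * (s + (n + t) / 2)) = -(s + (n + t) / 2 : ℂ) := by
          linear_combination ((s : ℂ) + (n + t) / 2) * Complex.I_sq
        rw [hI]
        simp only [hexForm, Equiv.neg_apply]
        push_cast
        field_simp
        ring

/-- Absolute convergence of the half-transformed double sum, needed to exchange the two summations.
The cross term is purely imaginary, so the norm is a product of two one-dimensional Gaussians. -/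
lemma summable_cexp_hexForm_aux {a : ℝ} (ha : 0 < a) (s t : ℝ) :
    Summable fun h : ℤ × ℤ => Complex.exp (-(Real.pi / a) * (h.2 + t) ^ 2 +
      (-Real.pi * (3 * a / 4 : ℝ) * h.1 ^ 2 + 2 * Real.pi * (Complex.I * (s + (h.2 + t) / 2)) * h.1)) := by
  have hπ := Real.pi_pos
  refine Summable.of_norm ?_
  have h3 : Summable fun n : ℤ => Real.exp (-(Real.pi / a) * ((n : ℝ) + t) ^ 2) := by
    refine Summable.of_nonneg_of_le (fun _ => (Real.exp_pos _).le) (fun n => ?_)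
      ((summable_int_exp_neg_sq (c := Real.pi / a / 2) (by positivity)).mul_left
        (Real.exp (Real.pi / a * t ^ 2)))
    rw [← Real.exp_add]
    refine Real.exp_le_exp.mpr ?_
    have : 0 < Real.pi / a := by positivity
    nlinarith [mul_nonneg this.le (sq_nonneg ((n : ℝ) + 2 * t))]
  have h4 := (summable_int_exp_neg_sq (c := Real.pi * (3 * a / 4)) (by positivity)).mul_of_nonneg h3
    (fun _ => (Real.exp_pos _).le) (fun _ => (Real.exp_pos _).le)
  refine h4.congr fun h => ?_
  rw [Complex.norm_exp, ← Real.exp_add]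
  congr 1
  have : (-(Real.pi / a) * (h.2 + t) ^ 2 +
    (-Real.pi * (3 * a / 4 : ℝ) * h.1 ^ 2 + 2 * Real.pi * (Complex.I * (s + (h.2 + t) / 2)) * h.1) : ℂ)
    = ((-(Real.pi / a) * ((h.2 : ℝ) + t) ^ 2 - Real.pi * (3 * a / 4 : ℝ) * (h.1 : ℝ) ^ 2 : ℝ) : ℂ) +
      ((2 * Real.pi * (s + ((h.2 : ℝ) + t) / 2) * h.1 : ℝ) : ℂ) * Complex.I := by
    push_cast; ring
  rw [this]
  simp only [Complex.add_re, Complex.ofReal_re, Complex.mul_re, Complex.I_re, Complex.ofReal_im, Complex.I_im]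
  ring

lemma tsum_tsum_comm {F : ℤ × ℤ → ℂ} (h : Summable F) :
    ∑' m : ℤ, ∑' n : ℤ, F (m, n) = ∑' n : ℤ, ∑' m : ℤ, F (m, n) :=
  (Summable.tsum_comm (f := fun m n => F (m, n)) h).symm

/-- Poisson summation for Gaussians on the hexagonal lattice, complex form. -/
lemma tsum_cexp_hexForm {a : ℝ} (ha : 0 < a) (s t : ℝ) :
    ∑' h : ℤ × ℤ, Complex.exp (-Real.pi * a * (hexForm h.1 h.2 : ℝ) +
        2 * Real.pi * Complex.I * (h.1 * s - h.2 * t)) =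
      ((2 / (√3 * a) : ℝ) : ℂ) * ∑' h : ℤ × ℤ,
        (Real.exp (-(4 * Real.pi / (3 * a)) * hexForm (h.1 + s) (h.2 + t)) : ℂ) := by
  have hπ := Real.pi_pos
  have hS1 : Summable fun h : ℤ × ℤ => Complex.exp (-Real.pi * a * (hexForm h.1 h.2 : ℝ) +
        2 * Real.pi * Complex.I * (h.1 * s - h.2 * t)) := by
    refine Summable.of_norm ?_
    refine (summable_exp_neg_hexForm (c := Real.pi * a) (by positivity)).congr fun h => ?_
    rw [Complex.norm_exp]
    congr 1
    simp
  have hS2 := summable_cexp_hexForm_aux ha s t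
  have hS3 : Summable fun h : ℤ × ℤ =>
        (Real.exp (-(4 * Real.pi / (3 * a)) * hexForm (h.1 + s) (h.2 + t)) : ℂ) := by
    exact (Complex.ofRealCLM.summable
      (summable_exp_neg_hexForm_shift (c := 4 * Real.pi / (3 * a)) (by positivity) s t))
  have hb : (0 : ℝ) < 3 * a / 4 := by positivity
  rw [hS1.tsum_prod]
  simp_rw [tsum_cexp_hexForm_row ha s t]
  rw [tsum_mul_left]
  have sw2 := tsum_tsum_comm hS2
  dsimp only at sw2
  rw [sw2]
  simp_rw [tsum_cexp_hexForm_column ha s t]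
  rw [tsum_mul_left, hS3.tsum_prod]
  have sw3 := tsum_tsum_comm hS3
  dsimp only at sw3
  rw [sw3, ← mul_assoc]
  congr 1
  -- What remains is the prefactor: 1/√a from the rows times 1/√(3a/4) from the columns is 2/(√3 a).
  rw [show (1 / 2 : ℂ) = ((1 / 2 : ℝ) : ℂ) by push_cast; rfl, ← Complex.ofReal_cpow ha.le,
    ← Complex.ofReal_cpow hb.le, ← Real.sqrt_eq_rpow, ← Real.sqrt_eq_rpow]
  norm_cast
  have h4 : √(3 * a / 4) = √3 * √a / 2 := by
    rw [show 3 * a / 4 = 3 * a / 2 ^ 2 by norm_num, Real.sqrt_div (by positivity),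
      Real.sqrt_mul (by norm_num), Real.sqrt_sq (by norm_num)]
  rw [h4]
  have h5 : √a ^ 2 = a := Real.sq_sqrt ha.le
  have h6 : 0 < √a := Real.sqrt_pos.mpr ha
  field_simp
  rw [h5]
  
/-- Poisson summation for Gaussians on the hexagonal lattice. -/
lemma tsum_exp_hexForm_mul_cos {a : ℝ} (ha : 0 < a) (s t : ℝ) :
    ∑' h : ℤ × ℤ, Real.exp (-(Real.pi * a) * hexForm h.1 h.2) *
        Real.cos (2 * Real.pi * (h.1 * s - h.2 * t)) =
      2 / (√3 * a) * ∑' h : ℤ × ℤ,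
        Real.exp (-(4 * Real.pi / (3 * a)) * hexForm (h.1 + s) (h.2 + t)) := by
  have h := congrArg Complex.re (tsum_cexp_hexForm ha s t)
  rw [Complex.re_ofReal_mul, ← Complex.ofReal_tsum, Complex.ofReal_re, Complex.re_tsum] at h
  · rw [← h]
    refine tsum_congr fun x => ?_
    rw [Complex.exp_re]
    congr 2
    · simp
    · simp
  · refine Summable.of_norm ?_
    refine (summable_exp_neg_hexForm (c := Real.pi * a) (by positivity)).congr fun h => ?_
    rw [Complex.norm_exp]
    congr 1
    simp

/-! ### Differentiating Poisson summation twice; the dynamical matrix. -/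

/-- Clear for z² ≥ 1. Otherwise multiply cosh z ≤ exp (z²/2) by 1 - z² ≤ exp (-z²). The bound
dominates second differences of Gaussians. -/
lemma cosh_sub_one_le (z : ℝ) : Real.cosh z - 1 ≤ z ^ 2 * Real.cosh z := by
  have h1 := Real.cosh_le_exp_half_sq z
  have h0 := Real.one_le_cosh z
  rcases le_total 1 (z ^ 2) with h | h
  · nlinarith
  · have h2 : 1 - z ^ 2 ≤ Real.exp (-z ^ 2) := by linarith [Real.add_one_le_exp (-z ^ 2)]
    have h3 : Real.cosh z * (1 - z ^ 2) ≤ Real.exp (z ^ 2 / 2) * Real.exp (-z ^ 2) := by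
      gcongr
    rw [← Real.exp_add] at h3
    have : Real.exp (z ^ 2 / 2 + -z ^ 2) ≤ 1 := Real.exp_le_one_iff.mpr (by nlinarith [sq_nonneg z])
    linarith

lemma tendsto_div_of_hasDerivAt {g : ℝ → ℝ} {g' : ℝ} (h : HasDerivAt g g' 0) (h0 : g 0 = 0) :
    Tendsto (fun τ => g τ / τ) (𝓝[≠] 0) (𝓝 g') := by
  have := h.tendsto_slope
  refine this.congr fun τ => ?_
  simp [slope_def_field, h0]

lemma tendsto_one_sub_cos_div_sq (x : ℝ) :
    Tendsto (fun τ => (2 * (Real.cos (x * τ) - 1)) / τ ^ 2) (𝓝[≠] 0) (𝓝 (-x ^ 2)) := by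
  have h1 : HasDerivAt (fun τ => Real.sin (x / 2 * τ)) (x / 2) 0 := by
    have := ((hasDerivAt_id (0 : ℝ)).const_mul (x / 2)).sin
    simpa using this
  have h2 := ((tendsto_div_of_hasDerivAt h1 (by simp)).pow 2).const_mul (-4)
  convert! h2 using 1
  · ext τ
    have : Real.cos (x * τ) = 1 - 2 * Real.sin (x / 2 * τ) ^ 2 := by
      rw [show x * τ = 2 * (x / 2 * τ) by ring, Real.cos_two_mul, Real.cos_sq']; ring
    rw [this, div_pow]; ring
  · ring_nf

lemma tendsto_cosh_sub_one_div_sq (x : ℝ) :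
    Tendsto (fun τ => (2 * (Real.cosh (x * τ) - 1)) / τ ^ 2) (𝓝[≠] 0) (𝓝 (x ^ 2)) := by
  have h1 : HasDerivAt (fun τ => Real.sinh (x / 2 * τ)) (x / 2) 0 := by
    have := ((hasDerivAt_id (0 : ℝ)).const_mul (x / 2)).sinh
    simpa using this
  have h2 := ((tendsto_div_of_hasDerivAt h1 (by simp)).pow 2).const_mul 4
  convert! h2 using 1
  · ext τ
    have : Real.cosh (x * τ) = 1 + 2 * Real.sinh (x / 2 * τ) ^ 2 := by
      rw [show x * τ = 2 * (x / 2 * τ) by ring, Real.cosh_two_mul, Real.cosh_sq]; ring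
    rw [this, div_pow]; ring
  · ring_nf

lemma tendsto_exp_sq_sub_one_div_sq (y : ℝ) :
    Tendsto (fun τ : ℝ => (Real.exp (-y * τ ^ 2) - 1) / τ ^ 2) (𝓝[≠] 0) (𝓝 (-y)) := by
  have h1 : HasDerivAt (fun τ => Real.exp (-y * τ) - 1) (-y) 0 := by
    have := (((hasDerivAt_id (0 : ℝ)).const_mul (-y)).exp).sub_const 1
    simpa using this
  have h2 := tendsto_div_of_hasDerivAt h1 (by simp)
  refine h2.comp (f := fun τ : ℝ => τ ^ 2) ?_
  refine tendsto_nhdsWithin_iff.mpr ⟨?_, ?_⟩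
  · have : Tendsto (fun τ : ℝ => τ ^ 2) (𝓝 0) (𝓝 (0 ^ 2)) := (continuous_pow 2).tendsto 0
    simpa using this.mono_left nhdsWithin_le_nhds
  · filter_upwards [self_mem_nhdsWithin] with τ hτ
    exact pow_ne_zero 2 hτ

/-- The second moment sum `∑ ⟨x, ξ + k⟩² exp (-u |ξ + k|²)` over the hexagonal lattice, in
coordinates. -/
def hexMoment (u x₁ x₂ s t : ℝ) : ℝ :=
  ∑' h : ℤ × ℤ, ((h.1 + s) * x₁ + (h.2 + t) * x₂) ^ 2 * Real.exp (-u * hexForm (h.1 + s) (h.2 + t))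

lemma linear_sq_le (m n s t x₁ x₂ : ℝ) :
    ((m + s) * x₁ + (n + t) * x₂) ^ 2 ≤
      2 * (x₁ ^ 2 + x₂ ^ 2) * (1 + s ^ 2 + t ^ 2) * (1 + (m ^ 2 + n ^ 2)) := by
  have h1 : ((m + s) * x₁ + (n + t) * x₂) ^ 2 ≤ ((m + s) ^ 2 + (n + t) ^ 2) * (x₁ ^ 2 + x₂ ^ 2) := by
    nlinarith [sq_nonneg ((m + s) * x₂ - (n + t) * x₁)]
  have h2 : (m + s) ^ 2 + (n + t) ^ 2 ≤ 2 * ((1 + s ^ 2 + t ^ 2) * (1 + (m ^ 2 + n ^ 2))) := by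
    nlinarith [sq_nonneg (m - s), sq_nonneg (n - t), sq_nonneg (s * m), sq_nonneg (s * n), sq_nonneg (t * m),
      sq_nonneg (t * n)]
  calc _ ≤ _ := h1
    _ ≤ 2 * ((1 + s ^ 2 + t ^ 2) * (1 + (m ^ 2 + n ^ 2))) * (x₁ ^ 2 + x₂ ^ 2) := by gcongr
    _ = _ := by ring

lemma summable_hexMoment {u : ℝ} (hu : 0 < u) (x₁ x₂ s t : ℝ) :
    Summable fun h : ℤ × ℤ =>
      ((h.1 + s) * x₁ + (h.2 + t) * x₂) ^ 2 * Real.exp (-u * hexForm (h.1 + s) (h.2 + t)) := by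
  refine summable_of_le_pow_mul_exp (c := u / 4) (by positivity) 1
    (C := 2 * (x₁ ^ 2 + x₂ ^ 2) * (1 + s ^ 2 + t ^ 2) * Real.exp (u * (s ^ 2 + t ^ 2) / 2)) fun h => ?_
  rw [abs_of_nonneg (by positivity)]
  calc _ ≤ (2 * (x₁ ^ 2 + x₂ ^ 2) * (1 + s ^ 2 + t ^ 2) * (1 + ((h.1 : ℝ) ^ 2 + (h.2 : ℝ) ^ 2))) *
        (Real.exp (u * (s ^ 2 + t ^ 2) / 2) * Real.exp (-(u / 4) * ((h.1 : ℝ) ^ 2 + (h.2 : ℝ) ^ 2))) :=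
        mul_le_mul (linear_sq_le _ _ _ _ _ _) (exp_neg_hexForm_shift_le hu.le _ _ _ _)
          (Real.exp_pos _).le (by positivity)
    _ = _ := by ring

lemma hexForm_add_smul (w₁ w₂ d₁ d₂ τ : ℝ) :
    hexForm (w₁ + τ * d₁) (w₂ + τ * d₂) =
      hexForm w₁ w₂ + τ * (w₁ * (2 * d₁ + d₂) + w₂ * (d₁ + 2 * d₂)) + τ ^ 2 * hexForm d₁ d₂ := by
  unfold hexForm; ring

/-- Second symmetric difference of a shifted Gaussian lattice sum. -/
lemma tendsto_second_difference_hexForm {b : ℝ} (hb : 0 < b) (s t d₁ d₂ : ℝ) :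
    Tendsto (fun τ : ℝ => (∑' h : ℤ × ℤ, Real.exp (-b * hexForm (h.1 + (s + τ * d₁)) (h.2 + (t + τ * d₂)))
        + ∑' h : ℤ × ℤ, Real.exp (-b * hexForm (h.1 + (s - τ * d₁)) (h.2 + (t - τ * d₂)))
        - 2 * ∑' h : ℤ × ℤ, Real.exp (-b * hexForm (h.1 + s) (h.2 + t))) / τ ^ 2) (𝓝[≠] 0)
      (𝓝 (b ^ 2 * hexMoment b (2 * d₁ + d₂) (d₁ + 2 * d₂) s t - 2 * b * hexForm d₁ d₂ *
        ∑' h : ℤ × ℤ, Real.exp (-b * hexForm (h.1 + s) (h.2 + t)))) := by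
  set Y := hexForm d₁ d₂ with hY
  have hY0 : 0 ≤ Y := hexForm_nonneg _ _
  set B : ℤ × ℤ → ℝ := fun h => (h.1 + s) * (2 * d₁ + d₂) + (h.2 + t) * (d₁ + 2 * d₂) with hB
  set E : ℤ × ℤ → ℝ := fun h => Real.exp (-b * hexForm (h.1 + s) (h.2 + t)) with hE
  have hplus : ∀ (τ : ℝ) (h : ℤ × ℤ), Real.exp (-b * hexForm (h.1 + (s + τ * d₁)) (h.2 + (t + τ * d₂))) =
      E h * (Real.exp (-(b * Y) * τ ^ 2) * Real.exp (-(b * B h * τ))) := by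
    intro τ h
    rw [hE, ← Real.exp_add, ← Real.exp_add, ← add_assoc, ← add_assoc, hexForm_add_smul]
    congr 1; simp only [hB, hY]; ring
  have hminus : ∀ (τ : ℝ) (h : ℤ × ℤ), Real.exp (-b * hexForm (h.1 + (s - τ * d₁)) (h.2 + (t - τ * d₂))) =
      E h * (Real.exp (-(b * Y) * τ ^ 2) * Real.exp (b * B h * τ)) := by
    intro τ h
    have := hplus (-τ) h
    simpa [sub_eq_add_neg] using this
  have hcosh : ∀ (τ : ℝ) (h : ℤ × ℤ), Real.exp (-(b * B h * τ)) + Real.exp (b * B h * τ) =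
      2 * Real.cosh (b * B h * τ) := by
    intro τ h; rw [Real.cosh_eq]; ring
  -- Pairing +τ with -τ cancels the odd terms and leaves cosh, while the quadratic term of the shift
  -- factors out of the exponent.
  have hform : ∀ τ : ℝ, (∑' h : ℤ × ℤ, Real.exp (-b * hexForm (h.1 + (s + τ * d₁)) (h.2 + (t + τ * d₂)))
        + ∑' h : ℤ × ℤ, Real.exp (-b * hexForm (h.1 + (s - τ * d₁)) (h.2 + (t - τ * d₂)))
        - 2 * ∑' h : ℤ × ℤ, E h) / τ ^ 2 =
      ∑' h : ℤ × ℤ, E h * (Real.exp (-(b * Y) * τ ^ 2) * ((2 * (Real.cosh (b * B h * τ) - 1)) / τ ^ 2) +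
        2 * ((Real.exp (-(b * Y) * τ ^ 2) - 1) / τ ^ 2)) := by
    intro τ
    rw [← tsum_mul_left, ← Summable.tsum_add (summable_exp_neg_hexForm_shift hb _ _)
      (summable_exp_neg_hexForm_shift hb _ _), ← Summable.tsum_sub
      ((summable_exp_neg_hexForm_shift hb _ _).add (summable_exp_neg_hexForm_shift hb _ _))
      ((summable_exp_neg_hexForm_shift hb _ _).mul_left 2), ← tsum_div_const]
    refine tsum_congr fun h => ?_
    rw [hplus, hminus]
    linear_combination (E h * Real.exp (-(b * Y) * τ ^ 2) / τ ^ 2) * hcosh τ h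
  have hlim : b ^ 2 * hexMoment b (2 * d₁ + d₂) (d₁ + 2 * d₂) s t - 2 * b * Y * ∑' h : ℤ × ℤ, E h =
      ∑' h : ℤ × ℤ, E h * (1 * (b * B h) ^ 2 + 2 * (-(b * Y))) := by
    rw [hexMoment, ← tsum_mul_left, ← tsum_mul_left, ← Summable.tsum_sub
      ((summable_hexMoment hb _ _ _ _).mul_left _) ((summable_exp_neg_hexForm_shift hb _ _).mul_left _)]
    refine tsum_congr fun h => ?_
    simp only [hE, hB]; ring
  rw [hlim]
  simp_rw [hform]
  -- This constant bounds the shift factor uniformly for |τ| ≤ 1.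
  set K := Real.exp (b * ((|s| + |d₁|) ^ 2 + (|t| + |d₂|) ^ 2) / 2) with hK
  refine tendsto_tsum_of_dominated_convergence
    (bound := fun h => 2 * b ^ 2 * (B h ^ 2 * (K * Real.exp (-(b / 4) * ((h.1 : ℝ) ^ 2 + (h.2 : ℝ) ^ 2)))) + 2 * (b * Y) * E h) ?_ ?_ ?_
  · refine Summable.add (Summable.mul_left _ ?_) ((summable_exp_neg_hexForm_shift hb _ _).mul_left _)
    refine summable_of_le_pow_mul_exp (c := b / 4) (by positivity) 1
      (C := 2 * ((2 * d₁ + d₂) ^ 2 + (d₁ + 2 * d₂) ^ 2) * (1 + s ^ 2 + t ^ 2) * K) fun h => ?_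
    rw [abs_of_nonneg (by positivity)]
    calc _ ≤ (2 * ((2 * d₁ + d₂) ^ 2 + (d₁ + 2 * d₂) ^ 2) * (1 + s ^ 2 + t ^ 2) *
          (1 + ((h.1 : ℝ) ^ 2 + (h.2 : ℝ) ^ 2))) * (K * Real.exp (-(b / 4) * ((h.1 : ℝ) ^ 2 + (h.2 : ℝ) ^ 2))) := by
          gcongr
          exact linear_sq_le _ _ _ _ _ _
      _ = _ := by ring
  · intro h
    refine Tendsto.const_mul _ (Tendsto.add (Tendsto.mul ?_ (tendsto_cosh_sub_one_div_sq _))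
      ((tendsto_exp_sq_sub_one_div_sq _).const_mul 2))
    have : Tendsto (fun τ : ℝ => Real.exp (-(b * Y) * τ ^ 2)) (𝓝 0) (𝓝 (Real.exp (-(b * Y) * 0 ^ 2))) :=
      Continuous.tendsto (by fun_prop) 0
    simpa using this.mono_left nhdsWithin_le_nhds
  · have h1 : ∀ᶠ τ : ℝ in 𝓝[≠] 0, |τ| ≤ 1 := by
      refine nhdsWithin_le_nhds ?_
      filter_upwards [Metric.ball_mem_nhds (0 : ℝ) one_pos] with τ hτ
      simpa [Real.norm_eq_abs] using (mem_ball_zero_iff.mp hτ).le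
    filter_upwards [h1, self_mem_nhdsWithin] with τ hτ hτ0 h
    have hτ0' : 0 < τ ^ 2 := by positivity [show τ ≠ 0 from hτ0]
    have hKb : ∀ σ : ℝ, |σ| ≤ 1 → Real.exp (-b * hexForm (h.1 + (s + σ * d₁)) (h.2 + (t + σ * d₂))) ≤
        K * Real.exp (-(b / 4) * ((h.1 : ℝ) ^ 2 + (h.2 : ℝ) ^ 2)) := by
      intro σ hσ
      refine (exp_neg_hexForm_shift_le hb.le _ _ _ _).trans ?_
      rw [hK]
      have aux : ∀ x d : ℝ, (x + σ * d) ^ 2 ≤ (|x| + |d|) ^ 2 := by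
        intro x d
        rw [← sq_abs]
        gcongr
        calc |x + σ * d| ≤ |x| + |σ * d| := abs_add_le _ _
          _ ≤ |x| + |d| := by rw [abs_mul]; nlinarith [abs_nonneg d]
      have := add_le_add (aux s d₁) (aux t d₂)
      gcongr
    have e1 := hKb τ hτ
    have e2 := hKb (-τ) (by simpa using hτ)
    rw [hplus] at e1
    rw [hplus] at e2
    simp only [even_two.neg_pow, mul_neg, neg_neg] at e2
    have hc1 : 0 ≤ Real.cosh (b * B h * τ) - 1 := by linarith [Real.one_le_cosh (b * B h * τ)]
    have hEpos : 0 < E h := Real.exp_pos _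
    have hex1 : Real.exp (-(b * Y) * τ ^ 2) ≤ 1 := Real.exp_le_one_iff.mpr (by nlinarith [mul_nonneg hb.le hY0])
    have hex2 : 1 - Real.exp (-(b * Y) * τ ^ 2) ≤ b * Y * τ ^ 2 := by
      linarith [Real.add_one_le_exp (-(b * Y) * τ ^ 2)]
    rw [Real.norm_eq_abs, abs_mul, abs_of_pos hEpos]
    have t1 : |Real.exp (-(b * Y) * τ ^ 2) * ((2 * (Real.cosh (b * B h * τ) - 1)) / τ ^ 2)| ≤
        Real.exp (-(b * Y) * τ ^ 2) * (2 * (b * B h) ^ 2 * Real.cosh (b * B h * τ)) := by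
      rw [abs_of_nonneg (by positivity)]
      gcongr
      rw [div_le_iff₀ hτ0']
      nlinarith [cosh_sub_one_le (b * B h * τ)]
    have t2 : |2 * ((Real.exp (-(b * Y) * τ ^ 2) - 1) / τ ^ 2)| ≤ 2 * (b * Y) := by
      rw [abs_mul, abs_two, abs_div, abs_of_pos hτ0', abs_of_nonpos (by linarith)]
      gcongr
      rw [div_le_iff₀ hτ0']; linarith
    calc _ ≤ E h * (Real.exp (-(b * Y) * τ ^ 2) * (2 * (b * B h) ^ 2 * Real.cosh (b * B h * τ)) + 2 * (b * Y)) := by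
          gcongr
          exact (abs_add_le _ _).trans (add_le_add t1 t2)
      -- The cosh is expanded back into two exponentials, each of which is a shifted Gaussian
      -- covered by `hKb`.
      _ = (b * B h) ^ 2 * (E h * (Real.exp (-(b * Y) * τ ^ 2) * Real.exp (-(b * B h * τ))) +
            E h * (Real.exp (-(b * Y) * τ ^ 2) * Real.exp (b * B h * τ))) + 2 * (b * Y) * E h := by
          linear_combination (-(b * B h) ^ 2 * E h * Real.exp (-(b * Y) * τ ^ 2)) * hcosh τ h
      _ ≤ (b * B h) ^ 2 * (K * Real.exp (-(b / 4) * ((h.1 : ℝ) ^ 2 + (h.2 : ℝ) ^ 2)) +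
            K * Real.exp (-(b / 4) * ((h.1 : ℝ) ^ 2 + (h.2 : ℝ) ^ 2))) + 2 * (b * Y) * E h := by
          gcongr
      _ = _ := by ring

lemma summable_exp_hexForm_mul_cos {a : ℝ} (ha : 0 < a) (φ : ℤ × ℤ → ℝ) :
    Summable fun h : ℤ × ℤ => Real.exp (-(Real.pi * a) * hexForm h.1 h.2) * Real.cos (φ h) := by
  refine Summable.of_norm_bounded (summable_exp_neg_hexForm (c := Real.pi * a) (by positivity)) fun h => ?_
  rw [Real.norm_eq_abs, abs_mul, abs_of_pos (Real.exp_pos _)]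
  exact mul_le_of_le_one_right (Real.exp_pos _).le (Real.abs_cos_le_one _)

lemma summable_linear_sq_mul_exp_hexForm {a : ℝ} (ha : 0 < a) (y₁ y₂ : ℝ) :
    Summable fun h : ℤ × ℤ => (h.1 * y₁ + h.2 * y₂) ^ 2 * Real.exp (-(Real.pi * a) * hexForm h.1 h.2) := by
  simpa using summable_hexMoment (u := Real.pi * a) (by positivity) y₁ y₂ 0 0

lemma summable_linear_sq_mul_exp_hexForm_mul_cos {a : ℝ} (ha : 0 < a) (y₁ y₂ : ℝ) (φ : ℤ × ℤ → ℝ) :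
    Summable fun h : ℤ × ℤ => (h.1 * y₁ + h.2 * y₂) ^ 2 *
      (Real.exp (-(Real.pi * a) * hexForm h.1 h.2) * Real.cos (φ h)) := by
  refine Summable.of_norm_bounded (summable_linear_sq_mul_exp_hexForm ha y₁ y₂) fun h => ?_
  rw [Real.norm_eq_abs, abs_mul, abs_mul, abs_of_pos (Real.exp_pos _), abs_of_nonneg (sq_nonneg _), ← mul_assoc]
  exact mul_le_of_le_one_right (by positivity) (Real.abs_cos_le_one _)

/-- The differentiation direction is (y₁, -y₂): with the phase h.1 s - h.2 t each derivative then
brings down h.1 y₁ + h.2 y₂. -/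
lemma tendsto_second_difference_cos {a : ℝ} (ha : 0 < a) (s t y₁ y₂ : ℝ) :
    Tendsto (fun τ : ℝ => (∑' h : ℤ × ℤ, Real.exp (-(Real.pi * a) * hexForm h.1 h.2) *
          Real.cos (2 * Real.pi * (h.1 * (s + τ * y₁) - h.2 * (t + τ * -y₂)))
        + ∑' h : ℤ × ℤ, Real.exp (-(Real.pi * a) * hexForm h.1 h.2) *
          Real.cos (2 * Real.pi * (h.1 * (s - τ * y₁) - h.2 * (t - τ * -y₂)))
        - 2 * ∑' h : ℤ × ℤ, Real.exp (-(Real.pi * a) * hexForm h.1 h.2) *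
          Real.cos (2 * Real.pi * (h.1 * s - h.2 * t))) / τ ^ 2) (𝓝[≠] 0)
      (𝓝 (-(4 * Real.pi ^ 2) * ∑' h : ℤ × ℤ, (h.1 * y₁ + h.2 * y₂) ^ 2 *
        (Real.exp (-(Real.pi * a) * hexForm h.1 h.2) * Real.cos (2 * Real.pi * (h.1 * s - h.2 * t))))) := by
  set E : ℤ × ℤ → ℝ := fun h => Real.exp (-(Real.pi * a) * hexForm h.1 h.2) *
    Real.cos (2 * Real.pi * (h.1 * s - h.2 * t)) with hE
  set x : ℤ × ℤ → ℝ := fun h => 2 * Real.pi * (h.1 * y₁ + h.2 * y₂) with hx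
  have hform : ∀ τ : ℝ, (∑' h : ℤ × ℤ, Real.exp (-(Real.pi * a) * hexForm h.1 h.2) *
          Real.cos (2 * Real.pi * (h.1 * (s + τ * y₁) - h.2 * (t + τ * -y₂)))
        + ∑' h : ℤ × ℤ, Real.exp (-(Real.pi * a) * hexForm h.1 h.2) *
          Real.cos (2 * Real.pi * (h.1 * (s - τ * y₁) - h.2 * (t - τ * -y₂)))
        - 2 * ∑' h : ℤ × ℤ, E h) / τ ^ 2 =
      ∑' h : ℤ × ℤ, E h * ((2 * (Real.cos (x h * τ) - 1)) / τ ^ 2) := by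
    intro τ
    rw [← tsum_mul_left, ← Summable.tsum_add (summable_exp_hexForm_mul_cos ha _)
      (summable_exp_hexForm_mul_cos ha _), ← Summable.tsum_sub
      ((summable_exp_hexForm_mul_cos ha _).add (summable_exp_hexForm_mul_cos ha _))
      ((summable_exp_hexForm_mul_cos ha _).mul_left 2), ← tsum_div_const]
    refine tsum_congr fun h => ?_
    have e1 : 2 * Real.pi * (h.1 * (s + τ * y₁) - h.2 * (t + τ * -y₂)) =
      2 * Real.pi * (h.1 * s - h.2 * t) + x h * τ := by simp only [hx]; ring
    have e2 : 2 * Real.pi * (h.1 * (s - τ * y₁) - h.2 * (t - τ * -y₂)) =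
      2 * Real.pi * (h.1 * s - h.2 * t) - x h * τ := by simp only [hx]; ring
    rw [e1, e2, Real.cos_add, Real.cos_sub]
    simp only [hE]; ring
  have hlim : -(4 * Real.pi ^ 2) * ∑' h : ℤ × ℤ, (h.1 * y₁ + h.2 * y₂) ^ 2 * E h =
      ∑' h : ℤ × ℤ, E h * (-x h ^ 2) := by
    rw [← tsum_mul_left]
    refine tsum_congr fun h => ?_
    simp only [hx]; ring
  rw [hlim]
  simp_rw [hform]
  refine tendsto_tsum_of_dominated_convergence
    (bound := fun h => 4 * Real.pi ^ 2 * ((h.1 * y₁ + h.2 * y₂) ^ 2 * Real.exp (-(Real.pi * a) * hexForm h.1 h.2)))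
    ((summable_linear_sq_mul_exp_hexForm ha y₁ y₂).mul_left _)
    (fun h => (tendsto_one_sub_cos_div_sq _).const_mul _) ?_
  filter_upwards [self_mem_nhdsWithin] with τ hτ0 h
  have hτ0' : 0 < τ ^ 2 := by positivity [show τ ≠ 0 from hτ0]
  rw [Real.norm_eq_abs, abs_mul]
  have t1 : |(2 * (Real.cos (x h * τ) - 1)) / τ ^ 2| ≤ x h ^ 2 := by
    rw [abs_div, abs_of_pos hτ0', abs_of_nonpos (by linarith [Real.cos_le_one (x h * τ)]), div_le_iff₀ hτ0']
    nlinarith [Real.one_sub_sq_div_two_le_cos (x := x h * τ)]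
  have t2 : |E h| ≤ Real.exp (-(Real.pi * a) * hexForm h.1 h.2) := by
    rw [abs_mul, abs_of_pos (Real.exp_pos _)]
    exact mul_le_of_le_one_right (Real.exp_pos _).le (Real.abs_cos_le_one _)
  calc _ ≤ Real.exp (-(Real.pi * a) * hexForm h.1 h.2) * x h ^ 2 := by gcongr
    _ = _ := by simp only [hx]; ring

/-- Both sides are the limit of the same second difference quotient, computed on the two sides of
`tsum_exp_hexForm_mul_cos`. -/
lemma tsum_linear_sq_cos_eq {a : ℝ} (ha : 0 < a) (s t y₁ y₂ : ℝ) :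
    -(4 * Real.pi ^ 2) * ∑' h : ℤ × ℤ, (h.1 * y₁ + h.2 * y₂) ^ 2 *
        (Real.exp (-(Real.pi * a) * hexForm h.1 h.2) * Real.cos (2 * Real.pi * (h.1 * s - h.2 * t))) =
      2 / (√3 * a) * (4 * Real.pi / (3 * a)) ^ 2 *
        hexMoment (4 * Real.pi / (3 * a)) (2 * y₁ - y₂) (y₁ - 2 * y₂) s t -
      2 * (4 * Real.pi / (3 * a)) * (y₁ ^ 2 - y₁ * y₂ + y₂ ^ 2) * ∑' h : ℤ × ℤ,
        Real.exp (-(Real.pi * a) * hexForm h.1 h.2) * Real.cos (2 * Real.pi * (h.1 * s - h.2 * t)) := by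
  have hb : 0 < 4 * Real.pi / (3 * a) := by positivity
  have h1 := tendsto_second_difference_cos ha s t y₁ y₂
  have h2 := (tendsto_second_difference_hexForm hb s t y₁ (-y₂)).const_mul (2 / (√3 * a))
  refine (tendsto_nhds_unique h1 (h2.congr fun τ => ?_)).trans ?_
  · simp_rw [tsum_exp_hexForm_mul_cos ha]
    ring
  · rw [tsum_exp_hexForm_mul_cos ha]
    rw [show y₁ ^ 2 - y₁ * y₂ + y₂ ^ 2 = hexForm y₁ (-y₂) by unfold hexForm; ring,
      show 2 * y₁ + -y₂ = 2 * y₁ - y₂ by ring, show y₁ + 2 * -y₂ = y₁ - 2 * y₂ by ring]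
    ring

/-- The dynamical matrix of a Gaussian on the hexagonal lattice, evaluated on both sides of
Poisson summation. -/
lemma tsum_dynamical_eq {a : ℝ} (ha : 0 < a) (s t y₁ y₂ : ℝ) :
    ∑' h : ℤ × ℤ, Real.exp (-(Real.pi * a) * hexForm h.1 h.2) *
        (1 - Real.cos (2 * Real.pi * (h.1 * s - h.2 * t))) *
        (4 * Real.pi ^ 2 * (h.1 * y₁ + h.2 * y₂) ^ 2 -
          2 * (4 * Real.pi / (3 * a)) * (y₁ ^ 2 - y₁ * y₂ + y₂ ^ 2)) =
      2 / (√3 * a) * (4 * Real.pi / (3 * a)) ^ 2 *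
        (hexMoment (4 * Real.pi / (3 * a)) (2 * y₁ - y₂) (y₁ - 2 * y₂) s t -
          hexMoment (4 * Real.pi / (3 * a)) (2 * y₁ - y₂) (y₁ - 2 * y₂) 0 0) := by
  have h1 := tsum_linear_sq_cos_eq ha s t y₁ y₂
  have h0 := tsum_linear_sq_cos_eq ha 0 0 y₁ y₂
  set E : ℤ × ℤ → ℝ := fun h => Real.exp (-(Real.pi * a) * hexForm h.1 h.2) with hE
  set κ := 2 * (4 * Real.pi / (3 * a)) * (y₁ ^ 2 - y₁ * y₂ + y₂ ^ 2) with hκ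
  have S1 := summable_linear_sq_mul_exp_hexForm_mul_cos ha y₁ y₂ (fun h => 2 * Real.pi * (h.1 * s - h.2 * t))
  have S2 := summable_linear_sq_mul_exp_hexForm_mul_cos ha y₁ y₂ (fun h => 2 * Real.pi * (h.1 * 0 - h.2 * 0))
  have S3 := summable_exp_hexForm_mul_cos ha (fun h => 2 * Real.pi * (h.1 * s - h.2 * t))
  have S4 := summable_exp_hexForm_mul_cos ha (fun h => 2 * Real.pi * (h.1 * 0 - h.2 * 0))
  have split : ∑' h : ℤ × ℤ, E h * (1 - Real.cos (2 * Real.pi * (h.1 * s - h.2 * t))) *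
      (4 * Real.pi ^ 2 * (h.1 * y₁ + h.2 * y₂) ^ 2 - κ) =
      (4 * Real.pi ^ 2 * ∑' h : ℤ × ℤ, (h.1 * y₁ + h.2 * y₂) ^ 2 *
        (E h * Real.cos (2 * Real.pi * (h.1 * 0 - h.2 * 0))) -
      κ * ∑' h : ℤ × ℤ, E h * Real.cos (2 * Real.pi * (h.1 * 0 - h.2 * 0))) -
      (4 * Real.pi ^ 2 * ∑' h : ℤ × ℤ, (h.1 * y₁ + h.2 * y₂) ^ 2 *
        (E h * Real.cos (2 * Real.pi * (h.1 * s - h.2 * t))) -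
      κ * ∑' h : ℤ × ℤ, E h * Real.cos (2 * Real.pi * (h.1 * s - h.2 * t))) := by
    rw [← tsum_mul_left, ← tsum_mul_left, ← tsum_mul_left, ← tsum_mul_left,
      ← Summable.tsum_sub (S2.mul_left _) (S4.mul_left _), ← Summable.tsum_sub (S1.mul_left _) (S3.mul_left _),
      ← Summable.tsum_sub ((S2.mul_left _).sub (S4.mul_left _)) ((S1.mul_left _).sub (S3.mul_left _))]
    refine tsum_congr fun h => ?_
    have hc : Real.cos (2 * Real.pi * (h.1 * 0 - h.2 * 0)) = 1 := by simp
    rw [hc]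
    ring
  rw [split]
  -- Subtracting the identity at wave vector zero cancels the κ terms, so only the difference of
  -- second moments survives.
  linear_combination h1 - h0

/-! ### Coercivity on the direct side: averaging over 120° rotations. -/

/-- Rotation by 120 degrees of the hexagonal lattice, in coordinates. -/
def hexRot : ℤ × ℤ ≃ ℤ × ℤ where
  toFun h := (-h.1 - h.2, h.1)
  invFun h := (h.2, -h.1 - h.2)
  left_inv h := Prod.ext rfl (by dsimp only; ring)
  right_inv h := Prod.ext (by dsimp only; ring) rfl

lemma hexForm_hexRot (h : ℤ × ℤ) : hexForm (hexRot h).1 (hexRot h).2 = hexForm h.1 h.2 := by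
  simp only [hexRot, Equiv.coe_fn_mk, hexForm]; push_cast; ring

/-- Summation over the orbits of the rotation. -/
lemma three_mul_tsum_eq {f : ℤ × ℤ → ℝ} (hf : Summable f) :
    3 * ∑' h, f h = ∑' h, (f h + f (hexRot h) + f (hexRot (hexRot h))) := by
  have h1 : Summable fun h => f (hexRot h) := (hexRot.summable_iff (f := f)).mpr hf
  have h2 : Summable fun h => f (hexRot (hexRot h)) :=
    (hexRot.summable_iff (f := fun h => f (hexRot h))).mpr h1
  rw [(hf.add h1).tsum_add h2, hf.tsum_add h1, hexRot.tsum_eq f,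
    hexRot.tsum_eq (fun h => f (hexRot h)), hexRot.tsum_eq f]
  ring

lemma summable_orbit {f : ℤ × ℤ → ℝ} (hf : Summable f) :
    Summable fun h => f h + f (hexRot h) + f (hexRot (hexRot h)) := by
  have h1 : Summable fun h => f (hexRot h) := (hexRot.summable_iff (f := f)).mpr hf
  exact (hf.add h1).add ((hexRot.summable_iff (f := fun h => f (hexRot h))).mpr h1)

/-- The difference of the two sides is a binary form of positive trace when the weights are not all
zero. Its determinant is w₁w₂ + w₂w₃ + w₃w₁ - (w₁ + w₂ + w₃)²/4, whose nonnegativity is exactly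
`hw`. Geometrically, no direction receives too small a share of the three weighted projections at
120°. -/
lemma weighted_squares_ge {w₁ w₂ w₃ : ℝ} (h₁ : 0 ≤ w₁) (h₂ : 0 ≤ w₂) (h₃ : 0 ≤ w₃)
    (hw : w₁ ^ 2 + w₂ ^ 2 + w₃ ^ 2 ≤ 2 * (w₁ * w₂ + w₂ * w₃ + w₃ * w₁)) (x y : ℝ) :
    (x ^ 2 + x * y + y ^ 2) / 3 * (w₁ + w₂ + w₃) ≤ w₁ * x ^ 2 + w₂ * y ^ 2 + w₃ * (x + y) ^ 2 := by
  rcases (add_nonneg (add_nonneg h₁ h₂) h₃).eq_or_lt with hW | hW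
  · have a1 : w₁ = 0 := by linarith
    have a2 : w₂ = 0 := by linarith
    have a3 : w₃ = 0 := by linarith
    simp [a1, a2, a3]
  · set p := w₁ + w₃ - (w₁ + w₂ + w₃) / 3 with hp
    set q := w₂ + w₃ - (w₁ + w₂ + w₃) / 3 with hq
    set o := w₃ - (w₁ + w₂ + w₃) / 6 with ho
    have hpq : 0 < p + q := by simp only [hp, hq]; linarith
    have hdet : 0 ≤ p * q - o ^ 2 := by simp only [hp, hq, ho]; nlinarith
    have key : 0 ≤ (p + q) * (p * x ^ 2 + 2 * o * x * y + q * y ^ 2) := by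
      have : (p + q) * (p * x ^ 2 + 2 * o * x * y + q * y ^ 2) =
          (p * x + o * y) ^ 2 + (o * x + q * y) ^ 2 + (p * q - o ^ 2) * (x ^ 2 + y ^ 2) := by ring
      rw [this]; positivity
    have := nonneg_of_mul_nonneg_right key hpq
    simp only [hp, hq, ho] at this
    nlinarith

/-- The defect is exactly twice the product of the three factors 1 - cos. With 1 - cos φ = 2 sin²
(φ/2) this is a Heron type formula. -/
lemma one_sub_cos_heron (φ ψ : ℝ) :
    (1 - Real.cos φ) ^ 2 + (1 - Real.cos ψ) ^ 2 + (1 - Real.cos (φ + ψ)) ^ 2 ≤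
      2 * ((1 - Real.cos φ) * (1 - Real.cos ψ) + (1 - Real.cos ψ) * (1 - Real.cos (φ + ψ)) +
        (1 - Real.cos (φ + ψ)) * (1 - Real.cos φ)) := by
  have key : 2 * ((1 - Real.cos φ) * (1 - Real.cos ψ) + (1 - Real.cos ψ) * (1 - Real.cos (φ + ψ)) +
        (1 - Real.cos (φ + ψ)) * (1 - Real.cos φ)) - ((1 - Real.cos φ) ^ 2 + (1 - Real.cos ψ) ^ 2 +
        (1 - Real.cos (φ + ψ)) ^ 2) =
      2 * (1 - Real.cos φ) * (1 - Real.cos ψ) * (1 - Real.cos (φ + ψ)) := by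
    rw [Real.cos_add]
    have h1 := Real.sin_sq_add_cos_sq φ
    have h2 := Real.sin_sq_add_cos_sq ψ
    linear_combination (-(Real.sin ψ) ^ 2) * h1 + (Real.cos φ ^ 2 - 1) * h2
  have : 0 ≤ 2 * (1 - Real.cos φ) * (1 - Real.cos ψ) * (1 - Real.cos (φ + ψ)) :=
    mul_nonneg (mul_nonneg (mul_nonneg zero_le_two (by linarith [Real.cos_le_one φ]))
      (by linarith [Real.cos_le_one ψ])) (by linarith [Real.cos_le_one (φ + ψ)])
  linarith

/-- The sum of `1 - cos` over the three shortest directions of the hexagonal lattice. -/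
def hexWeight (s t : ℝ) : ℝ :=
  (1 - Real.cos (2 * Real.pi * s)) + (1 - Real.cos (2 * Real.pi * t)) +
    (1 - Real.cos (2 * Real.pi * (s + t)))

lemma hexWeight_nonneg (s t : ℝ) : 0 ≤ hexWeight s t := by
  unfold hexWeight
  linarith [Real.cos_le_one (2 * Real.pi * s), Real.cos_le_one (2 * Real.pi * t),
    Real.cos_le_one (2 * Real.pi * (s + t))]

/-- The summand of the dynamical matrix. -/
def dynTerm (a s t y₁ y₂ : ℝ) (h : ℤ × ℤ) : ℝ :=
  Real.exp (-(Real.pi * a) * hexForm h.1 h.2) * (1 - Real.cos (2 * Real.pi * (h.1 * s - h.2 * t))) *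
    (4 * Real.pi ^ 2 * (h.1 * y₁ + h.2 * y₂) ^ 2 -
      2 * (4 * Real.pi / (3 * a)) * (y₁ ^ 2 - y₁ * y₂ + y₂ ^ 2))

lemma summable_dynTerm {a : ℝ} (ha : 0 < a) (s t y₁ y₂ : ℝ) : Summable (dynTerm a s t y₁ y₂) := by
  set κ := 2 * (4 * Real.pi / (3 * a)) * (y₁ ^ 2 - y₁ * y₂ + y₂ ^ 2) with hκ
  have S1 := summable_linear_sq_mul_exp_hexForm_mul_cos ha y₁ y₂ (fun h => 2 * Real.pi * (h.1 * s - h.2 * t))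
  have S2 := summable_linear_sq_mul_exp_hexForm_mul_cos ha y₁ y₂ (fun _ => 0)
  have S3 := summable_exp_hexForm_mul_cos ha (fun h => 2 * Real.pi * (h.1 * s - h.2 * t))
  have S4 := summable_exp_hexForm_mul_cos ha (fun _ => 0)
  refine (((S2.mul_left (4 * Real.pi ^ 2)).sub (S4.mul_left κ)).sub
    ((S1.mul_left (4 * Real.pi ^ 2)).sub (S3.mul_left κ))).congr fun h => ?_
  simp only [dynTerm, Real.cos_zero]
  ring

/-- The three phases of an orbit sum to zero, so `one_sub_cos_heron` supplies the hypothesis of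
`weighted_squares_ge`. The last factor on the left is nonnegative precisely when π a `hexForm h.1
h.2` ≥ 2 (for a nonzero y). -/
lemma dynTerm_orbit_ge {a : ℝ} (s t y₁ y₂ : ℝ) (h : ℤ × ℤ) :
    Real.exp (-(Real.pi * a) * hexForm h.1 h.2) *
      ((1 - Real.cos (2 * Real.pi * (h.1 * s - h.2 * t))) +
       (1 - Real.cos (2 * Real.pi * ((-h.1 - h.2) * s - h.1 * t))) +
       (1 - Real.cos (2 * Real.pi * (h.2 * s - (-h.1 - h.2) * t)))) *
      ((y₁ ^ 2 - y₁ * y₂ + y₂ ^ 2) * (4 * Real.pi ^ 2 / 3 * hexForm h.1 h.2 - 2 * (4 * Real.pi / (3 * a)))) ≤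
    dynTerm a s t y₁ y₂ h + dynTerm a s t y₁ y₂ (hexRot h) + dynTerm a s t y₁ y₂ (hexRot (hexRot h)) := by
  set w₁ := 1 - Real.cos (2 * Real.pi * (h.1 * s - h.2 * t)) with hw₁
  set w₂ := 1 - Real.cos (2 * Real.pi * ((-h.1 - h.2) * s - h.1 * t)) with hw₂
  set w₃ := 1 - Real.cos (2 * Real.pi * (h.2 * s - (-h.1 - h.2) * t)) with hw₃
  set E := Real.exp (-(Real.pi * a) * hexForm h.1 h.2) with hE
  set Y := y₁ ^ 2 - y₁ * y₂ + y₂ ^ 2 with hY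
  set x := h.1 * y₁ + h.2 * y₂ with hx
  set y := (-h.1 - h.2) * y₁ + h.1 * y₂ with hy
  have hw3' : w₃ = 1 - Real.cos (2 * Real.pi * (h.1 * s - h.2 * t) +
      2 * Real.pi * ((-h.1 - h.2) * s - h.1 * t)) := by
    rw [hw₃, ← Real.cos_neg]; congr 2; ring
  have hheron : w₁ ^ 2 + w₂ ^ 2 + w₃ ^ 2 ≤ 2 * (w₁ * w₂ + w₂ * w₃ + w₃ * w₁) := by
    rw [hw3']; exact one_sub_cos_heron _ _
  have key := weighted_squares_ge (w₁ := w₁) (w₂ := w₂) (w₃ := w₃) (by linarith [Real.cos_le_one (2 * Real.pi * (h.1 * s - h.2 * t))])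
    (by linarith [Real.cos_le_one (2 * Real.pi * ((-h.1 - h.2) * s - h.1 * t))])
    (by linarith [Real.cos_le_one (2 * Real.pi * (h.2 * s - (-h.1 - h.2) * t))]) hheron x y
  have hxy : x ^ 2 + x * y + y ^ 2 = hexForm h.1 h.2 * Y := by
    simp only [hx, hy, hY, hexForm]; ring
  rw [hxy] at key
  have hsum : dynTerm a s t y₁ y₂ h + dynTerm a s t y₁ y₂ (hexRot h) + dynTerm a s t y₁ y₂ (hexRot (hexRot h)) =
      E * (4 * Real.pi ^ 2 * (w₁ * x ^ 2 + w₂ * y ^ 2 + w₃ * (x + y) ^ 2) -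
        2 * (4 * Real.pi / (3 * a)) * Y * (w₁ + w₂ + w₃)) := by
    have e3 : -((-h.1 - h.2 : ℤ)) - h.1 = h.2 := by ring
    simp only [dynTerm, hexForm_hexRot]
    simp only [hexRot, Equiv.coe_fn_mk, e3, Int.cast_sub, Int.cast_neg]
    rw [← hE, ← hw₁, ← hw₂, ← hw₃, ← hx, ← hy, ← hY]
    have : (h.2 : ℝ) * y₁ + (-h.1 - h.2) * y₂ = -(x + y) := by simp only [hx, hy]; ring
    rw [this]; ring
  rw [hsum, mul_assoc]
  refine mul_le_mul_of_nonneg_left ?_ (Real.exp_pos _).le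
  have : 0 ≤ 4 * Real.pi ^ 2 := by positivity
  nlinarith [mul_le_mul_of_nonneg_left key this]

lemma quad_nonneg (y₁ y₂ : ℝ) : 0 ≤ y₁ ^ 2 - y₁ * y₂ + y₂ ^ 2 := by
  nlinarith [sq_nonneg (y₁ - y₂), sq_nonneg y₁, sq_nonneg y₂]

/-- Coercivity of the dynamical matrix when the nearest-neighbour interaction is convex enough. -/
lemma tsum_dynTerm_ge_of_large {a : ℝ} (ha : 2 ≤ Real.pi * a) (s t y₁ y₂ : ℝ) :
    8 * Real.pi / (9 * a) * (Real.pi * a / 2 - 1) * Real.exp (-(Real.pi * a)) * hexWeight s t *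
      (y₁ ^ 2 - y₁ * y₂ + y₂ ^ 2) ≤ ∑' h, dynTerm a s t y₁ y₂ h := by
  have hπ := Real.pi_pos
  have ha0 : 0 < a := by
    by_contra hc
    nlinarith [mul_nonneg hπ.le (not_lt.mp hc |> neg_nonneg.mpr)]
  have hY := quad_nonneg y₁ y₂
  have hS := summable_dynTerm ha0 s t y₁ y₂
  have h3 := three_mul_tsum_eq hS
  have hnn : ∀ h : ℤ × ℤ, 0 ≤ dynTerm a s t y₁ y₂ h + dynTerm a s t y₁ y₂ (hexRot h) +
      dynTerm a s t y₁ y₂ (hexRot (hexRot h)) := by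
    intro h
    by_cases hh : h = 0
    · subst hh
      simp [dynTerm, hexRot]
    refine le_trans ?_ (dynTerm_orbit_ge s t y₁ y₂ h)
    have hN := one_le_hexForm hh
    refine mul_nonneg (mul_nonneg (Real.exp_pos _).le ?_) (mul_nonneg hY ?_)
    · linarith [Real.cos_le_one (2 * Real.pi * (h.1 * s - h.2 * t)),
        Real.cos_le_one (2 * Real.pi * ((-h.1 - h.2) * s - h.1 * t)),
        Real.cos_le_one (2 * Real.pi * (h.2 * s - (-h.1 - h.2) * t))]
    · have : 2 * (4 * Real.pi / (3 * a)) ≤ 4 * Real.pi ^ 2 / 3 := by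
        rw [mul_div_assoc', div_le_div_iff₀ (by positivity) (by positivity)]
        nlinarith [mul_le_mul_of_nonneg_left ha hπ.le]
      nlinarith [sq_nonneg Real.pi]
  -- All orbit sums being nonnegative, only that of (1, 0) is kept; its three phases make up
  -- `hexWeight s t`.
  have h4 := (summable_orbit hS).le_tsum (1, 0) (fun h _ => hnn h)
  have h5 := dynTerm_orbit_ge (a := a) s t y₁ y₂ (1, 0)
  have e1 : 2 * Real.pi * ((-1 - 0) * s - 1 * t) = -(2 * Real.pi * (s + t)) := by ring
  have e2 : 2 * Real.pi * (0 * s - (-1 - 0) * t) = 2 * Real.pi * t := by ring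
  have e3 : 2 * Real.pi * (1 * s - 0 * t) = 2 * Real.pi * s := by ring
  simp only [Int.cast_one, Int.cast_zero, e1, e2, e3, Real.cos_neg] at h5
  have e4 : hexForm 1 0 = 1 := by norm_num [hexForm]
  rw [e4, mul_one] at h5
  have h6 : 8 * Real.pi / (9 * a) * (Real.pi * a / 2 - 1) * Real.exp (-(Real.pi * a)) * hexWeight s t *
      (y₁ ^ 2 - y₁ * y₂ + y₂ ^ 2) * 3 = Real.exp (-(Real.pi * a)) *
      (1 - Real.cos (2 * Real.pi * s) + (1 - Real.cos (2 * Real.pi * (s + t))) + (1 - Real.cos (2 * Real.pi * t))) *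
      ((y₁ ^ 2 - y₁ * y₂ + y₂ ^ 2) * (4 * Real.pi ^ 2 / 3 * 1 - 2 * (4 * Real.pi / (3 * a)))) := by
    unfold hexWeight; field_simp; ring
  linarith

/-! ### Second moments on the dual side: short wave vectors. -/

lemma pow_succ_ge_tangent {x y : ℝ} (hx : 0 ≤ x) (hy : 0 ≤ y) (n : ℕ) :
    x ^ (n + 1) + (n + 1) * x ^ n * (y - x) ≤ y ^ (n + 1) := by
  induction n with
  | zero => simp
  | succ n ih =>
    have h1 := mul_le_mul_of_nonneg_left ih hy
    have h2 : 0 ≤ ((n : ℝ) + 1) * x ^ n * (y - x) ^ 2 := by positivity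
    push_cast
    calc _ = y * (x ^ (n + 1) + (n + 1) * x ^ n * (y - x)) - ((n : ℝ) + 1) * x ^ n * (y - x) ^ 2 := by ring
      _ ≤ y * y ^ (n + 1) := by linarith
      _ = _ := by ring

/-- The power series of cosh in the squared variable has nonnegative coefficients, so cosh is convex
and increasing in the square. This is Jensen's inequality, applied term by term through tangent
lines. -/
lemma weighted_cosh_ge {a₁ a₂ a₃ c₁ c₂ c₃ x : ℝ} (h₁ : 0 ≤ a₁) (h₂ : 0 ≤ a₂) (h₃ : 0 ≤ a₃)
    (h : (a₁ + a₂ + a₃) * x ^ 2 ≤ a₁ * c₁ ^ 2 + a₂ * c₂ ^ 2 + a₃ * c₃ ^ 2) :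
    (a₁ + a₂ + a₃) * Real.cosh x ≤ a₁ * Real.cosh c₁ + a₂ * Real.cosh c₂ + a₃ * Real.cosh c₃ := by
  have H := (Real.hasSum_cosh x).mul_left (a₁ + a₂ + a₃)
  have H' := (((Real.hasSum_cosh c₁).mul_left a₁).add ((Real.hasSum_cosh c₂).mul_left a₂)).add
    ((Real.hasSum_cosh c₃).mul_left a₃)
  refine hasSum_le (fun n => ?_) H H'
  rcases n with _ | n
  · simp
  · have e : ∀ (a c : ℝ), a * (c ^ (2 * (n + 1)) / ((2 * (n + 1)).factorial : ℝ)) =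
      (a * (c ^ 2) ^ (n + 1)) / ((2 * (n + 1)).factorial : ℝ) := by
      intro a c; rw [pow_mul]; ring
    simp only [e]
    rw [← add_div, ← add_div]
    refine div_le_div_of_nonneg_right ?_ (by positivity)
    have t := fun c : ℝ => pow_succ_ge_tangent (sq_nonneg x) (sq_nonneg c) n
    have t1 := mul_le_mul_of_nonneg_left (t c₁) h₁
    have t2 := mul_le_mul_of_nonneg_left (t c₂) h₂
    have t3 := mul_le_mul_of_nonneg_left (t c₃) h₃
    have t4 : 0 ≤ ((n : ℝ) + 1) * (x ^ 2) ^ n *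
        (a₁ * c₁ ^ 2 + a₂ * c₂ ^ 2 + a₃ * c₃ ^ 2 - (a₁ + a₂ + a₃) * x ^ 2) :=
      mul_nonneg (by positivity) (by linarith)
    nlinarith

lemma exp_le_one_add_add_sq {w : ℝ} (h0 : 0 ≤ w) (h : w ≤ 1) : Real.exp w ≤ 1 + w + w ^ 2 := by
  have := Real.abs_exp_sub_one_sub_id_le (x := w) (by rw [abs_of_nonneg h0]; exact h)
  linarith [le_abs_self (Real.exp w - 1 - w)]

lemma one_add_sq_half_le_cosh (z : ℝ) : 1 + z ^ 2 / 2 ≤ Real.cosh z := by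
  have h := Real.hasSum_cosh z
  have := sum_le_hasSum (Finset.range 2) (fun n _ => by rw [pow_mul]; positivity) h
  simpa [Finset.sum_range_succ] using this

/-- The right side is exp (-u k²) cosh² z with z = u k / 2, so it is enough that cosh z exceeds an
exponential with exponent slightly above u k² / 2. -/
lemma exp_mul_cosh_ge {u k : ℝ} (hu : 13 / 2 ≤ u) (hk0 : 0 ≤ k) (hk : k ^ 2 ≤ 1 / 5) :
    1 + k ^ 2 / 10 ≤ Real.exp (-(u * k ^ 2)) * ((1 + Real.cosh (u * k)) / 2) := by
  set z := u * k / 2 with hz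
  have hz0 : 0 ≤ z := by positivity
  have hk1 : k ≤ 0.4473 := by nlinarith
  have hc : (1 + Real.cosh (u * k)) / 2 = Real.cosh z ^ 2 := by
    rw [show u * k = 2 * z by rw [hz]; ring, Real.cosh_two_mul, Real.sinh_sq]; ring
  -- Twice w is u k² + u k²/65, and the surplus u k²/65 is at least k²/10 because u ≥ 13/2.
  set w := 66 / 65 * (z * k) with hw
  have hw0 : 0 ≤ w := by positivity
  have key : Real.exp w ≤ Real.cosh z := by
    -- For small z the bound 1 + z²/2 ≤ cosh z is used, with k ≤ 4z/13; for large z the bound exp z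
    -- / 2 ≤ cosh z, with k ≤ 1/√5.
    rcases le_total z 1.3 with h | h
    · have hw1 : w ≤ 0.3125 * z ^ 2 := by
        have : k ≤ z * (4 / 13) := by rw [hz]; nlinarith
        have := mul_le_mul_of_nonneg_left this hz0
        rw [hw]; nlinarith [sq_nonneg z]
      have hz2 : z ^ 2 ≤ 1.69 := by nlinarith
      refine (exp_le_one_add_add_sq hw0 (by nlinarith)).trans (le_trans ?_ (one_add_sq_half_le_cosh z))
      nlinarith [mul_le_mul hw1 hw1 hw0 (by positivity), sq_nonneg z]
    · have hw1 : w ≤ 0.4542 * z := by rw [hw]; nlinarith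
      have h2 : Real.exp z / 2 ≤ Real.cosh z := by
        rw [Real.cosh_eq]; linarith [Real.exp_pos (-z)]
      refine le_trans ?_ h2
      have h3 : Real.exp (w + Real.log 2) ≤ Real.exp z := by
        refine Real.exp_le_exp.mpr ?_
        linarith [Real.log_two_lt_d9]
      rw [Real.exp_add, Real.exp_log two_pos] at h3
      linarith
  rw [hc]
  have h1 : Real.exp w ^ 2 ≤ Real.cosh z ^ 2 := by gcongr
  have h2 : Real.exp (k ^ 2 / 10) ≤ Real.exp (-(u * k ^ 2)) * Real.exp w ^ 2 := by
    rw [← Real.exp_nat_mul, ← Real.exp_add]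
    refine Real.exp_le_exp.mpr ?_
    have : z * k = u * k ^ 2 / 2 := by rw [hz]; ring
    rw [hw, this]
    push_cast
    nlinarith [sq_nonneg k]
  calc 1 + k ^ 2 / 10 ≤ Real.exp (k ^ 2 / 10) := by linarith [Real.add_one_le_exp (k ^ 2 / 10)]
    _ ≤ _ := h2
    _ ≤ _ := by gcongr

lemma hasSum_pow_natAbs {r : ℝ} (h0 : 0 ≤ r) (h1 : r < 1) :
    HasSum (fun n : ℤ => r ^ n.natAbs) ((1 + r) / (1 - r)) := by
  have hg := hasSum_geometric_of_lt_one h0 h1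
  have hg' : HasSum (fun n : ℕ => r ^ (-((n : ℤ) + 1)).natAbs) (r * (1 - r)⁻¹) := by
    refine (hg.mul_left r).congr_fun ?_
    intro n
    have : (-((n : ℤ) + 1)).natAbs = n + 1 := by omega
    rw [this, pow_succ]; ring
  have := HasSum.of_nat_of_neg_add_one (f := fun n : ℤ => r ^ n.natAbs) (by simpa using hg) hg'
  convert! this using 1
  have : 1 - r ≠ 0 := by linarith
  field_simp

lemma exp_neg_half_lt : Real.exp (-(1 / 2)) < 0.6066 := by
  have h1 : Real.exp (-(1 / 2)) ^ 2 * Real.exp 1 = 1 := by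
    rw [← Real.exp_nat_mul, ← Real.exp_add]; norm_num
  have h2 := Real.exp_one_gt_d9
  have h3 := Real.exp_pos (-(1 / 2))
  by_contra hc
  push Not at hc
  have h4 : (0.6066 : ℝ) ^ 2 ≤ Real.exp (-(1 / 2)) ^ 2 := by gcongr
  nlinarith

lemma exp_neg_six_lt : Real.exp (-6) < 0.00248 := by
  have h1 : Real.exp (-6) * Real.exp 1 ^ 6 = 1 := by
    rw [← Real.exp_nat_mul, ← Real.exp_add]; norm_num
  have h2 : (2.7182 : ℝ) ^ 6 ≤ Real.exp 1 ^ 6 := by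
    have := Real.exp_one_gt_d9
    gcongr; linarith
  have h3 := Real.exp_pos (-6)
  by_contra hc
  push Not at hc
  nlinarith

lemma exp_neg_hexForm_le_pow (h : ℤ × ℤ) :
    Real.exp (-hexForm h.1 h.2) ≤
      Real.exp (-(1 / 2)) ^ h.1.natAbs * Real.exp (-(1 / 2)) ^ h.2.natAbs := by
  rw [← Real.exp_nat_mul, ← Real.exp_nat_mul, ← Real.exp_add]
  refine Real.exp_le_exp.mpr ?_
  have aux : ∀ m : ℤ, (m.natAbs : ℝ) ≤ (m : ℝ) ^ 2 := by
    intro m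
    have : |m| ≤ m ^ 2 := by
      rw [← sq_abs]
      exact Int.le_self_sq |m|
    rw [Nat.cast_natAbs]
    exact_mod_cast this
  have := half_le_hexForm h.1 h.2
  linarith [aux h.1, aux h.2]

/-- The six shortest vectors of the hexagonal lattice. -/
def hexRing : Finset (ℤ × ℤ) := {(1, 0), (0, 1), (-1, 1), (-1, 0), (0, -1), (1, -1)}

/-- The norm m² + m n + n² does not take the value 2. -/
lemma three_le_hexForm {h : ℤ × ℤ} (h0 : h ≠ 0) (hr : h ∉ hexRing) : 3 ≤ hexForm h.1 h.2 := by
  obtain ⟨m, n⟩ := h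
  have key : 3 ≤ m ^ 2 + m * n + n ^ 2 := by
    by_contra hc
    push Not at hc
    have hm : m ^ 2 < 3 ^ 2 := by nlinarith [sq_nonneg (m + n)]
    have hn : n ^ 2 < 3 ^ 2 := by nlinarith [sq_nonneg (m + n)]
    have hm' := abs_lt_of_sq_lt_sq hm (by norm_num)
    have hn' := abs_lt_of_sq_lt_sq hn (by norm_num)
    rw [abs_lt] at hm' hn'
    obtain ⟨m1, m2⟩ := hm'
    obtain ⟨n1, n2⟩ := hn'
    interval_cases m <;> interval_cases n <;> simp_all [hexRing]
  unfold hexForm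
  exact_mod_cast key

/-- The part of `∑ exp (-3 N)` beyond the first shell. -/
def hexTail (h : ℤ × ℤ) : ℝ := if 3 ≤ hexForm h.1 h.2 then Real.exp (-(3 * hexForm h.1 h.2)) else 0

lemma hexTail_nonneg (h : ℤ × ℤ) : 0 ≤ hexTail h := by
  unfold hexTail; split_ifs <;> positivity

/-- For N ≥ 3, exp (-3N) ≤ exp (-6) exp (-N), and exp (-N) is at most a product of two geometric
terms of ratio exp (-1/2). The geometric sums are computed exactly. -/
lemma summable_hexTail_and_tsum_le : Summable hexTail ∧ ∑' h, hexTail h ≤ 1 / 20 := by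
  set r := Real.exp (-(1 / 2)) with hr
  have hr0 : 0 < r := Real.exp_pos _
  have hr1 : r < 0.6066 := exp_neg_half_lt
  have H := hasSum_pow_natAbs hr0.le (by linarith)
  have H2s : Summable fun h : ℤ × ℤ => r ^ h.1.natAbs * r ^ h.2.natAbs :=
    H.summable.mul_of_nonneg H.summable (fun _ => by positivity) (fun _ => by positivity)
  have H2 := (H.mul H H2s).mul_left (Real.exp (-6))
  have hle : ∀ h : ℤ × ℤ, hexTail h ≤ Real.exp (-6) * (r ^ h.1.natAbs * r ^ h.2.natAbs) := by
    intro h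
    unfold hexTail
    split_ifs with h3
    · calc Real.exp (-(3 * hexForm h.1 h.2)) ≤ Real.exp (-6) * Real.exp (-hexForm h.1 h.2) := by
            rw [← Real.exp_add]; exact Real.exp_le_exp.mpr (by linarith)
        _ ≤ _ := by gcongr; exact exp_neg_hexForm_le_pow h
    · positivity
  have hs : Summable hexTail := Summable.of_nonneg_of_le hexTail_nonneg hle H2.summable
  refine ⟨hs, (hs.tsum_le_tsum hle H2.summable).trans ?_⟩
  rw [H2.tsum_eq]
  have h1 : (1 + r) / (1 - r) ≤ 4.084 := by
    rw [div_le_iff₀ (by linarith)]; linarith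
  have h2 : 0 ≤ (1 + r) / (1 - r) := div_nonneg (by linarith) (by linarith)
  have h3 : (1 + r) / (1 - r) * ((1 + r) / (1 - r)) ≤ 4.084 * 4.084 := by gcongr
  have h4 := mul_le_mul exp_neg_six_lt.le h3 (by positivity) (by norm_num)
  exact h4.trans (by norm_num)

/-- Splitting off the origin and the first shell. -/
lemma tsum_le_ring_add_tail {f : ℤ × ℤ → ℝ} (h0 : f 0 = 0) {C : ℝ}
    (hf : ∀ h, h ≠ 0 → h ∉ hexRing → f h ≤ C * hexTail h) (hs : Summable f) (hC : 0 ≤ C) :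
    ∑' h, f h ≤ ∑ h ∈ hexRing, f h + C / 20 := by
  obtain ⟨hS, hT⟩ := summable_hexTail_and_tsum_le
  set g : ℤ × ℤ → ℝ := fun h => if h ∈ hexRing then f h else 0 with hg
  have hgs : HasSum g (∑ h ∈ hexRing, g h) := hasSum_sum_of_ne_finset_zero fun h hh => by simp [hg, hh]
  have hgsum : ∑ h ∈ hexRing, g h = ∑ h ∈ hexRing, f h :=
    Finset.sum_congr rfl fun h hh => by simp [hg, hh]
  calc ∑' h, f h ≤ ∑' h, (g h + C * hexTail h) := by
        refine hs.tsum_le_tsum (fun h => ?_) (hgs.summable.add (hS.mul_left C))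
        by_cases hr : h ∈ hexRing
        · simp only [hg, hr, if_true]
          nlinarith [hexTail_nonneg h]
        · simp only [hg, hr, if_false, zero_add]
          by_cases hh : h = 0
          · rw [hh, h0]; exact mul_nonneg hC (hexTail_nonneg 0)
          · exact hf h hh hr
    _ = ∑ h ∈ hexRing, f h + C * ∑' h, hexTail h := by
        rw [hgs.summable.tsum_add (hS.mul_left C), hgs.tsum_eq, hgsum, tsum_mul_left]
    _ ≤ _ := by nlinarith

lemma sum_hexRing (f : ℤ × ℤ → ℝ) : ∑ h ∈ hexRing, f h =
    f (1, 0) + f (0, 1) + f (-1, 1) + f (-1, 0) + f (0, -1) + f (1, -1) := by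
  unfold hexRing
  repeat rw [Finset.sum_insert (by decide)]
  rw [Finset.sum_singleton]; ring

/-- The polar form of `hexForm`, times two. -/
def hexBilin (s t : ℝ) (h : ℤ × ℤ) : ℝ := h.1 * (2 * s + t) + h.2 * (s + 2 * t)

lemma hexForm_add (s t : ℝ) (h : ℤ × ℤ) :
    hexForm (h.1 + s) (h.2 + t) = hexForm h.1 h.2 + hexBilin s t h + hexForm s t := by
  unfold hexForm hexBilin; ring

lemma hexBilin_sq_le (s t : ℝ) (h : ℤ × ℤ) :
    hexBilin s t h ^ 2 ≤ 4 * (hexForm h.1 h.2 * hexForm s t) := by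
  unfold hexForm hexBilin
  nlinarith [sq_nonneg (h.1 * t - h.2 * s)]

/-- The difference of the two sides is the square of A sinh (c/2) - 2 b cosh (c/2). For a pair ±h,
with A and b the pairings of x with h and with the wave vector, this trades the cross term for part
of the A² term and a loss proportional to b². Losses in b² can be charged to the lattice origin. -/
lemma pair_ge (A b c : ℝ) :
    A ^ 2 * ((1 + Real.cosh c) / 2) - b ^ 2 * (Real.cosh c + 2) ≤
      (A ^ 2 + b ^ 2) * Real.cosh c - 2 * A * b * Real.sinh c := by
  have h1 : Real.cosh c = 2 * Real.sinh (c / 2) ^ 2 + 1 := by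
    conv_lhs => rw [show c = 2 * (c / 2) by ring, Real.cosh_two_mul, Real.cosh_sq]
    ring
  have h2 : Real.sinh c = 2 * Real.sinh (c / 2) * Real.cosh (c / 2) := by
    conv_lhs => rw [show c = 2 * (c / 2) by ring, Real.sinh_two_mul]
  have h3 := Real.cosh_sq (c / 2)
  rw [h1, h2]
  nlinarith [sq_nonneg (A * Real.sinh (c / 2) - 2 * b * Real.cosh (c / 2))]

/-- Symmetrised form of the second moment sum. -/
lemma hexMoment_eq_tsum_cosh {u : ℝ} (hu : 0 < u) (x₁ x₂ s t : ℝ) :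
    (Summable fun h : ℤ × ℤ => Real.exp (-(u * hexForm s t)) * (Real.exp (-u * hexForm h.1 h.2) *
      (((h.1 * x₁ + h.2 * x₂) ^ 2 + (s * x₁ + t * x₂) ^ 2) * Real.cosh (u * hexBilin s t h) -
        2 * (h.1 * x₁ + h.2 * x₂) * (s * x₁ + t * x₂) * Real.sinh (u * hexBilin s t h)))) ∧
    hexMoment u x₁ x₂ s t = ∑' h : ℤ × ℤ, Real.exp (-(u * hexForm s t)) *
      (Real.exp (-u * hexForm h.1 h.2) *
      (((h.1 * x₁ + h.2 * x₂) ^ 2 + (s * x₁ + t * x₂) ^ 2) * Real.cosh (u * hexBilin s t h) -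
        2 * (h.1 * x₁ + h.2 * x₂) * (s * x₁ + t * x₂) * Real.sinh (u * hexBilin s t h))) := by
  have hS := summable_hexMoment hu x₁ x₂ s t
  have hS' : Summable fun h : ℤ × ℤ => (((-h).1 + s) * x₁ + ((-h).2 + t) * x₂) ^ 2 *
      Real.exp (-u * hexForm ((-h).1 + s) ((-h).2 + t)) := by
    have := (Equiv.neg (ℤ × ℤ)).summable_iff.mpr hS
    refine this.congr fun h => ?_
    simp
  have e : ∀ h : ℤ × ℤ, (1 / 2 : ℝ) * (((h.1 + s) * x₁ + (h.2 + t) * x₂) ^ 2 *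
        Real.exp (-u * hexForm (h.1 + s) (h.2 + t)) + (((-h).1 + s) * x₁ + ((-h).2 + t) * x₂) ^ 2 *
      Real.exp (-u * hexForm ((-h).1 + s) ((-h).2 + t))) = Real.exp (-(u * hexForm s t)) *
      (Real.exp (-u * hexForm h.1 h.2) *
      (((h.1 * x₁ + h.2 * x₂) ^ 2 + (s * x₁ + t * x₂) ^ 2) * Real.cosh (u * hexBilin s t h) -
        2 * (h.1 * x₁ + h.2 * x₂) * (s * x₁ + t * x₂) * Real.sinh (u * hexBilin s t h))) := by
    intro h
    have e1 : -u * hexForm (h.1 + s) (h.2 + t) =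
        -(u * hexForm s t) + (-u * hexForm h.1 h.2 + -(u * hexBilin s t h)) := by
      rw [hexForm_add]; ring
    have e2 : -u * hexForm ((-h).1 + s) ((-h).2 + t) =
        -(u * hexForm s t) + (-u * hexForm h.1 h.2 + u * hexBilin s t h) := by
      simp only [Prod.fst_neg, Prod.snd_neg, Int.cast_neg, hexForm, hexBilin]; ring
    rw [e1, e2, Real.exp_add, Real.exp_add, Real.exp_add, Real.exp_add, Real.cosh_eq, Real.sinh_eq]
    simp only [Prod.fst_neg, Prod.snd_neg, Int.cast_neg]
    ring
  refine ⟨((hS.add hS').mul_left (1 / 2)).congr e, ?_⟩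
  simp_rw [← e]
  rw [tsum_mul_left, hS.tsum_add hS']
  have : ∑' h : ℤ × ℤ, (((-h).1 + s) * x₁ + ((-h).2 + t) * x₂) ^ 2 *
      Real.exp (-u * hexForm ((-h).1 + s) ((-h).2 + t)) = hexMoment u x₁ x₂ s t := by
    unfold hexMoment
    rw [← (Equiv.neg (ℤ × ℤ)).tsum_eq]
    simp
  rw [this]
  unfold hexMoment
  ring

lemma summable_exp_mul_cosh_hexBilin {u : ℝ} (hu : 0 < u) (s t : ℝ) :
    Summable fun h : ℤ × ℤ => Real.exp (-u * hexForm h.1 h.2) * Real.cosh (u * hexBilin s t h) := by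
  have h1 := summable_exp_neg_hexForm_shift hu s t
  have h2 := summable_exp_neg_hexForm_shift hu (-s) (-t)
  refine ((h1.add h2).mul_left (Real.exp (u * hexForm s t) / 2)).congr fun h => ?_
  have e1 : -u * hexForm (h.1 + s) (h.2 + t) =
        -(u * hexForm s t) + (-u * hexForm h.1 h.2 + -(u * hexBilin s t h)) := by
      rw [hexForm_add]; ring
  have e2 : -u * hexForm (h.1 + -s) (h.2 + -t) =
        -(u * hexForm s t) + (-u * hexForm h.1 h.2 + u * hexBilin s t h) := by
      simp only [hexForm, hexBilin]; ring
  rw [e1, e2, Real.exp_add, Real.exp_add, Real.exp_add, Real.exp_add, Real.cosh_eq, Real.exp_neg (u * hexForm s t)]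
  field_simp
  ring

/-- For u ≥ 0, cosh (u B) ≤ exp (u |B|)/2 + 1/2, and 1/2 + 2 gives the factor 5/2. -/
lemma exp_mul_cosh_add_two_le (u N B : ℝ) :
    Real.exp (-u * N) * (Real.cosh (u * B) + 2) ≤
      Real.exp (-(u * (N - |B|))) / 2 + 5 / 2 * Real.exp (-u * N) ∨ u < 0 := by
  rcases lt_or_ge u 0 with hu | hu
  · exact Or.inr hu
  left
  have h1 : Real.cosh (u * B) = (Real.exp (u * |B|) + Real.exp (-(u * |B|))) / 2 := by
    rw [← Real.cosh_eq]
    rcases abs_choice B with h | h <;> rw [h]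
    rw [mul_neg, Real.cosh_neg]
  have h2 : Real.exp (-(u * |B|)) ≤ 1 := Real.exp_le_one_iff.mpr (by nlinarith [abs_nonneg B])
  have h3 : Real.exp (-(u * (N - |B|))) = Real.exp (-u * N) * Real.exp (u * |B|) := by
    rw [← Real.exp_add]; ring_nf
  rw [h1, h3]
  nlinarith [Real.exp_pos (-u * N)]

/-- The deviation of the transverse part, summed over all nonzero lattice vectors. -/
def hexDeviation (u s t : ℝ) (h : ℤ × ℤ) : ℝ :=
  if h = 0 then 0 else Real.exp (-u * hexForm h.1 h.2) * (Real.cosh (u * hexBilin s t h) + 2)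

lemma summable_hexDeviation {u : ℝ} (hu : 0 < u) (s t : ℝ) : Summable (hexDeviation u s t) := by
  have h1 := summable_exp_mul_cosh_hexBilin hu s t
  have h2 := (summable_exp_neg_hexForm hu).mul_right 2
  refine Summable.of_nonneg_of_le (fun h => ?_) (fun h => ?_) (h1.add h2)
  · unfold hexDeviation; split_ifs
    · exact le_rfl
    · have := Real.cosh_pos (u * hexBilin s t h); positivity
  · unfold hexDeviation; split_ifs
    · have := Real.cosh_pos (u * hexBilin s t h); positivity
    · rw [mul_add]

lemma exp_neg_685_le : Real.exp (-0.685) ≤ 0.505 := by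
  have h1 : Real.exp (-0.685) = Real.exp (-Real.log 2) * Real.exp (Real.log 2 - 0.685) := by
    rw [← Real.exp_add]; ring_nf
  rw [h1, Real.exp_neg, Real.exp_log two_pos]
  have h2 := Real.log_two_lt_d9
  have h3 := Real.log_two_gt_d9
  have h4 := exp_le_one_add_add_sq (w := Real.log 2 - 0.685) (by linarith) (by linarith)
  nlinarith

/-- These are the b² losses of `pair_ge` in units of the origin term, so the bound 1 says that the
origin can pay for them. At u = 13/2 the first shell contributes about 0.83 and the tail 3/20, so
the margin is small. -/
lemma tsum_hexDeviation_le {u s t : ℝ} (hu : 13 / 2 ≤ u) (ht : 0 ≤ t) (hst : t ≤ s)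
    (hk : hexForm s t ≤ 1 / 5) : ∑' h, hexDeviation u s t h ≤ 1 := by
  have hu0 : 0 < u := by linarith
  have hs : 0 ≤ s := ht.trans hst
  have hk' : s ^ 2 + s * t + t ^ 2 ≤ 1 / 5 := hk
  have hb : ∀ N B : ℝ, Real.exp (-u * N) * (Real.cosh (u * B) + 2) ≤
      Real.exp (-(u * (N - |B|))) / 2 + 5 / 2 * Real.exp (-u * N) :=
    fun N B => (exp_mul_cosh_add_two_le u N B).resolve_right (by linarith)
  have hrest : ∀ h : ℤ × ℤ, h ≠ 0 → h ∉ hexRing → hexDeviation u s t h ≤ 3 * hexTail h := by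
    intro h h0 hr
    have h3 := three_le_hexForm h0 hr
    unfold hexDeviation hexTail
    rw [if_neg h0, if_pos h3]
    refine (hb _ _).trans ?_
    set N := hexForm h.1 h.2 with hN
    -- Cauchy-Schwarz gives B² ≤ 4N/5 ≤ (4/15) N² for N ≥ 3, hence u (N - |B|) ≥ 3N.
    have hB : |hexBilin s t h| ≤ 0.5165 * N := by
      refine abs_le_of_sq_le_sq ?_ (by positivity)
      have := hexBilin_sq_le s t h
      nlinarith
    have e1 : Real.exp (-(u * (N - |hexBilin s t h|))) ≤ Real.exp (-(3 * N)) :=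
      Real.exp_le_exp.mpr (by nlinarith)
    have e2 : Real.exp (-u * N) ≤ Real.exp (-(3 * N)) := Real.exp_le_exp.mpr (by nlinarith)
    linarith
  refine (tsum_le_ring_add_tail (by simp [hexDeviation]) hrest (summable_hexDeviation hu0 s t)
    (by norm_num)).trans ?_
  have hring : ∀ h : ℤ × ℤ, h ≠ 0 → hexForm h.1 h.2 = 1 → ∀ B : ℝ, |hexBilin s t h| = B →
      hexDeviation u s t h ≤ Real.exp (-(u * (1 - B))) / 2 + 5 / 2 * Real.exp (-6) := by
    intro h h0 h1 B hB
    unfold hexDeviation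
    rw [if_neg h0]
    refine (hb _ _).trans ?_
    rw [hB, h1]
    have : Real.exp (-u * 1) ≤ Real.exp (-6) := Real.exp_le_exp.mpr (by linarith)
    linarith
  -- With k² = `hexForm s t` ≤ 1/5 the three numbers are at most 2k, √3 k and k, using 0 ≤ t ≤ s.
  -- The exponents u (1 - B) are then at least 1, 2 and 5 times 0.685.
  have p1 : 2 * s + t ≤ 0.8945 := by nlinarith [sq_nonneg t]
  have p2 : s + 2 * t ≤ 0.7746 := by nlinarith
  have p3 : s - t ≤ 0.4473 := by nlinarith [mul_nonneg hs ht]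
  have q1 : Real.exp (-(u * (1 - (2 * s + t)))) ≤ 0.505 :=
    le_trans (Real.exp_le_exp.mpr (by nlinarith)) exp_neg_685_le
  have q2 : Real.exp (-(u * (1 - (s + 2 * t)))) ≤ 0.505 ^ 2 := by
    refine le_trans ?_ (pow_le_pow_left₀ (Real.exp_pos _).le exp_neg_685_le 2)
    rw [← Real.exp_nat_mul]
    exact Real.exp_le_exp.mpr (by push_cast; nlinarith)
  have q3 : Real.exp (-(u * (1 - (s - t)))) ≤ 0.505 ^ 5 := by
    refine le_trans ?_ (pow_le_pow_left₀ (Real.exp_pos _).le exp_neg_685_le 5)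
    rw [← Real.exp_nat_mul]
    exact Real.exp_le_exp.mpr (by push_cast; nlinarith)
  have r1 := hring (1, 0) (by decide) (by norm_num [hexForm]) (2 * s + t)
    (by simp only [hexBilin]; push_cast; rw [← abs_of_nonneg (show 0 ≤ 2 * s + t by linarith)]; congr 1; rw [abs_of_nonneg (show 0 ≤ 2 * s + t by linarith)]; ring)
  have r2 := hring (0, 1) (by decide) (by norm_num [hexForm]) (s + 2 * t)
    (by simp only [hexBilin]; push_cast; rw [abs_of_nonneg (by linarith)]; ring)
  have r3 := hring (-1, 1) (by decide) (by norm_num [hexForm]) (s - t)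
    (by simp only [hexBilin]; push_cast; rw [abs_of_nonpos (by linarith)]; ring)
  have r4 := hring (-1, 0) (by decide) (by norm_num [hexForm]) (2 * s + t)
    (by simp only [hexBilin]; push_cast; rw [abs_of_nonpos (by linarith)]; ring)
  have r5 := hring (0, -1) (by decide) (by norm_num [hexForm]) (s + 2 * t)
    (by simp only [hexBilin]; push_cast; rw [abs_of_nonpos (by linarith)]; ring)
  have r6 := hring (1, -1) (by decide) (by norm_num [hexForm]) (s - t)
    (by simp only [hexBilin]; push_cast; rw [abs_of_nonneg (by linarith)]; ring)
  rw [sum_hexRing]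
  have := exp_neg_six_lt
  norm_num at q1 q2 q3 this ⊢
  linarith

lemma summable_sq_mul_exp_shift {u : ℝ} (hu : 0 < u) (x₁ x₂ s t : ℝ) :
    Summable fun h : ℤ × ℤ => (h.1 * x₁ + h.2 * x₂) ^ 2 * Real.exp (-u * hexForm (h.1 + s) (h.2 + t)) := by
  refine summable_of_le_pow_mul_exp (c := u / 4) (by positivity) 1
    (C := 2 * (x₁ ^ 2 + x₂ ^ 2) * Real.exp (u * (s ^ 2 + t ^ 2) / 2)) fun h => ?_
  rw [abs_of_nonneg (by positivity)]
  have h1 := linear_sq_le h.1 h.2 0 0 x₁ x₂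
  simp only [add_zero] at h1
  calc _ ≤ (2 * (x₁ ^ 2 + x₂ ^ 2) * (1 + 0 ^ 2 + 0 ^ 2) * (1 + ((h.1 : ℝ) ^ 2 + (h.2 : ℝ) ^ 2))) *
        (Real.exp (u * (s ^ 2 + t ^ 2) / 2) * Real.exp (-(u / 4) * ((h.1 : ℝ) ^ 2 + (h.2 : ℝ) ^ 2))) :=
        mul_le_mul (by simpa using h1) (exp_neg_hexForm_shift_le hu.le _ _ _ _)
          (Real.exp_pos _).le (by positivity)
    _ = _ := by ring

/-- The transverse contribution of a lattice vector. -/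
def hexTransverse (u s t x₁ x₂ : ℝ) (h : ℤ × ℤ) : ℝ :=
  Real.exp (-u * hexForm h.1 h.2) * (h.1 * x₁ + h.2 * x₂) ^ 2 *
    (Real.exp (-(u * hexForm s t)) * ((1 + Real.cosh (u * hexBilin s t h)) / 2) - 1)

lemma summable_hexTransverse {u : ℝ} (hu : 0 < u) (s t x₁ x₂ : ℝ) :
    Summable (hexTransverse u s t x₁ x₂) := by
  have h1 := summable_sq_mul_exp_shift hu x₁ x₂ s t
  have h2 := summable_sq_mul_exp_shift hu x₁ x₂ (-s) (-t)
  have h3 := summable_sq_mul_exp_shift hu x₁ x₂ 0 0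
  refine (((h1.add h2).mul_left (1 / 4)).add
    (h3.mul_left (Real.exp (-(u * hexForm s t)) / 2 - 1))).congr fun h => ?_
  have e1 : -u * hexForm (h.1 + s) (h.2 + t) =
        -(u * hexForm s t) + (-u * hexForm h.1 h.2 + -(u * hexBilin s t h)) := by
      rw [hexForm_add]; ring
  have e2 : -u * hexForm (h.1 + -s) (h.2 + -t) =
        -(u * hexForm s t) + (-u * hexForm h.1 h.2 + u * hexBilin s t h) := by
      simp only [hexForm, hexBilin]; ring
  unfold hexTransverse
  rw [e1, e2, Real.exp_add, Real.exp_add, Real.exp_add, Real.exp_add, Real.cosh_eq, add_zero, add_zero]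
  ring

/-- Averaging the transverse contributions over an orbit of lines, in real variables. -/
lemma orbit_average_ge {u s t m n x₁ x₂ : ℝ} (hu : 13 / 2 ≤ u) (hk : hexForm s t ≤ 1 / 5)
    (hN1 : 1 ≤ hexForm m n) :
    hexForm m n * (x₁ ^ 2 - x₁ * x₂ + x₂ ^ 2) * (hexForm s t / 5) ≤
      (m * x₁ + n * x₂) ^ 2 * (Real.exp (-(u * hexForm s t)) *
        ((1 + Real.cosh (u * (m * (2 * s + t) + n * (s + 2 * t)))) / 2) - 1) +
      ((-m - n) * x₁ + m * x₂) ^ 2 * (Real.exp (-(u * hexForm s t)) *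
        ((1 + Real.cosh (u * ((-m - n) * (2 * s + t) + m * (s + 2 * t)))) / 2) - 1) +
      (n * x₁ + (-m - n) * x₂) ^ 2 * (Real.exp (-(u * hexForm s t)) *
        ((1 + Real.cosh (u * (n * (2 * s + t) + (-m - n) * (s + 2 * t)))) / 2) - 1) := by
  set A₁ := m * x₁ + n * x₂ with hA₁
  set A₂ := (-m - n) * x₁ + m * x₂ with hA₂
  set A₃ := n * x₁ + (-m - n) * x₂ with hA₃
  set B₁ := m * (2 * s + t) + n * (s + 2 * t) with hB₁
  set B₂ := (-m - n) * (2 * s + t) + m * (s + 2 * t) with hB₂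
  set B₃ := n * (2 * s + t) + (-m - n) * (s + 2 * t) with hB₃
  have hA : A₁ ^ 2 + A₂ ^ 2 + A₃ ^ 2 = 2 * hexForm m n * (x₁ ^ 2 - x₁ * x₂ + x₂ ^ 2) := by
    simp only [hA₁, hA₂, hA₃, hexForm]; ring
  have hAB : A₁ ^ 2 * B₁ ^ 2 + A₂ ^ 2 * B₂ ^ 2 + A₃ ^ 2 * B₃ ^ 2 =
      hexForm m n ^ 2 * (2 * (x₁ ^ 2 - x₁ * x₂ + x₂ ^ 2) * hexForm s t + 3 * (s * x₁ + t * x₂) ^ 2) := by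
    simp only [hA₁, hA₂, hA₃, hB₁, hB₂, hB₃, hexForm]; ring
  have hκ0 := hexForm_nonneg s t
  have hX0 := quad_nonneg x₁ x₂
  have hP0 : 0 < Real.exp (-(u * hexForm s t)) := Real.exp_pos _
  have hk2 : √(hexForm s t) ^ 2 = hexForm s t := Real.sq_sqrt hκ0
  have hsc := exp_mul_cosh_ge hu (Real.sqrt_nonneg (hexForm s t)) (by rw [hk2]; exact hk)
  rw [hk2] at hsc
  generalize √(hexForm s t) = k at *
  generalize Real.exp (-(u * hexForm s t)) = P at *
  generalize hexForm s t = κ at *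
  generalize hexForm m n = N at *
  generalize x₁ ^ 2 - x₁ * x₂ + x₂ ^ 2 = X at *
  generalize s * x₁ + t * x₂ = b at *
  clear_value A₁ A₂ A₃ B₁ B₂ B₃
  -- The weights A_i² have total 2 N X, and by `hAB` the weighted mean of B_i² is at least N κ ≥ κ =
  -- k².
  have hj := weighted_cosh_ge (a₁ := A₁ ^ 2) (a₂ := A₂ ^ 2) (a₃ := A₃ ^ 2) (c₁ := u * B₁) (c₂ := u * B₂)
    (c₃ := u * B₃) (x := u * k) (sq_nonneg _) (sq_nonneg _) (sq_nonneg _) (by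
      have e : A₁ ^ 2 * (u * B₁) ^ 2 + A₂ ^ 2 * (u * B₂) ^ 2 + A₃ ^ 2 * (u * B₃) ^ 2 =
        u ^ 2 * (N ^ 2 * (2 * X * κ + 3 * b ^ 2)) := by rw [← hAB]; ring
      rw [e, hA, mul_pow, hk2]
      have f1 : 0 ≤ u ^ 2 * (X * κ) * (N * (N - 1)) :=
        mul_nonneg (by positivity) (mul_nonneg (by linarith) (by linarith))
      have f2 : 0 ≤ u ^ 2 * N ^ 2 * b ^ 2 := by positivity
      linarith)
  rw [hA] at hj
  have g1 := mul_le_mul_of_nonneg_left hj (half_pos hP0).le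
  have g2 := mul_le_mul_of_nonneg_left hsc (show 0 ≤ 2 * N * X by positivity)
  linarith [congrArg (fun z => (P / 2 - 1) * z) hA]

lemma hexTransverse_orbit_ge {u s t : ℝ} (hu : 13 / 2 ≤ u) (hk : hexForm s t ≤ 1 / 5) (x₁ x₂ : ℝ)
    (h : ℤ × ℤ) :
    Real.exp (-u * hexForm h.1 h.2) * (hexForm h.1 h.2 * (x₁ ^ 2 - x₁ * x₂ + x₂ ^ 2) * (hexForm s t / 5)) ≤
      hexTransverse u s t x₁ x₂ h + hexTransverse u s t x₁ x₂ (hexRot h) +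
        hexTransverse u s t x₁ x₂ (hexRot (hexRot h)) := by
  by_cases h0 : h = 0
  · subst h0; simp [hexTransverse, hexRot, hexForm]
  have key := mul_le_mul_of_nonneg_left (orbit_average_ge (x₁ := x₁) (x₂ := x₂) hu hk (one_le_hexForm h0))
    (Real.exp_pos (-u * hexForm h.1 h.2)).le
  refine key.trans (le_of_eq ?_)
  have e3 : -((-h.1 - h.2 : ℤ)) - h.1 = h.2 := by ring
  simp only [hexTransverse, hexForm_hexRot]
  simp only [hexRot, Equiv.coe_fn_mk, e3, Int.cast_sub, Int.cast_neg, hexBilin]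
  ring

lemma tsum_hexTransverse_ge {u s t : ℝ} (hu : 13 / 2 ≤ u) (hk : hexForm s t ≤ 1 / 5) (x₁ x₂ : ℝ) :
    1 / 15 * Real.exp (-u) * hexForm s t * (x₁ ^ 2 - x₁ * x₂ + x₂ ^ 2) ≤
      ∑' h, hexTransverse u s t x₁ x₂ h := by
  have hGs := summable_hexTransverse (show 0 < u by linarith) s t x₁ x₂
  have h3 := three_mul_tsum_eq hGs
  have hX0 := quad_nonneg x₁ x₂
  have h4 := (summable_orbit hGs).le_tsum (1, 0) (fun h _ => le_trans (by
    have := hexForm_nonneg h.1 h.2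
    have := hexForm_nonneg s t
    positivity) (hexTransverse_orbit_ge hu hk x₁ x₂ h))
  have h5 := hexTransverse_orbit_ge hu hk x₁ x₂ (1, 0)
  have e4 : hexForm ((1 : ℤ) : ℝ) ((0 : ℤ) : ℝ) = 1 := by norm_num [hexForm]
  simp only [e4, mul_one, one_mul] at h5
  linarith

/-- Second moment gap for small wave vectors. -/
lemma hexMoment_gap_of_small {u s t : ℝ} (hu : 13 / 2 ≤ u) (ht : 0 ≤ t) (hst : t ≤ s)
    (hk : hexForm s t ≤ 1 / 5) (x₁ x₂ : ℝ) :
    1 / 15 * Real.exp (-u) * hexForm s t * (x₁ ^ 2 - x₁ * x₂ + x₂ ^ 2) ≤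
      hexMoment u x₁ x₂ s t - hexMoment u x₁ x₂ 0 0 := by
  have hu0 : 0 < u := by linarith
  obtain ⟨hS, hM⟩ := hexMoment_eq_tsum_cosh hu0 x₁ x₂ s t
  set b := s * x₁ + t * x₂ with hb
  set X := x₁ ^ 2 - x₁ * x₂ + x₂ ^ 2 with hX
  have hX0 : 0 ≤ X := quad_nonneg _ _
  set P := Real.exp (-(u * hexForm s t)) with hP
  have hP0 : 0 < P := Real.exp_pos _
  have hS0 := summable_hexMoment hu0 x₁ x₂ 0 0
  simp only [add_zero] at hS0
  have hD := summable_hexDeviation hu0 s t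
  set G : ℤ × ℤ → ℝ := hexTransverse u s t x₁ x₂ with hG
  set T : ℤ × ℤ → ℝ := fun h => P * (Real.exp (-u * hexForm h.1 h.2) *
      (((h.1 * x₁ + h.2 * x₂) ^ 2 + b ^ 2) * Real.cosh (u * hexBilin s t h) -
        2 * (h.1 * x₁ + h.2 * x₂) * b * Real.sinh (u * hexBilin s t h))) with hT
  -- The term of the lattice origin is P b²; it has no counterpart in the unshifted moment. Since
  -- the deviations sum to at most 1, it outweighs all b² losses and only the transverse gain `G`
  -- remains.
  set δ : ℤ × ℤ → ℝ := fun h => if h = 0 then P * b ^ 2 else 0 with hδ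
  have hδs : HasSum δ (P * b ^ 2) := by
    have := hasSum_ite_eq (0 : ℤ × ℤ) (P * b ^ 2)
    exact this
  have hGs : Summable G := summable_hexTransverse hu0 s t x₁ x₂
  have hle : ∀ h, δ h - P * b ^ 2 * hexDeviation u s t h + G h ≤
      T h - (h.1 * x₁ + h.2 * x₂) ^ 2 * Real.exp (-u * hexForm h.1 h.2) := by
    intro h
    by_cases h0 : h = 0
    · subst h0
      simp [hδ, hG, hT, hexDeviation, hexTransverse, hexBilin, hexForm]
    · simp only [hδ, hG, hT, hexDeviation, hexTransverse, h0, if_false]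
      have := mul_le_mul_of_nonneg_left (pair_ge (h.1 * x₁ + h.2 * x₂) b (u * hexBilin s t h))
        (mul_pos hP0 (Real.exp_pos (-u * hexForm h.1 h.2))).le
      nlinarith
  have hsum := ((hδs.summable.sub (hD.mul_left (P * b ^ 2))).add hGs).tsum_le_tsum hle (hS.sub hS0)
  rw [(hδs.summable.sub (hD.mul_left (P * b ^ 2))).tsum_add hGs,
    hδs.summable.tsum_sub (hD.mul_left (P * b ^ 2)), hδs.tsum_eq, tsum_mul_left, hS.tsum_sub hS0,
    ← hM] at hsum
  have hM0 : hexMoment u x₁ x₂ 0 0 =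
      ∑' h : ℤ × ℤ, (h.1 * x₁ + h.2 * x₂) ^ 2 * Real.exp (-u * hexForm h.1 h.2) := by
    simp [hexMoment]
  rw [← hM0] at hsum
  have hdev := tsum_hexDeviation_le hu ht hst hk
  have hPb : 0 ≤ P * b ^ 2 := by positivity
  have htr := tsum_hexTransverse_ge hu hk x₁ x₂
  have := mul_le_mul_of_nonneg_left hdev hPb
  linarith

/-! ### Second moments on the dual side: long wave vectors. -/

/-- Averaging over rotation orbits makes the moment isotropic. The six shortest vectors give 12 X
exp (-u) before division by 3; the tail adds at most 0.1 X exp (-u), and 12.1 / 3 ≤ 4.04. -/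
lemma hexMoment_zero_le {u : ℝ} (hu : 13 / 2 ≤ u) (x₁ x₂ : ℝ) :
    hexMoment u x₁ x₂ 0 0 ≤ 4.04 * Real.exp (-u) * (x₁ ^ 2 - x₁ * x₂ + x₂ ^ 2) := by
  have hu0 : 0 < u := by linarith
  have hX0 := quad_nonneg x₁ x₂
  set X := x₁ ^ 2 - x₁ * x₂ + x₂ ^ 2 with hX
  set f : ℤ × ℤ → ℝ := fun h => (h.1 * x₁ + h.2 * x₂) ^ 2 * Real.exp (-u * hexForm h.1 h.2) with hf
  have hM : hexMoment u x₁ x₂ 0 0 = ∑' h, f h := by simp [hexMoment, hf]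
  have hs : Summable f := by simpa [hf] using summable_sq_mul_exp_shift hu0 x₁ x₂ 0 0
  have horb : ∀ h : ℤ × ℤ, f h + f (hexRot h) + f (hexRot (hexRot h)) =
      2 * X * (hexForm h.1 h.2 * Real.exp (-u * hexForm h.1 h.2)) := by
    intro h
    have e3 : -((-h.1 - h.2 : ℤ)) - h.1 = h.2 := by ring
    simp only [hf, hexForm_hexRot]
    simp only [hexRot, Equiv.coe_fn_mk, e3, Int.cast_sub, Int.cast_neg]
    simp only [hX]
    generalize Real.exp (-u * hexForm h.1 h.2) = E
    simp only [hexForm]; ring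
  have h3 := three_mul_tsum_eq hs
  have hso := summable_orbit hs
  simp only [horb] at h3 hso
  have hle : ∑' h : ℤ × ℤ, 2 * X * (hexForm h.1 h.2 * Real.exp (-u * hexForm h.1 h.2)) ≤
      12 * X * Real.exp (-u) + (2 * X * Real.exp (-u)) / 20 := by
    refine (tsum_le_ring_add_tail (C := 2 * X * Real.exp (-u)) (by simp [hexForm]) ?_ hso (by positivity)).trans ?_
    · intro h h0 hr
      have hN := three_le_hexForm h0 hr
      unfold hexTail
      rw [if_pos hN, mul_assoc (2 * X)]
      refine mul_le_mul_of_nonneg_left ?_ (by positivity)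
      rw [← Real.exp_add]
      generalize hexForm h.1 h.2 = N at *
      calc N * Real.exp (-u * N) ≤ Real.exp N * Real.exp (-u * N) := by
            gcongr; linarith [Real.add_one_le_exp N]
        _ ≤ _ := by rw [← Real.exp_add]; exact Real.exp_le_exp.mpr (by nlinarith)
    · rw [sum_hexRing]
      refine le_of_eq ?_
      norm_num [hexForm]
      ring
  rw [hM]
  nlinarith [Real.exp_pos (-u)]

lemma le_exp_of_le {x : ℝ} (hx : 3.7 ≤ x) : 40 ≤ Real.exp x := by
  have h1 : Real.exp 3.7 ≤ Real.exp x := Real.exp_le_exp.mpr hx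
  have h2 : Real.exp 3.7 ^ 10 = Real.exp 1 ^ 37 := by
    rw [← Real.exp_nat_mul, ← Real.exp_nat_mul]; norm_num
  have h3 : (2.7182 : ℝ) ^ 37 ≤ Real.exp 1 ^ 37 := by
    have := Real.exp_one_gt_d9
    gcongr; linarith
  by_contra hc
  have h4 : Real.exp 3.7 ^ 10 < 40 ^ 10 := by
    gcongr; linarith
  rw [h2] at h4
  have : (40 : ℝ) ^ 10 < 2.7182 ^ 37 := by norm_num
  linarith

lemma le_exp_of_le' {x : ℝ} (hx : 1.58 ≤ x) : 4.8 ≤ Real.exp x := by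
  have h1 : Real.exp 1.58 ≤ Real.exp x := Real.exp_le_exp.mpr hx
  have h2 : Real.exp 1.58 ^ 50 = Real.exp 1 ^ 79 := by
    rw [← Real.exp_nat_mul, ← Real.exp_nat_mul]; norm_num
  have h3 : (2.7182 : ℝ) ^ 79 ≤ Real.exp 1 ^ 79 := by
    have := Real.exp_one_gt_d9
    gcongr; linarith
  by_contra hc
  have h4 : Real.exp 1.58 ^ 50 < 4.8 ^ 50 := by
    gcongr; linarith
  rw [h2] at h4
  have : (4.8 : ℝ) ^ 50 < 2.7182 ^ 79 := by norm_num
  linarith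

/-- The squares are those of x paired with the wave vector and its translates by the two basis
vectors; 40 and 4.8 are the Gaussian weights, relative to exp (-u), that these points carry for long
wave vectors. The value 4.5 leaves room above 4.04. -/
lemma three_vertex_form_ge (x₁ x₂ b : ℝ) :
    4.5 * (x₁ ^ 2 - x₁ * x₂ + x₂ ^ 2) ≤ b ^ 2 * 40 + ((b - x₁) ^ 2 * 40 + (b - x₂) ^ 2 * 4.8) := by
  have h : b ^ 2 * 40 + ((b - x₁) ^ 2 * 40 + (b - x₂) ^ 2 * 4.8) - 4.5 * (x₁ ^ 2 - x₁ * x₂ + x₂ ^ 2) =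
      16.625 * x₁ ^ 2 + (84.8 * (b - x₁ / 2) - 4.8 * (x₂ - x₁ / 2)) ^ 2 / 84.8 +
        (0.3 - 4.8 ^ 2 / 84.8) * (x₂ - x₁ / 2) ^ 2 := by ring
  have : 0 ≤ 16.625 * x₁ ^ 2 + (84.8 * (b - x₁ / 2) - 4.8 * (x₂ - x₁ / 2)) ^ 2 / 84.8 +
        (0.3 - 4.8 ^ 2 / 84.8) * (x₂ - x₁ / 2) ^ 2 := by
    have : (0 : ℝ) ≤ 0.3 - 4.8 ^ 2 / 84.8 := by norm_num
    positivity
  linarith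

/-- Second moment gap for wave vectors near the boundary of the Voronoi cell. -/
lemma hexMoment_gap_of_large {u s t : ℝ} (hu : 13 / 2 ≤ u) (ht : 0 ≤ t) (hst : t ≤ s)
    (hV : 2 * s + t ≤ 1) (hk : 1 / 5 ≤ hexForm s t) (x₁ x₂ : ℝ) :
    1 / 15 * Real.exp (-u) * hexForm s t * (x₁ ^ 2 - x₁ * x₂ + x₂ ^ 2) ≤
      hexMoment u x₁ x₂ s t - hexMoment u x₁ x₂ 0 0 := by
  have hu0 : 0 < u := by linarith
  have hX0 := quad_nonneg x₁ x₂
  have h0 := hexMoment_zero_le hu x₁ x₂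
  have hs : 0 ≤ s := ht.trans hst
  have hκ3 : hexForm s t ≤ 1 / 3 := by unfold hexForm; nlinarith
  set k := √(hexForm s t) with hkdef
  have hk2 : k ^ 2 = hexForm s t := Real.sq_sqrt (hexForm_nonneg s t)
  have hk0 : 0 ≤ k := Real.sqrt_nonneg _
  have hklo : 0.4472 ≤ k := by nlinarith
  have hkhi : k ≤ 0.5774 := by nlinarith
  -- In the domain 0 ≤ t ≤ s, the quantity s + 2t is smallest relative to k on the side t = 0, and
  -- 2s + t on the side t = s.
  have e2 : k ≤ s + 2 * t := by
    refine le_of_sq_le_sq ?_ (by linarith)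
    rw [hk2]; unfold hexForm; nlinarith
  have e1 : 1.732 * k ≤ 2 * s + t := by
    refine le_of_sq_le_sq ?_ (by linarith)
    rw [mul_pow, hk2]; unfold hexForm; nlinarith
  have E0 : 40 ≤ Real.exp (u * (1 - hexForm s t)) := le_exp_of_le (by nlinarith)
  have E1 : 40 ≤ Real.exp (u * (2 * s + t - hexForm s t)) := le_exp_of_le (by
    have : 0.57 ≤ 2 * s + t - hexForm s t := by rw [← hk2]; nlinarith
    nlinarith)
  have E2 : 4.8 ≤ Real.exp (u * (s + 2 * t - hexForm s t)) := le_exp_of_le' (by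
    have : 0.244 ≤ s + 2 * t - hexForm s t := by rw [← hk2]; nlinarith
    nlinarith)
  -- Only three lattice points are kept: those whose translates by the wave vector are the vertices
  -- closest to the origin.
  have hM := (summable_hexMoment hu0 x₁ x₂ s t).sum_le_tsum {(0, 0), (-1, 0), (0, -1)}
    (fun h _ => by positivity)
  rw [Finset.sum_insert (by decide), Finset.sum_insert (by decide), Finset.sum_singleton] at hM
  have g0 : Real.exp (-u * hexForm (((0 : ℤ) : ℝ) + s) (((0 : ℤ) : ℝ) + t)) =
      Real.exp (-u) * Real.exp (u * (1 - hexForm s t)) := by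
    rw [← Real.exp_add]; congr 1; simp only [hexForm]; push_cast; ring
  have g1 : Real.exp (-u * hexForm (((-1 : ℤ) : ℝ) + s) (((0 : ℤ) : ℝ) + t)) =
      Real.exp (-u) * Real.exp (u * (2 * s + t - hexForm s t)) := by
    rw [← Real.exp_add]; congr 1; simp only [hexForm]; push_cast; ring
  have g2 : Real.exp (-u * hexForm (((0 : ℤ) : ℝ) + s) (((-1 : ℤ) : ℝ) + t)) =
      Real.exp (-u) * Real.exp (u * (s + 2 * t - hexForm s t)) := by
    rw [← Real.exp_add]; congr 1; simp only [hexForm]; push_cast; ring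
  simp only [g0, g1, g2] at hM
  change _ ≤ hexMoment u x₁ x₂ s t at hM
  set b := s * x₁ + t * x₂ with hb
  have b0 : (((0 : ℤ) : ℝ) + s) * x₁ + (((0 : ℤ) : ℝ) + t) * x₂ = b := by push_cast; ring
  have b1 : (((-1 : ℤ) : ℝ) + s) * x₁ + (((0 : ℤ) : ℝ) + t) * x₂ = b - x₁ := by push_cast; ring
  have b2 : (((0 : ℤ) : ℝ) + s) * x₁ + (((-1 : ℤ) : ℝ) + t) * x₂ = b - x₂ := by push_cast; ring
  rw [b0, b1, b2] at hM
  have hq : 4.5 * (x₁ ^ 2 - x₁ * x₂ + x₂ ^ 2) ≤ b ^ 2 * 40 + ((b - x₁) ^ 2 * 40 + (b - x₂) ^ 2 * 4.8) := three_vertex_form_ge x₁ x₂ b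
  have hE := Real.exp_pos (-u)
  have hlow : Real.exp (-u) * (b ^ 2 * 40 + ((b - x₁) ^ 2 * 40 + (b - x₂) ^ 2 * 4.8)) ≤ hexMoment u x₁ x₂ s t := by
    refine le_trans ?_ hM
    have := mul_le_mul_of_nonneg_left E0 (show 0 ≤ Real.exp (-u) * b ^ 2 by positivity)
    have := mul_le_mul_of_nonneg_left E1 (show 0 ≤ Real.exp (-u) * (b - x₁) ^ 2 by positivity)
    have := mul_le_mul_of_nonneg_left E2 (show 0 ≤ Real.exp (-u) * (b - x₂) ^ 2 by positivity)
    linarith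
  have h5 := mul_le_mul_of_nonneg_left hq hE.le
  have h6 : Real.exp (-u) * (x₁ ^ 2 - x₁ * x₂ + x₂ ^ 2) * hexForm s t ≤
      Real.exp (-u) * (x₁ ^ 2 - x₁ * x₂ + x₂ ^ 2) * 1 := by
    gcongr; linarith
  have h7 : 0 ≤ Real.exp (-u) * (x₁ ^ 2 - x₁ * x₂ + x₂ ^ 2) := by positivity
  linarith

/-! ### Reduction to a fundamental domain by symmetry. -/

lemma hexMoment_add_int (u x₁ x₂ s t : ℝ) (i j : ℤ) :
    hexMoment u x₁ x₂ (s + i) (t + j) = hexMoment u x₁ x₂ s t := by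
  unfold hexMoment
  rw [← (Equiv.addRight ((i, j) : ℤ × ℤ)).tsum_eq (fun h : ℤ × ℤ =>
    ((h.1 + s) * x₁ + (h.2 + t) * x₂) ^ 2 * Real.exp (-u * hexForm (h.1 + s) (h.2 + t)))]
  refine tsum_congr fun h => ?_
  simp only [Equiv.coe_addRight, Prod.fst_add, Prod.snd_add, Int.cast_add]
  ring_nf

lemma hexMoment_neg (u x₁ x₂ s t : ℝ) : hexMoment u x₁ x₂ (-s) (-t) = hexMoment u x₁ x₂ s t := by
  unfold hexMoment
  rw [← (Equiv.neg (ℤ × ℤ)).tsum_eq]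
  refine tsum_congr fun h => ?_
  simp only [Equiv.neg_apply, Prod.fst_neg, Prod.snd_neg, Int.cast_neg, hexForm]
  ring_nf

lemma hexMoment_swap (u x₁ x₂ s t : ℝ) : hexMoment u x₂ x₁ t s = hexMoment u x₁ x₂ s t := by
  unfold hexMoment
  rw [← (Equiv.prodComm ℤ ℤ).tsum_eq]
  refine tsum_congr fun h => ?_
  simp only [Equiv.prodComm_apply, Prod.fst_swap, Prod.snd_swap, hexForm]
  ring_nf

/-- A reflection of the hexagonal lattice, in coordinates. -/
def hexReflect : ℤ × ℤ ≃ ℤ × ℤ where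
  toFun h := (-h.1 - h.2, h.2)
  invFun h := (-h.1 - h.2, h.2)
  left_inv h := Prod.ext (by dsimp only; ring) rfl
  right_inv h := Prod.ext (by dsimp only; ring) rfl

lemma hexMoment_reflect (u x₁ x₂ s t : ℝ) :
    hexMoment u (-x₁) (x₂ - x₁) s t = hexMoment u x₁ x₂ (-s - t) t := by
  unfold hexMoment
  rw [← hexReflect.tsum_eq (fun h : ℤ × ℤ =>
    ((h.1 + (-s - t)) * x₁ + (h.2 + t) * x₂) ^ 2 * Real.exp (-u * hexForm (h.1 + (-s - t)) (h.2 + t)))]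
  refine tsum_congr fun h => ?_
  simp only [hexReflect, Equiv.coe_fn_mk, hexForm]
  push_cast
  ring_nf

/-- Reduction to a fundamental domain of the symmetry group of the hexagonal lattice. -/
lemma hex_reduction {P : ℝ → ℝ → Prop} (hdom : ∀ s t, 0 ≤ t → t ≤ s → 2 * s + t ≤ 1 → P s t)
    (hshift : ∀ s t (i j : ℤ), P s t → P (s + i) (t + j)) (hneg : ∀ s t, P s t → P (-s) (-t))
    (hswap : ∀ s t, P s t → P t s) (hrefl : ∀ s t, P s t → P (-s - t) t) (s t : ℝ) : P s t := by
  -- Reflection combined with a lattice translation; it folds the part 2s + t > 1 of the triangle s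
  -- + t ≤ 1 back.
  have hr : ∀ s t, P s t → P (1 - s - t) t := by
    intro s t h
    have := hshift _ _ 1 0 (hrefl s t h)
    push_cast at this
    rw [add_zero, show -s - t + 1 = 1 - s - t by ring] at this
    exact this
  have htri' : ∀ s t, 0 ≤ t → t ≤ s → s + t ≤ 1 → P s t := by
    intro s t h0 h1 h2
    by_cases h3 : 2 * s + t ≤ 1
    · exact hdom s t h0 h1 h3
    · have key : P (1 - s - t) t := by
        rcases le_total t (1 - s - t) with h4 | h4
        · exact hdom _ _ h0 h4 (by linarith)
        · exact hswap _ _ (hdom _ _ (by linarith) h4 (by linarith))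
      have := hr _ _ key
      rwa [show 1 - (1 - s - t) - t = s by ring] at this
  have htri : ∀ s t, 0 ≤ s → 0 ≤ t → s + t ≤ 1 → P s t := by
    intro s t h0 h1 h2
    rcases le_total t s with h | h
    · exact htri' s t h1 h h2
    · exact hswap _ _ (htri' t s h0 h (by linarith))
  have hbox : ∀ s t, 0 ≤ s → s ≤ 1 → 0 ≤ t → t ≤ 1 → P s t := by
    intro s t h0 h1 h2 h3
    rcases le_total (s + t) 1 with h | h
    · exact htri s t h0 h2 h
    · have := hneg _ _ (hshift _ _ (-1) (-1) (htri (1 - s) (1 - t) (by linarith) (by linarith) (by linarith)))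
      push_cast at this
      rwa [show -(1 - s + -1) = s by ring, show -(1 - t + -1) = t by ring] at this
  have := hshift _ _ ⌊s⌋ ⌊t⌋ (hbox (Int.fract s) (Int.fract t) (Int.fract_nonneg _) (Int.fract_lt_one _).le
    (Int.fract_nonneg _) (Int.fract_lt_one _).le)
  rwa [Int.fract_add_floor, Int.fract_add_floor] at this

lemma one_sub_cos_le (x : ℝ) : 1 - Real.cos x ≤ x ^ 2 / 2 := by
  linarith [Real.one_sub_sq_div_two_le_cos (x := x)]

/-- Termwise 1 - cos x ≤ x²/2. It replaces the non-periodic `hexForm` by the periodic `hexWeight`,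
so that the estimate can be carried to all wave vectors by translations. -/
lemma hexWeight_le (s t : ℝ) : hexWeight s t ≤ 4 * Real.pi ^ 2 * hexForm s t := by
  unfold hexWeight hexForm
  have h1 := one_sub_cos_le (2 * Real.pi * s)
  have h2 := one_sub_cos_le (2 * Real.pi * t)
  have h3 := one_sub_cos_le (2 * Real.pi * (s + t))
  linarith

lemma hexWeight_add_int (s t : ℝ) (i j : ℤ) : hexWeight (s + i) (t + j) = hexWeight s t := by
  unfold hexWeight
  have h : ∀ (x : ℝ) (n : ℤ), Real.cos (2 * Real.pi * (x + n)) = Real.cos (2 * Real.pi * x) := by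
    intro x n
    rw [show 2 * Real.pi * (x + n) = 2 * Real.pi * x + n * (2 * Real.pi) by ring, Real.cos_add_int_mul_two_pi]
  rw [h, h, show s + i + (t + j) = s + t + ((i + j : ℤ) : ℝ) by push_cast; ring, h]

/-- Coercivity of the second moment sum for all wave vectors. -/
lemma hexMoment_gap {u : ℝ} (hu : 13 / 2 ≤ u) (x₁ x₂ s t : ℝ) :
    1 / (60 * Real.pi ^ 2) * Real.exp (-u) * hexWeight s t * (x₁ ^ 2 - x₁ * x₂ + x₂ ^ 2) ≤
      hexMoment u x₁ x₂ s t - hexMoment u x₁ x₂ 0 0 := by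
  have hneg' : ∀ x : ℝ, Real.cos (2 * Real.pi * -x) = Real.cos (2 * Real.pi * x) := by
    intro x; rw [mul_neg, Real.cos_neg]
  revert x₁ x₂
  refine hex_reduction (P := fun s t => ∀ x₁ x₂ : ℝ,
    1 / (60 * Real.pi ^ 2) * Real.exp (-u) * hexWeight s t * (x₁ ^ 2 - x₁ * x₂ + x₂ ^ 2) ≤
      hexMoment u x₁ x₂ s t - hexMoment u x₁ x₂ 0 0) ?_ ?_ ?_ ?_ ?_ s t
  · intro s t ht hst hV x₁ x₂
    have h1 : 1 / (60 * Real.pi ^ 2) * hexWeight s t ≤ 1 / 15 * hexForm s t := by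
      calc _ ≤ 1 / (60 * Real.pi ^ 2) * (4 * Real.pi ^ 2 * hexForm s t) := by
            gcongr; exact hexWeight_le s t
        _ = _ := by field_simp; ring
    have h2 : 1 / (60 * Real.pi ^ 2) * Real.exp (-u) * hexWeight s t * (x₁ ^ 2 - x₁ * x₂ + x₂ ^ 2) ≤
        1 / 15 * Real.exp (-u) * hexForm s t * (x₁ ^ 2 - x₁ * x₂ + x₂ ^ 2) := by
      refine mul_le_mul_of_nonneg_right ?_ (quad_nonneg _ _)
      have := mul_le_mul_of_nonneg_left h1 (Real.exp_pos (-u)).le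
      linarith
    refine h2.trans ?_
    rcases le_total (hexForm s t) (1 / 5) with h | h
    · exact hexMoment_gap_of_small hu ht hst h x₁ x₂
    · exact hexMoment_gap_of_large hu ht hst hV h x₁ x₂
  · intro s t i j h x₁ x₂
    rw [hexWeight_add_int, hexMoment_add_int]; exact h x₁ x₂
  · intro s t h x₁ x₂
    have : hexWeight (-s) (-t) = hexWeight s t := by
      unfold hexWeight
      rw [hneg', hneg', show -s + -t = -(s + t) by ring, hneg']
    rw [this, hexMoment_neg]; exact h x₁ x₂
  · intro s t h x₁ x₂
    have e : hexWeight t s = hexWeight s t := by unfold hexWeight; rw [add_comm t s]; ring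
    have := h x₂ x₁
    rw [hexMoment_swap u x₁ x₂ t s, hexMoment_swap u x₁ x₂ 0 0] at this
    rw [e]; linarith
  · intro s t h x₁ x₂
    have e : hexWeight (-s - t) t = hexWeight s t := by
      unfold hexWeight
      rw [show -s - t + t = -s by ring, hneg', show -s - t = -(s + t) by ring, hneg']; ring
    have := h (-x₁) (x₂ - x₁)
    have e0 := hexMoment_reflect u x₁ x₂ 0 0
    rw [show (-0 - 0 : ℝ) = 0 by norm_num] at e0
    rw [hexMoment_reflect, e0] at this
    rw [e]; linarith

/-! ### Coercivity for every Gaussian, at covolume one. -/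

lemma rStar_pos : 0 < rStar := by unfold rStar; positivity

lemma rStar_sq : rStar ^ 2 = 2 / √3 := by
  unfold rStar; exact Real.sq_sqrt (by positivity)

lemma sqrt_three_mul_rStar_sq : √3 * rStar ^ 2 = 2 := by
  rw [rStar_sq]; field_simp

lemma rStar_pow_four : (rStar ^ 2) ^ 2 = 4 / 3 := by
  rw [rStar_sq, div_pow, Real.sq_sqrt (by norm_num)]; norm_num

lemma one_le_rStar_sq : 1.1547 ≤ rStar ^ 2 := by
  nlinarith [rStar_pow_four, sq_nonneg rStar]

lemma rStar_sq_le : rStar ^ 2 ≤ 1.1548 := by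
  nlinarith [rStar_pow_four, sq_nonneg rStar]

/-- The size of the coercivity constant of the Gaussian `exp (-π α r²)`. -/
def gaussGap (α : ℝ) : ℝ := Real.exp (-(Real.pi * rStar ^ 2 * max α α⁻¹))

/-- The size of the error terms of the Gaussian `exp (-π α r²)`. -/
def gaussLoss (α : ℝ) : ℝ := if α ≤ 1 then α⁻¹ else Real.exp (-(Real.pi * α / 2 * rStar ^ 2))

lemma gaussGap_pos (α : ℝ) : 0 < gaussGap α := Real.exp_pos _

lemma gaussLoss_nonneg {α : ℝ} (hα : 0 ≤ α) : 0 ≤ gaussLoss α := by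
  unfold gaussLoss; split_ifs <;> positivity

/-- Coercivity of the dynamical matrix of every Gaussian. -/
lemma tsum_dynTerm_ge {α : ℝ} (hα : 0 < α) (s t y₁ y₂ : ℝ) :
    1 / 1000 * gaussGap α * hexWeight s t * (y₁ ^ 2 - y₁ * y₂ + y₂ ^ 2) ≤
      α ^ 2 / 2 * ∑' h, dynTerm (α * rStar ^ 2) s t y₁ y₂ h := by
  have hπ := Real.pi_pos
  have hπ1 := Real.pi_gt_d4
  have hπ2 := Real.pi_lt_d4
  have hr := one_le_rStar_sq
  have hr' := rStar_sq_le
  have hr4 := rStar_pow_four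
  have h3r := sqrt_three_mul_rStar_sq
  have hr0 : 0 < rStar ^ 2 := by linarith
  have hY := quad_nonneg y₁ y₂
  have hw := hexWeight_nonneg s t
  have ha : 0 < α * rStar ^ 2 := by positivity
  -- The direct estimate needs π a > 2 and the dual one needs 4π/(3a) ≥ 13/2, that is π a ≤ 8π²/39 ≈
  -- 2.024, where a = α r⋆². The threshold lies in this narrow overlap.
  rcases le_total 2.01 (Real.pi * (α * rStar ^ 2)) with h | h
  · have key := tsum_dynTerm_ge_of_large (a := α * rStar ^ 2) (by linarith) s t y₁ y₂
    have hg : gaussGap α ≤ Real.exp (-(Real.pi * (α * rStar ^ 2))) := by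
      refine Real.exp_le_exp.mpr ?_
      have := mul_le_mul_of_nonneg_left (le_max_left α α⁻¹) (show 0 ≤ Real.pi * rStar ^ 2 by positivity)
      linarith
    refine le_trans ?_ (mul_le_mul_of_nonneg_left key (by positivity))
    have hc : (1 : ℝ) / 1000 ≤ α ^ 2 / 2 * (8 * Real.pi / (9 * (α * rStar ^ 2)) * (Real.pi * (α * rStar ^ 2) / 2 - 1)) := by
      have e : α ^ 2 / 2 * (8 * Real.pi / (9 * (α * rStar ^ 2)) * (Real.pi * (α * rStar ^ 2) / 2 - 1)) =
        4 * (Real.pi * α) / (9 * rStar ^ 2) * (Real.pi * (α * rStar ^ 2) / 2 - 1) := by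
        field_simp; ring
      rw [e]
      have h1 : (0.005 : ℝ) ≤ Real.pi * (α * rStar ^ 2) / 2 - 1 := by linarith
      have h2 : (0.2 : ℝ) ≤ 4 * (Real.pi * α) / (9 * rStar ^ 2) := by
        rw [le_div_iff₀ (by positivity)]
        have : Real.pi * (α * rStar ^ 2) ≤ Real.pi * α * 1.1548 := by
          have := mul_le_mul_of_nonneg_left hr' (show 0 ≤ Real.pi * α by positivity)
          linarith
        linarith
      calc (1 : ℝ) / 1000 = 0.2 * 0.005 := by norm_num
        _ ≤ _ := by gcongr
    calc _ ≤ α ^ 2 / 2 * (8 * Real.pi / (9 * (α * rStar ^ 2)) * (Real.pi * (α * rStar ^ 2) / 2 - 1)) *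
          Real.exp (-(Real.pi * (α * rStar ^ 2))) * hexWeight s t * (y₁ ^ 2 - y₁ * y₂ + y₂ ^ 2) := by
          gcongr
          exact (gaussGap_pos α).le
      _ = _ := by ring
  -- At covolume one the dual parameter is π r⋆²/α, so exp (-u) is the branch of `gaussGap` with
  -- α⁻¹.
  · have hb : 4 * Real.pi / (3 * (α * rStar ^ 2)) = Real.pi * rStar ^ 2 * α⁻¹ := by
      rw [div_eq_iff (by positivity)]
      field_simp
      nlinarith
    have hu : 13 / 2 ≤ 4 * Real.pi / (3 * (α * rStar ^ 2)) := by
      rw [le_div_iff₀ (by positivity)]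
      have h1 : 13 / 2 * (3 * (α * rStar ^ 2)) * Real.pi ≤ 4 * Real.pi * Real.pi := by nlinarith
      exact le_of_mul_le_mul_right h1 hπ
    have key := hexMoment_gap hu (2 * y₁ - y₂) (y₁ - 2 * y₂) s t
    have e := tsum_dynamical_eq ha s t y₁ y₂
    change ∑' h, dynTerm (α * rStar ^ 2) s t y₁ y₂ h = _ at e
    rw [e]
    have hg : gaussGap α ≤ Real.exp (-(4 * Real.pi / (3 * (α * rStar ^ 2)))) := by
      rw [hb]
      refine Real.exp_le_exp.mpr ?_
      have := mul_le_mul_of_nonneg_left (le_max_right α α⁻¹) (show 0 ≤ Real.pi * rStar ^ 2 by positivity)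
      linarith
    have hX : (2 * y₁ - y₂) ^ 2 - (2 * y₁ - y₂) * (y₁ - 2 * y₂) + (y₁ - 2 * y₂) ^ 2 =
        3 * (y₁ ^ 2 - y₁ * y₂ + y₂ ^ 2) := by ring
    rw [hX] at key
    have hcoef : 0 ≤ 2 / (√3 * (α * rStar ^ 2)) * (4 * Real.pi / (3 * (α * rStar ^ 2))) ^ 2 := by positivity
    refine le_trans ?_ (mul_le_mul_of_nonneg_left (mul_le_mul_of_nonneg_left key hcoef)
      (show 0 ≤ α ^ 2 / 2 by positivity))
    have hc : (1 : ℝ) / 1000 ≤ α ^ 2 / 2 * (2 / (√3 * (α * rStar ^ 2)) *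
        (4 * Real.pi / (3 * (α * rStar ^ 2))) ^ 2) * (1 / (60 * Real.pi ^ 2)) * 3 := by
      have e2 : √3 * (α * rStar ^ 2) = 2 * α := by linear_combination α * h3r
      have e1 : α ^ 2 / 2 * (2 / (√3 * (α * rStar ^ 2)) *
        (4 * Real.pi / (3 * (α * rStar ^ 2))) ^ 2) * (1 / (60 * Real.pi ^ 2)) * 3 = 1 / (30 * α) := by
        rw [hb, e2, mul_pow, mul_pow, hr4]
        field_simp; norm_num
      rw [e1, div_le_div_iff₀ (by norm_num) (by positivity)]
      have : α ≤ 1 := by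
        by_contra hc
        push Not at hc
        have : 3 * 1 ≤ Real.pi * (α * rStar ^ 2) := by
          have : 1 ≤ α * rStar ^ 2 := by nlinarith
          gcongr; linarith
        linarith
      linarith
    calc _ ≤ (α ^ 2 / 2 * (2 / (√3 * (α * rStar ^ 2)) *
        (4 * Real.pi / (3 * (α * rStar ^ 2))) ^ 2) * (1 / (60 * Real.pi ^ 2)) * 3) *
          Real.exp (-(4 * Real.pi / (3 * (α * rStar ^ 2)))) * hexWeight s t * (y₁ ^ 2 - y₁ * y₂ + y₂ ^ 2) := by
          gcongr
          exact (gaussGap_pos α).le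
      _ = _ := by ring

/-- Gaussian sums over the nonzero lattice vectors are controlled by `gaussLoss`. -/
lemma exists_tsum_exp_le_gaussLoss : ∃ C : ℝ, 0 ≤ C ∧ ∀ α : ℝ, 0 < α →
    ∑' h : ℤ × ℤ, (if h = 0 then 0 else Real.exp (-(Real.pi * α / 2 * (rStar ^ 2 * hexForm h.1 h.2)))) ≤
      C * gaussLoss α := by
  have hπ := Real.pi_pos
  have hr := one_le_rStar_sq
  have hr0 : 0 < rStar ^ 2 := by linarith
  set C₁ := ∑' h : ℤ × ℤ, Real.exp (-(8 * Real.pi / (3 * rStar ^ 2)) * hexForm h.1 h.2) with hC₁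
  set C₂ := ∑' h : ℤ × ℤ, Real.exp (-(Real.pi / 2 * rStar ^ 2) * (hexForm h.1 h.2 - 1)) with hC₂
  have hs₁ := summable_exp_neg_hexForm (c := 8 * Real.pi / (3 * rStar ^ 2)) (by positivity)
  have hs₂ : Summable fun h : ℤ × ℤ => Real.exp (-(Real.pi / 2 * rStar ^ 2) * (hexForm h.1 h.2 - 1)) := by
    refine ((summable_exp_neg_hexForm (c := Real.pi / 2 * rStar ^ 2) (by positivity)).mul_left
      (Real.exp (Real.pi / 2 * rStar ^ 2))).congr fun h => ?_
    rw [← Real.exp_add]; ring_nf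
  have hC₁0 : 0 ≤ C₁ := tsum_nonneg fun _ => (Real.exp_pos _).le
  have hC₂0 : 0 ≤ C₂ := tsum_nonneg fun _ => (Real.exp_pos _).le
  refine ⟨2 * C₁ + C₂, by positivity, fun α hα => ?_⟩
  have hs : Summable fun h : ℤ × ℤ => Real.exp (-(Real.pi * (α * rStar ^ 2 / 2)) * hexForm h.1 h.2) :=
    summable_exp_neg_hexForm (by positivity)
  have hs' : Summable fun h : ℤ × ℤ =>
      (if h = 0 then 0 else Real.exp (-(Real.pi * α / 2 * (rStar ^ 2 * hexForm h.1 h.2)))) := by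
    refine Summable.of_nonneg_of_le (fun h => by split_ifs <;> positivity) (fun h => ?_) hs
    split_ifs
    · positivity
    · exact le_of_eq (by ring_nf)
  unfold gaussLoss
  split_ifs with h1
  -- For α ≤ 1 Poisson summation yields the factor 2/α times a dual sum bounded by its value at α =
  -- 1.
  · have hp := tsum_exp_hexForm_mul_cos (a := α * rStar ^ 2 / 2) (by positivity) 0 0
    simp only [mul_zero, sub_zero, Real.cos_zero, mul_one, add_zero] at hp
    have e : 2 / (√3 * (α * rStar ^ 2 / 2)) = 2 * α⁻¹ := by
      rw [show √3 * (α * rStar ^ 2 / 2) = α by linear_combination α / 2 * sqrt_three_mul_rStar_sq]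
      field_simp
    rw [e] at hp
    calc _ ≤ ∑' h : ℤ × ℤ, Real.exp (-(Real.pi * (α * rStar ^ 2 / 2)) * hexForm h.1 h.2) := by
          refine hs'.tsum_le_tsum (fun h => ?_) hs
          split_ifs
          · positivity
          · exact le_of_eq (by ring_nf)
      _ ≤ 2 * α⁻¹ * C₁ := by
          rw [hp]
          refine mul_le_mul_of_nonneg_left ?_ (by positivity)
          refine (summable_exp_neg_hexForm (by positivity)).tsum_le_tsum (fun h => ?_) hs₁
          refine Real.exp_le_exp.mpr ?_
          rw [neg_mul, neg_mul, neg_le_neg_iff]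
          refine mul_le_mul_of_nonneg_right ?_ (hexForm_nonneg _ _)
          rw [div_le_div_iff₀ (by positivity) (by positivity)]
          have : α * rStar ^ 2 ≤ rStar ^ 2 := by nlinarith
          nlinarith
      _ ≤ _ := by
          have : 0 ≤ C₂ * α⁻¹ := by positivity
          linarith
  · push Not at h1
    -- For α > 1 and N ≥ 1, α N ≥ α + (N - 1), so the nearest neighbour Gaussian factors out of a
    -- sum independent of α.
    calc _ ≤ ∑' h : ℤ × ℤ, Real.exp (-(Real.pi * α / 2 * rStar ^ 2)) *
          Real.exp (-(Real.pi / 2 * rStar ^ 2) * (hexForm h.1 h.2 - 1)) := by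
          refine hs'.tsum_le_tsum (fun h => ?_) (hs₂.mul_left _)
          split_ifs with h0
          · positivity
          · rw [← Real.exp_add]
            refine Real.exp_le_exp.mpr ?_
            have hN := one_le_hexForm h0
            have : 0 ≤ (Real.pi / 2 * rStar ^ 2) * ((α - 1) * (hexForm h.1 h.2 - 1)) :=
              mul_nonneg (by positivity) (mul_nonneg (by linarith) (by linarith))
            linarith
      _ = Real.exp (-(Real.pi * α / 2 * rStar ^ 2)) * C₂ := tsum_mul_left
      _ ≤ _ := by
          have : 0 ≤ 2 * C₁ * Real.exp (-(Real.pi * α / 2 * rStar ^ 2)) := by positivity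
          linarith

/-! ### Parseval on the torus and the second order part of the energy. -/

/-- The phase of the character of `ℤ × ℤ` with parameter `p`. -/
def charPhase (z : ℤ × ℤ) (p : ℝ × ℝ) : ℝ := 2 * Real.pi * (z.1 * p.1 - z.2 * p.2)

lemma charPhase_add (z w : ℤ × ℤ) (p : ℝ × ℝ) : charPhase (z + w) p = charPhase z p + charPhase w p := by
  simp only [charPhase, Prod.fst_add, Prod.snd_add]; push_cast; ring

lemma charPhase_sub (z w : ℤ × ℤ) (p : ℝ × ℝ) : charPhase (z - w) p = charPhase z p - charPhase w p := by
  simp only [charPhase, Prod.fst_sub, Prod.snd_sub]; push_cast; ring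

lemma continuous_charPhase (z : ℤ × ℤ) : Continuous (charPhase z) := by
  unfold charPhase; fun_prop

/-- The normalised Lebesgue measure on the torus, realised on the unit square. -/
def torusMeasure : Measure (ℝ × ℝ) :=
  (volume.restrict (Ioc (0 : ℝ) 1)).prod (volume.restrict (Ioc (0 : ℝ) 1))

instance : IsProbabilityMeasure (volume.restrict (Ioc (0 : ℝ) 1)) :=
  ⟨by simp⟩

instance : IsProbabilityMeasure torusMeasure := by unfold torusMeasure; infer_instance

lemma integral_cos_two_pi_int (m : ℤ) :
    ∫ x in Ioc (0 : ℝ) 1, Real.cos (2 * Real.pi * (m * x)) = if m = 0 then 1 else 0 := by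
  rw [← intervalIntegral.integral_of_le zero_le_one]
  split_ifs with h
  · simp [h]
  · have hm : (2 * Real.pi * m : ℝ) ≠ 0 := by
      have : (m : ℝ) ≠ 0 := by exact_mod_cast h
      have := Real.pi_ne_zero
      positivity
    have e : ∀ x : ℝ, 2 * Real.pi * (m * x) = (2 * Real.pi * m) * x := fun x => by ring
    simp_rw [e]
    rw [intervalIntegral.integral_comp_mul_left (fun x => Real.cos x) hm, integral_cos]
    have : Real.sin (2 * Real.pi * m) = 0 := by
      rw [show 2 * Real.pi * m = ((2 * m : ℤ) : ℝ) * Real.pi by push_cast; ring]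
      exact Real.sin_int_mul_pi _
    simp [this]

lemma integral_sin_two_pi_int (m : ℤ) :
    ∫ x in Ioc (0 : ℝ) 1, Real.sin (2 * Real.pi * (m * x)) = 0 := by
  rw [← intervalIntegral.integral_of_le zero_le_one]
  by_cases h : m = 0
  · simp [h]
  · have hm : (2 * Real.pi * m : ℝ) ≠ 0 := by
      have : (m : ℝ) ≠ 0 := by exact_mod_cast h
      have := Real.pi_ne_zero
      positivity
    have e : ∀ x : ℝ, 2 * Real.pi * (m * x) = (2 * Real.pi * m) * x := fun x => by ring
    simp_rw [e]
    rw [intervalIntegral.integral_comp_mul_left (fun x => Real.sin x) hm, integral_sin]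
    have : Real.cos (2 * Real.pi * m) = 1 := by
      rw [show 2 * Real.pi * m = (m : ℝ) * (2 * Real.pi) by ring]
      exact Real.cos_int_mul_two_pi _
    simp [this]

lemma integral_cos_charPhase (z : ℤ × ℤ) :
    ∫ p, Real.cos (charPhase z p) ∂torusMeasure = if z = 0 then 1 else 0 := by
  have e : ∀ p : ℝ × ℝ, Real.cos (charPhase z p) =
      Real.cos (2 * Real.pi * (z.1 * p.1)) * Real.cos (2 * Real.pi * (z.2 * p.2)) +
      Real.sin (2 * Real.pi * (z.1 * p.1)) * Real.sin (2 * Real.pi * (z.2 * p.2)) := by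
    intro p
    rw [← Real.cos_sub]; congr 1; unfold charPhase; ring
  simp_rw [e]
  have hi : ∀ f : ℝ → ℝ, Continuous f → (∀ x, |f x| ≤ 1) → Integrable f (volume.restrict (Ioc (0 : ℝ) 1)) :=
    fun f hf hb => Integrable.of_bound hf.aestronglyMeasurable 1 (ae_of_all _ hb)
  have c1 := fun m : ℤ => hi (fun x => Real.cos (2 * Real.pi * (m * x))) (by fun_prop) (fun x => Real.abs_cos_le_one _)
  have s1 := fun m : ℤ => hi (fun x => Real.sin (2 * Real.pi * (m * x))) (by fun_prop) (fun x => Real.abs_sin_le_one _)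
  unfold torusMeasure
  rw [integral_add ((c1 z.1).mul_prod (c1 z.2)) ((s1 z.1).mul_prod (s1 z.2)),
    integral_prod_mul (fun x => Real.cos (2 * Real.pi * (z.1 * x))) (fun x => Real.cos (2 * Real.pi * (z.2 * x))),
    integral_prod_mul (fun x => Real.sin (2 * Real.pi * (z.1 * x))) (fun x => Real.sin (2 * Real.pi * (z.2 * x))),
    integral_cos_two_pi_int, integral_cos_two_pi_int, integral_sin_two_pi_int]
  have : z = 0 ↔ z.1 = 0 ∧ z.2 = 0 := Prod.ext_iff
  by_cases h1 : z.1 = 0 <;> by_cases h2 : z.2 = 0 <;> simp [this, h1, h2]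

lemma integrable_torus_of_continuous {f : ℝ × ℝ → ℝ} (hf : Continuous f) {C : ℝ} (hC : ∀ p, |f p| ≤ C) :
    Integrable f torusMeasure :=
  Integrable.of_bound hf.aestronglyMeasurable C (ae_of_all _ hC)

lemma integrable_cos_charPhase (z : ℤ × ℤ) : Integrable (fun p => Real.cos (charPhase z p)) torusMeasure :=
  integrable_torus_of_continuous (Real.continuous_cos.comp (continuous_charPhase z))
    (fun _ => Real.abs_cos_le_one _)

/-- Parseval's identity for the increments of a finitely supported function. -/
lemma tsum_increment_sq_eq (r : ℤ × ℤ → ℝ) (Λ : Finset (ℤ × ℤ)) (hr : ∀ x, x ∉ Λ → r x = 0) (h : ℤ × ℤ) :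
    ∑' x, (r (x + h) - r x) ^ 2 = ∫ p, 2 * (1 - Real.cos (charPhase h p)) *
      ((∑ x ∈ Λ, r x * Real.cos (charPhase x p)) ^ 2 + (∑ x ∈ Λ, r x * Real.sin (charPhase x p)) ^ 2)
      ∂torusMeasure := by
  -- The square of the transform is a double sum of cosines of phase differences, and the factor 2(1
  -- - cos) shifts the difference by ±h. Integration then keeps only y = x and y = x ± h.
  have hpt : ∀ p, 2 * (1 - Real.cos (charPhase h p)) *
      ((∑ x ∈ Λ, r x * Real.cos (charPhase x p)) ^ 2 + (∑ x ∈ Λ, r x * Real.sin (charPhase x p)) ^ 2) =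
      ∑ x ∈ Λ, ∑ y ∈ Λ, r x * r y * (2 * Real.cos (charPhase (x - y) p) -
        Real.cos (charPhase (x - y + h) p) - Real.cos (charPhase (x - y - h) p)) := by
    intro p
    rw [sq, sq, Finset.sum_mul_sum, Finset.sum_mul_sum, ← Finset.sum_add_distrib, Finset.mul_sum]
    refine Finset.sum_congr rfl fun x _ => ?_
    rw [← Finset.sum_add_distrib, Finset.mul_sum]
    refine Finset.sum_congr rfl fun y _ => ?_
    rw [charPhase_add, charPhase_sub, charPhase_sub, charPhase_sub, Real.cos_add (charPhase x p - charPhase y p),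
      Real.cos_sub (charPhase x p - charPhase y p), Real.cos_sub]
    ring
  simp_rw [hpt]
  have hint : ∀ x y, Integrable (fun p => r x * r y * (2 * Real.cos (charPhase (x - y) p) -
        Real.cos (charPhase (x - y + h) p) - Real.cos (charPhase (x - y - h) p))) torusMeasure := fun x y =>
    ((((integrable_cos_charPhase _).const_mul 2).sub (integrable_cos_charPhase _)).sub
      (integrable_cos_charPhase _)).const_mul _
  rw [integral_finsetSum _ fun x _ => integrable_finsetSum _ fun y _ => hint x y]
  have hI : ∀ x ∈ Λ, ∫ p, ∑ y ∈ Λ, r x * r y * (2 * Real.cos (charPhase (x - y) p) -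
        Real.cos (charPhase (x - y + h) p) - Real.cos (charPhase (x - y - h) p)) ∂torusMeasure =
      2 * r x ^ 2 - r x * r (x + h) - r x * r (x - h) := by
    intro x hx
    rw [integral_finsetSum _ fun y _ => hint x y]
    have h1 : ∀ y, ∫ p, r x * r y * (2 * Real.cos (charPhase (x - y) p) -
        Real.cos (charPhase (x - y + h) p) - Real.cos (charPhase (x - y - h) p)) ∂torusMeasure =
        (if y = x then 2 * r x * r y else 0) - (if y = x + h then r x * r y else 0) -
        (if y = x - h then r x * r y else 0) := by
      intro y
      have k1 : Integrable (fun p => 2 * Real.cos (charPhase (x - y) p)) torusMeasure :=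
        (integrable_cos_charPhase _).const_mul 2
      have k2 : Integrable (fun p => 2 * Real.cos (charPhase (x - y) p) -
          Real.cos (charPhase (x - y + h) p)) torusMeasure := k1.sub (integrable_cos_charPhase _)
      rw [integral_const_mul, integral_sub k2 (integrable_cos_charPhase _),
        integral_sub k1 (integrable_cos_charPhase _), integral_const_mul, integral_cos_charPhase, integral_cos_charPhase, integral_cos_charPhase]
      have i1 : x - y = 0 ↔ y = x := by rw [sub_eq_zero, eq_comm]
      have i2 : x - y + h = 0 ↔ y = x + h := by
        rw [sub_add_eq_add_sub, sub_eq_zero, eq_comm]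
      have i3 : x - y - h = 0 ↔ y = x - h := by
        rw [sub_right_comm, sub_eq_zero, eq_comm]
      simp only [i1, i2, i3]
      split_ifs <;> ring
    simp_rw [h1]
    rw [Finset.sum_sub_distrib, Finset.sum_sub_distrib, Finset.sum_ite_eq', Finset.sum_ite_eq', Finset.sum_ite_eq', if_pos hx]
    have j : ∀ z, (if z ∈ Λ then r x * r z else 0) = r x * r z := by
      intro z
      split_ifs with hz
      · rfl
      · rw [hr z hz, mul_zero]
    rw [j, j]; ring
  rw [Finset.sum_congr rfl hI]
  have s1 : Summable fun x => r x ^ 2 := summable_of_ne_finset_zero (s := Λ) fun x hx => by simp [hr x hx]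
  have s2 : Summable fun x => r (x + h) ^ 2 := (Equiv.addRight h).summable_iff.mpr s1
  have s3 : Summable fun x => r x * r (x + h) := summable_of_ne_finset_zero (s := Λ) fun x hx => by simp [hr x hx]
  have s4 : Summable fun x => r x * r (x - h) := summable_of_ne_finset_zero (s := Λ) fun x hx => by simp [hr x hx]
  have t2 : ∑' x, r (x + h) ^ 2 = ∑' x, r x ^ 2 := (Equiv.addRight h).tsum_eq (fun x => r x ^ 2)
  have t3 : ∑' x, r x * r (x + h) = ∑' x, r x * r (x - h) := by
    rw [← (Equiv.addRight h).tsum_eq (fun x => r x * r (x - h))]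
    refine tsum_congr fun x => ?_
    simp [mul_comm]
  rw [← tsum_eq_sum (L := SummationFilter.unconditional _) (f := fun x => 2 * r x ^ 2 - r x * r (x + h) - r x * r (x - h)) (fun x hx => by simp [hr x hx]),
    ((s1.mul_left 2).sub s3).tsum_sub s4, (s1.mul_left 2).tsum_sub s3, tsum_mul_left, ← t3]
  have e : ∀ x, (r (x + h) - r x) ^ 2 = r (x + h) ^ 2 + r x ^ 2 - 2 * (r x * r (x + h)) := fun x => by ring
  simp_rw [e]
  rw [(s2.add s1).tsum_sub (s3.mul_left 2), s2.tsum_add s1, tsum_mul_left, t2]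
  ring

/-- The squared length of a vector, in terms of its inner products with the basis of the
hexagonal lattice. -/
def dualSq (y : ℝ × ℝ) : ℝ := 4 / (3 * rStar ^ 2) * (y.1 ^ 2 - y.1 * y.2 + y.2 ^ 2)

/-- The inner product of a lattice vector with a vector given by its inner products with the
basis. -/
def dualPair (h : ℤ × ℤ) (y : ℝ × ℝ) : ℝ := h.1 * y.1 + h.2 * y.2

/-- Cosine transform. -/
def cosCoeff (r : ℤ × ℤ → ℝ) (Λ : Finset (ℤ × ℤ)) (p : ℝ × ℝ) : ℝ :=
  ∑ x ∈ Λ, r x * Real.cos (charPhase x p)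

/-- Sine transform. -/
def sinCoeff (r : ℤ × ℤ → ℝ) (Λ : Finset (ℤ × ℤ)) (p : ℝ × ℝ) : ℝ :=
  ∑ x ∈ Λ, r x * Real.sin (charPhase x p)

lemma continuous_cosCoeff (r : ℤ × ℤ → ℝ) (Λ : Finset (ℤ × ℤ)) : Continuous (cosCoeff r Λ) := by
  unfold cosCoeff
  exact continuous_finsetSum _ fun x _ => continuous_const.mul (Real.continuous_cos.comp (continuous_charPhase x))

lemma continuous_sinCoeff (r : ℤ × ℤ → ℝ) (Λ : Finset (ℤ × ℤ)) : Continuous (sinCoeff r Λ) := by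
  unfold sinCoeff
  exact continuous_finsetSum _ fun x _ => continuous_const.mul (Real.continuous_sin.comp (continuous_charPhase x))

lemma abs_cosCoeff_le (r : ℤ × ℤ → ℝ) (Λ : Finset (ℤ × ℤ)) (p : ℝ × ℝ) :
    |cosCoeff r Λ p| ≤ ∑ x ∈ Λ, |r x| := by
  refine (Finset.abs_sum_le_sum_abs _ _).trans (Finset.sum_le_sum fun x _ => ?_)
  rw [abs_mul]
  exact mul_le_of_le_one_right (abs_nonneg _) (Real.abs_cos_le_one _)

lemma abs_sinCoeff_le (r : ℤ × ℤ → ℝ) (Λ : Finset (ℤ × ℤ)) (p : ℝ × ℝ) :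
    |sinCoeff r Λ p| ≤ ∑ x ∈ Λ, |r x| := by
  refine (Finset.abs_sum_le_sum_abs _ _).trans (Finset.sum_le_sum fun x _ => ?_)
  rw [abs_mul]
  exact mul_le_of_le_one_right (abs_nonneg _) (Real.abs_sin_le_one _)

lemma dualSq_nonneg (y : ℝ × ℝ) : 0 ≤ dualSq y := by
  have h1 : 0 ≤ y.1 ^ 2 - y.1 * y.2 + y.2 ^ 2 := by nlinarith [sq_nonneg (y.1 - y.2)]
  unfold dualSq
  positivity

/-- The sum of the squared lengths of the increments of `q` in the direction `h`. -/
def incSq (q : ℤ × ℤ → ℝ × ℝ) (h : ℤ × ℤ) : ℝ := ∑' x, dualSq (q (x + h) - q x)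

/-- The sum of the squared inner products with `h` of the increments of `q` in the direction `h`. -/
def incPairSq (q : ℤ × ℤ → ℝ × ℝ) (h : ℤ × ℤ) : ℝ := ∑' x, dualPair h (q (x + h) - q x) ^ 2

/-- The sum of the squared lengths of the increments of `q` along nearest neighbour edges. -/
def edgeEnergy (q : ℤ × ℤ → ℝ × ℝ) : ℝ := incSq q (1, 0) + incSq q (0, 1) + incSq q (1, -1)

lemma summable_increment {q : ℤ × ℤ → ℝ × ℝ} {Λ : Finset (ℤ × ℤ)} (hq : ∀ x, x ∉ Λ → q x = 0)
    (h : ℤ × ℤ) {g : ℝ × ℝ → ℝ} (hg : g 0 = 0) : Summable fun x => g (q (x + h) - q x) := by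
  classical
  refine summable_of_ne_finset_zero (s := Λ ∪ Λ.image (· - h)) fun x hx => ?_
  rw [Finset.mem_union, not_or] at hx
  have h1 : x + h ∉ Λ := fun h' => hx.2 (Finset.mem_image.mpr ⟨_, h', by simp⟩)
  rw [hq x hx.1, hq _ h1, sub_zero, hg]

lemma incSq_nonneg (q : ℤ × ℤ → ℝ × ℝ) (h : ℤ × ℤ) : 0 ≤ incSq q h := tsum_nonneg fun _ => dualSq_nonneg _

lemma edgeEnergy_nonneg (q : ℤ × ℤ → ℝ × ℝ) : 0 ≤ edgeEnergy q :=
  add_nonneg (add_nonneg (incSq_nonneg _ _) (incSq_nonneg _ _)) (incSq_nonneg _ _)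

lemma tsum_linear_increment_sq_eq {q : ℤ × ℤ → ℝ × ℝ} {Λ : Finset (ℤ × ℤ)} (hq : ∀ x, x ∉ Λ → q x = 0)
    (h : ℤ × ℤ) (l₁ l₂ : ℝ) :
    ∑' x, (l₁ * (q (x + h) - q x).1 + l₂ * (q (x + h) - q x).2) ^ 2 =
    ∫ p, 2 * (1 - Real.cos (charPhase h p)) *
      ((l₁ * cosCoeff (fun x => (q x).1) Λ p + l₂ * cosCoeff (fun x => (q x).2) Λ p) ^ 2 +
       (l₁ * sinCoeff (fun x => (q x).1) Λ p + l₂ * sinCoeff (fun x => (q x).2) Λ p) ^ 2) ∂torusMeasure := by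
  have := tsum_increment_sq_eq (fun x => l₁ * (q x).1 + l₂ * (q x).2) Λ (fun x hx => by simp [hq x hx]) h
  convert this using 1
  · refine tsum_congr fun x => ?_
    simp only [Prod.fst_sub, Prod.snd_sub]; ring
  · refine integral_congr_ae (ae_of_all _ fun p => ?_)
    simp only [cosCoeff, sinCoeff, Finset.mul_sum, ← Finset.sum_add_distrib]
    congr 3 <;> refine Finset.sum_congr rfl fun x _ => by ring

lemma integrable_increment_kernel (q : ℤ × ℤ → ℝ × ℝ) (Λ : Finset (ℤ × ℤ)) (h : ℤ × ℤ) (l₁ l₂ : ℝ) :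
    Integrable (fun p => 2 * (1 - Real.cos (charPhase h p)) *
      ((l₁ * cosCoeff (fun x => (q x).1) Λ p + l₂ * cosCoeff (fun x => (q x).2) Λ p) ^ 2 +
       (l₁ * sinCoeff (fun x => (q x).1) Λ p + l₂ * sinCoeff (fun x => (q x).2) Λ p) ^ 2)) torusMeasure := by
  set M := |l₁| * ∑ x ∈ Λ, |(q x).1| + |l₂| * ∑ x ∈ Λ, |(q x).2| with hM
  have c1 := continuous_cosCoeff (fun x => (q x).1) Λ
  have c2 := continuous_cosCoeff (fun x => (q x).2) Λ
  have c3 := continuous_sinCoeff (fun x => (q x).1) Λ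
  have c4 := continuous_sinCoeff (fun x => (q x).2) Λ
  have c5 := continuous_charPhase h
  refine integrable_torus_of_continuous (by fun_prop) (C := 4 * (M ^ 2 + M ^ 2)) fun p => ?_
  have k1 := Real.neg_one_le_cos (charPhase h p)
  have k2 := Real.cos_le_one (charPhase h p)
  have b1 : (l₁ * cosCoeff (fun x => (q x).1) Λ p + l₂ * cosCoeff (fun x => (q x).2) Λ p) ^ 2 ≤ M ^ 2 := by
    rw [sq_le_sq, abs_of_nonneg (a := M) (by positivity)]
    refine (abs_add_le _ _).trans ?_
    rw [abs_mul, abs_mul]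
    exact add_le_add (mul_le_mul_of_nonneg_left (abs_cosCoeff_le _ _ _) (abs_nonneg _))
      (mul_le_mul_of_nonneg_left (abs_cosCoeff_le _ _ _) (abs_nonneg _))
  have b2 : (l₁ * sinCoeff (fun x => (q x).1) Λ p + l₂ * sinCoeff (fun x => (q x).2) Λ p) ^ 2 ≤ M ^ 2 := by
    rw [sq_le_sq, abs_of_nonneg (a := M) (by positivity)]
    refine (abs_add_le _ _).trans ?_
    rw [abs_mul, abs_mul]
    exact add_le_add (mul_le_mul_of_nonneg_left (abs_sinCoeff_le _ _ _) (abs_nonneg _))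
      (mul_le_mul_of_nonneg_left (abs_sinCoeff_le _ _ _) (abs_nonneg _))
  rw [abs_of_nonneg (by have : 0 ≤ 1 - Real.cos (charPhase h p) := by linarith
                        positivity)]
  apply mul_le_mul (by linarith) (add_le_add b1 b2) (by positivity) (by norm_num)

/-- The sum of the squares of the cosine and sine transforms, measured by `dualSq`. -/
def spectralDensity (q : ℤ × ℤ → ℝ × ℝ) (Λ : Finset (ℤ × ℤ)) (p : ℝ × ℝ) : ℝ :=
  dualSq (cosCoeff (fun x => (q x).1) Λ p, cosCoeff (fun x => (q x).2) Λ p) +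
    dualSq (sinCoeff (fun x => (q x).1) Λ p, sinCoeff (fun x => (q x).2) Λ p)

lemma spectralDensity_nonneg (q : ℤ × ℤ → ℝ × ℝ) (Λ : Finset (ℤ × ℤ)) (p : ℝ × ℝ) :
    0 ≤ spectralDensity q Λ p := add_nonneg (dualSq_nonneg _) (dualSq_nonneg _)

/-- Diagonalising the form as two squares of linear functionals reduces its Parseval identity to the
scalar one. -/
lemma dualSq_eq (y : ℝ × ℝ) : dualSq y = 4 / (3 * rStar ^ 2) * (1 * y.1 + (-(1 / 2)) * y.2) ^ 2 +
    1 / rStar ^ 2 * (0 * y.1 + 1 * y.2) ^ 2 := by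
  have := rStar_pos
  unfold dualSq; field_simp; ring

lemma integrable_spectralDensity (q : ℤ × ℤ → ℝ × ℝ) (Λ : Finset (ℤ × ℤ)) (h : ℤ × ℤ) :
    Integrable (fun p => 2 * (1 - Real.cos (charPhase h p)) * spectralDensity q Λ p) torusMeasure := by
  have := ((integrable_increment_kernel q Λ h 1 (-(1 / 2))).const_mul (4 / (3 * rStar ^ 2))).add
    ((integrable_increment_kernel q Λ h 0 1).const_mul (1 / rStar ^ 2))
  refine this.congr (ae_of_all _ fun p => ?_)
  simp only [Pi.add_apply, spectralDensity, dualSq_eq]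
  ring

lemma incSq_eq {q : ℤ × ℤ → ℝ × ℝ} {Λ : Finset (ℤ × ℤ)} (hq : ∀ x, x ∉ Λ → q x = 0) (h : ℤ × ℤ) :
    incSq q h = ∫ p, 2 * (1 - Real.cos (charPhase h p)) * spectralDensity q Λ p ∂torusMeasure := by
  have e : ∀ p, 2 * (1 - Real.cos (charPhase h p)) * spectralDensity q Λ p =
      4 / (3 * rStar ^ 2) * (2 * (1 - Real.cos (charPhase h p)) *
      ((1 * cosCoeff (fun x => (q x).1) Λ p + -(1 / 2) * cosCoeff (fun x => (q x).2) Λ p) ^ 2 +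
       (1 * sinCoeff (fun x => (q x).1) Λ p + -(1 / 2) * sinCoeff (fun x => (q x).2) Λ p) ^ 2)) +
      1 / rStar ^ 2 * (2 * (1 - Real.cos (charPhase h p)) *
      ((0 * cosCoeff (fun x => (q x).1) Λ p + 1 * cosCoeff (fun x => (q x).2) Λ p) ^ 2 +
       (0 * sinCoeff (fun x => (q x).1) Λ p + 1 * sinCoeff (fun x => (q x).2) Λ p) ^ 2)) := by
    intro p
    simp only [spectralDensity, dualSq_eq]
    ring
  simp_rw [e]
  rw [integral_add ((integrable_increment_kernel q Λ h 1 (-(1 / 2))).const_mul _)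
    ((integrable_increment_kernel q Λ h 0 1).const_mul _), integral_const_mul, integral_const_mul,
    ← tsum_linear_increment_sq_eq hq, ← tsum_linear_increment_sq_eq hq, ← tsum_mul_left, ← tsum_mul_left,
    ← Summable.tsum_add]
  · exact tsum_congr fun x => dualSq_eq _
  · exact (summable_increment hq h (g := fun y => (1 * y.1 + -(1 / 2) * y.2) ^ 2) (by simp)).mul_left _
  · exact (summable_increment hq h (g := fun y => (0 * y.1 + 1 * y.2) ^ 2) (by simp)).mul_left _

/-- For the phase h.1 s - h.2 t, the directions (1, 0), (0, 1), (1, -1) have phases proportional to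
s, -t and s + t, which are those of `hexWeight`. -/
lemma edgeEnergy_eq {q : ℤ × ℤ → ℝ × ℝ} {Λ : Finset (ℤ × ℤ)} (hq : ∀ x, x ∉ Λ → q x = 0) :
    edgeEnergy q = ∫ p, 2 * hexWeight p.1 p.2 * spectralDensity q Λ p ∂torusMeasure := by
  have i1 := integrable_spectralDensity q Λ (1, 0)
  have i2 := integrable_spectralDensity q Λ (0, 1)
  have i3 := integrable_spectralDensity q Λ (1, -1)
  rw [edgeEnergy, incSq_eq hq, incSq_eq hq, incSq_eq hq, ← integral_add i1 i2]
  have i12 : Integrable (fun p => 2 * (1 - Real.cos (charPhase (1, 0) p)) * spectralDensity q Λ p +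
    2 * (1 - Real.cos (charPhase (0, 1) p)) * spectralDensity q Λ p) torusMeasure := i1.add i2
  rw [← integral_add i12 i3]
  refine integral_congr_ae (ae_of_all _ fun p => ?_)
  have e1 : charPhase (1, 0) p = 2 * Real.pi * p.1 := by simp [charPhase]
  have e2 : charPhase (0, 1) p = -(2 * Real.pi * p.2) := by simp [charPhase]
  have e3 : charPhase (1, -1) p = 2 * Real.pi * (p.1 + p.2) := by simp [charPhase]
  simp only [e1, e2, e3, hexWeight, Real.cos_neg]
  ring

lemma abs_sin_nat_mul_le (n : ℕ) (x : ℝ) : |Real.sin (n * x)| ≤ n * |Real.sin x| := by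
  induction n with
  | zero => simp
  | succ n ih =>
    push_cast
    rw [add_mul, one_mul, Real.sin_add, add_mul, one_mul]
    refine (abs_add_le _ _).trans (add_le_add ?_ ?_)
    · rw [abs_mul]; exact (mul_le_of_le_one_right (abs_nonneg _) (Real.abs_cos_le_one _)).trans ih
    · rw [abs_mul]; exact mul_le_of_le_one_left (abs_nonneg _) (Real.abs_cos_le_one _)

lemma abs_sin_int_mul_le (m : ℤ) (x : ℝ) : |Real.sin (m * x)| ≤ |(m : ℝ)| * |Real.sin x| := by
  obtain ⟨n, rfl | rfl⟩ := m.eq_nat_or_neg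
  · simpa using abs_sin_nat_mul_le n x
  · simpa [Real.sin_neg] using abs_sin_nat_mul_le n x

/-- From 1 - cos 2x = 2 sin² x, |sin (m x)| ≤ |m| |sin x| and Cauchy-Schwarz; the third term of
`hexWeight` is dropped. -/
lemma one_sub_cos_charPhase_le (h : ℤ × ℤ) (p : ℝ × ℝ) :
    1 - Real.cos (charPhase h p) ≤ ((h.1 : ℝ) ^ 2 + (h.2 : ℝ) ^ 2) * hexWeight p.1 p.2 := by
  have e : ∀ x : ℝ, 1 - Real.cos (2 * x) = 2 * Real.sin x ^ 2 := fun x => by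
    rw [Real.cos_two_mul, Real.sin_sq]; ring
  have e1 : charPhase h p = 2 * (h.1 * (Real.pi * p.1) - h.2 * (Real.pi * p.2)) := by unfold charPhase; ring
  have e2 : 2 * (Real.sin (Real.pi * p.1) ^ 2 + Real.sin (Real.pi * p.2) ^ 2) ≤ hexWeight p.1 p.2 := by
    unfold hexWeight
    rw [mul_assoc 2 Real.pi p.1, mul_assoc 2 Real.pi p.2, e, e]
    linarith [Real.cos_le_one (2 * Real.pi * (p.1 + p.2))]
  rw [e1, e]
  have b1 := abs_sin_int_mul_le h.1 (Real.pi * p.1)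
  have b2 := abs_sin_int_mul_le h.2 (Real.pi * p.2)
  have b : |Real.sin (h.1 * (Real.pi * p.1) - h.2 * (Real.pi * p.2))| ≤
      |(h.1 : ℝ)| * |Real.sin (Real.pi * p.1)| + |(h.2 : ℝ)| * |Real.sin (Real.pi * p.2)| := by
    rw [Real.sin_sub]
    refine (abs_sub _ _).trans (add_le_add ?_ ?_)
    · rw [abs_mul]; exact (mul_le_of_le_one_right (abs_nonneg _) (Real.abs_cos_le_one _)).trans b1
    · rw [abs_mul]; exact (mul_le_of_le_one_left (abs_nonneg _) (Real.abs_cos_le_one _)).trans b2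
  have b' : Real.sin (h.1 * (Real.pi * p.1) - h.2 * (Real.pi * p.2)) ^ 2 ≤
      ((h.1 : ℝ) ^ 2 + (h.2 : ℝ) ^ 2) * (Real.sin (Real.pi * p.1) ^ 2 + Real.sin (Real.pi * p.2) ^ 2) := by
    rw [← sq_abs, ← sq_abs (h.1 : ℝ), ← sq_abs (h.2 : ℝ), ← sq_abs (Real.sin (Real.pi * p.1)),
      ← sq_abs (Real.sin (Real.pi * p.2))]
    refine (pow_le_pow_left₀ (abs_nonneg _) b 2).trans ?_
    nlinarith [sq_nonneg (|(h.1 : ℝ)| * |Real.sin (Real.pi * p.2)| - |(h.2 : ℝ)| * |Real.sin (Real.pi * p.1)|)]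
  calc 2 * Real.sin (h.1 * (Real.pi * p.1) - h.2 * (Real.pi * p.2)) ^ 2
      ≤ ((h.1 : ℝ) ^ 2 + (h.2 : ℝ) ^ 2) *
        (2 * (Real.sin (Real.pi * p.1) ^ 2 + Real.sin (Real.pi * p.2) ^ 2)) := by linarith
    _ ≤ _ := by gcongr

/-- Long increments are controlled by nearest neighbour ones with only quadratic growth in h, which
a Gaussian absorbs. The inequality is read off from the symbols. -/
lemma incSq_le {q : ℤ × ℤ → ℝ × ℝ} {Λ : Finset (ℤ × ℤ)} (hq : ∀ x, x ∉ Λ → q x = 0) (h : ℤ × ℤ) :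
    incSq q h ≤ ((h.1 : ℝ) ^ 2 + (h.2 : ℝ) ^ 2) * edgeEnergy q := by
  have i1 := integrable_spectralDensity q Λ (1, 0)
  have i2 := integrable_spectralDensity q Λ (0, 1)
  have i3 := integrable_spectralDensity q Λ (1, -1)
  rw [incSq_eq hq, edgeEnergy_eq hq, ← integral_const_mul]
  refine integral_mono (integrable_spectralDensity q Λ h) (Integrable.const_mul ?_ _) fun p => ?_
  · refine ((i1.add i2).add i3).congr (ae_of_all _ fun p => ?_)
    have e1 : charPhase (1, 0) p = 2 * Real.pi * p.1 := by simp [charPhase]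
    have e2 : charPhase (0, 1) p = -(2 * Real.pi * p.2) := by simp [charPhase]
    have e3 : charPhase (1, -1) p = 2 * Real.pi * (p.1 + p.2) := by simp [charPhase]
    simp only [Pi.add_apply, e1, e2, e3, hexWeight, Real.cos_neg]
    ring
  · have := mul_le_mul_of_nonneg_right (one_sub_cos_charPhase_le h p) (spectralDensity_nonneg q Λ p)
    simp only
    linarith

lemma integrable_tsum_of_summable_integral_norm {ι X : Type*} [Countable ι] [MeasurableSpace X] {μ : Measure X}
    {F : ι → X → ℝ} (hF : ∀ i, Integrable (F i) μ) (hs : Summable fun i => ∫ a, ‖F i a‖ ∂μ) :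
    Integrable (fun a => ∑' i, F i a) μ := by
  refine ⟨(AEMeasurable.tsum fun i => (hF i).aestronglyMeasurable.aemeasurable).aestronglyMeasurable, ?_⟩
  refine lt_of_le_of_lt (lintegral_mono fun a => enorm_tsum_le_tsum_enorm) ?_
  rw [lintegral_tsum fun i => (hF i).aestronglyMeasurable.enorm]
  have e : ∀ i, ∫⁻ a, ‖F i a‖ₑ ∂μ = ENNReal.ofReal (∫ a, ‖F i a‖ ∂μ) := fun i =>
    (ofReal_integral_norm_eq_lintegral_enorm (hF i)).symm
  simp_rw [e]
  rw [← ENNReal.ofReal_tsum_of_nonneg (fun i => integral_nonneg fun a => norm_nonneg _) hs]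
  exact ENNReal.ofReal_lt_top

lemma summable_pow_mul_exp_hexForm {c : ℝ} (hc : 0 < c) (k : ℕ) :
    Summable fun h : ℤ × ℤ => (1 + ((h.1 : ℝ) ^ 2 + (h.2 : ℝ) ^ 2)) ^ k * Real.exp (-(c * hexForm h.1 h.2)) := by
  refine summable_of_le_pow_mul_exp (half_pos hc) k (C := 1) fun h => ?_
  rw [abs_of_nonneg (by positivity), one_mul]
  gcongr
  have := half_le_hexForm h.1 h.2
  nlinarith

/-- Cauchy-Schwarz in the plane: the right side is the product of the squared lengths of the lattice
vector and of the vector with coordinates y. -/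
lemma dualPair_sq_le (h : ℤ × ℤ) (y : ℝ × ℝ) :
    dualPair h y ^ 2 ≤ rStar ^ 2 * hexForm h.1 h.2 * dualSq y := by
  have hr := rStar_pos
  have e : rStar ^ 2 * hexForm h.1 h.2 * dualSq y =
      4 / 3 * (hexForm h.1 h.2 * (y.1 ^ 2 - y.1 * y.2 + y.2 ^ 2)) := by
    unfold dualSq; field_simp
  rw [e]
  unfold dualPair hexForm
  nlinarith [sq_nonneg ((h.1 : ℝ) * y.1 - 2 * h.1 * y.2 + 2 * h.2 * y.1 - h.2 * y.2)]

lemma incPairSq_le {q : ℤ × ℤ → ℝ × ℝ} {Λ : Finset (ℤ × ℤ)} (hq : ∀ x, x ∉ Λ → q x = 0) (h : ℤ × ℤ) :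
    incPairSq q h ≤ rStar ^ 2 * hexForm h.1 h.2 * incSq q h := by
  rw [incPairSq, incSq, ← tsum_mul_left]
  refine Summable.tsum_le_tsum (fun x => dualPair_sq_le _ _) ?_ ?_
  · exact summable_increment hq h (g := fun y => dualPair h y ^ 2) (by simp [dualPair])
  · exact (summable_increment hq h (g := dualSq) (by simp [dualSq])).mul_left _

/-- The second order part of the Gaussian energy of a displacement. -/
def gaussHessian (α : ℝ) (q : ℤ × ℤ → ℝ × ℝ) (h : ℤ × ℤ) : ℝ :=
  Real.exp (-(Real.pi * (α * rStar ^ 2)) * hexForm h.1 h.2) *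
    (2 * Real.pi ^ 2 * α ^ 2 * incPairSq q h - Real.pi * α * incSq q h)

lemma incPairSq_eq {q : ℤ × ℤ → ℝ × ℝ} {Λ : Finset (ℤ × ℤ)} (hq : ∀ x, x ∉ Λ → q x = 0) (h : ℤ × ℤ) :
    incPairSq q h = ∫ p, 2 * (1 - Real.cos (charPhase h p)) *
      ((h.1 * cosCoeff (fun x => (q x).1) Λ p + h.2 * cosCoeff (fun x => (q x).2) Λ p) ^ 2 +
       (h.1 * sinCoeff (fun x => (q x).1) Λ p + h.2 * sinCoeff (fun x => (q x).2) Λ p) ^ 2) ∂torusMeasure :=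
  tsum_linear_increment_sq_eq hq h h.1 h.2

/-- The second order part of the Gaussian energy of a displacement controls its edge energy. -/
lemma hasSum_gaussHessian {α : ℝ} (hα : 0 < α) {q : ℤ × ℤ → ℝ × ℝ} {Λ : Finset (ℤ × ℤ)}
    (hq : ∀ x, x ∉ Λ → q x = 0) :
    Summable (gaussHessian α q) ∧ 1 / 2000 * gaussGap α * edgeEnergy q ≤ ∑' h, gaussHessian α q h := by
  have hr := rStar_pos
  have hr2 := one_le_rStar_sq
  have ha : 0 < α * rStar ^ 2 := by positivity
  have hG := edgeEnergy_nonneg q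
  set A₁ := cosCoeff (fun x => (q x).1) Λ with hA1
  set A₂ := cosCoeff (fun x => (q x).2) Λ with hA2
  set B₁ := sinCoeff (fun x => (q x).1) Λ with hB1
  set B₂ := sinCoeff (fun x => (q x).2) Λ with hB2
  set F : ℤ × ℤ → ℝ × ℝ → ℝ := fun h p => α ^ 2 * (dynTerm (α * rStar ^ 2) p.1 p.2 (A₁ p) (A₂ p) h +
    dynTerm (α * rStar ^ 2) p.1 p.2 (B₁ p) (B₂ p) h) with hF
  set k₁ : ℤ × ℤ → ℝ × ℝ → ℝ := fun h p => 2 * (1 - Real.cos (charPhase h p)) *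
      ((h.1 * A₁ p + h.2 * A₂ p) ^ 2 + (h.1 * B₁ p + h.2 * B₂ p) ^ 2) with hk1
  set k₂ : ℤ × ℤ → ℝ × ℝ → ℝ := fun h p => 2 * (1 - Real.cos (charPhase h p)) * spectralDensity q Λ p with hk2
  set E : ℤ × ℤ → ℝ := fun h => Real.exp (-(Real.pi * (α * rStar ^ 2)) * hexForm h.1 h.2) with hE
  have hFe : ∀ h p, F h p = E h * (2 * Real.pi ^ 2 * α ^ 2 * k₁ h p - Real.pi * α * k₂ h p) := by
    intro h p
    have e1 : charPhase h p = 2 * Real.pi * (h.1 * p.1 - h.2 * p.2) := rfl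
    simp only [hF, hk1, hk2, hE, dynTerm, spectralDensity, dualSq, e1, ← hA1, ← hA2, ← hB1, ← hB2]
    field_simp
    ring
  have ik1 : ∀ h, Integrable (k₁ h) torusMeasure := fun h => integrable_increment_kernel q Λ h h.1 h.2
  have ik2 : ∀ h, Integrable (k₂ h) torusMeasure := fun h => integrable_spectralDensity q Λ h
  have nk1 : ∀ h p, 0 ≤ k₁ h p := fun h p => by
    have : 0 ≤ 1 - Real.cos (charPhase h p) := by linarith [Real.cos_le_one (charPhase h p)]
    simp only [hk1]; positivity
  have nk2 : ∀ h p, 0 ≤ k₂ h p := fun h p => by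
    have : 0 ≤ 1 - Real.cos (charPhase h p) := by linarith [Real.cos_le_one (charPhase h p)]
    have := spectralDensity_nonneg q Λ p
    simp only [hk2]; positivity
  have j1 : ∀ h, ∫ p, k₁ h p ∂torusMeasure = incPairSq q h := fun h => (incPairSq_eq hq h).symm
  have j2 : ∀ h, ∫ p, k₂ h p ∂torusMeasure = incSq q h := fun h => (incSq_eq hq h).symm
  have iF : ∀ h, Integrable (F h) torusMeasure := fun h => by
    have : F h = fun p => E h * (2 * Real.pi ^ 2 * α ^ 2 * k₁ h p - Real.pi * α * k₂ h p) := funext (hFe h)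
    rw [this]
    exact (((ik1 h).const_mul _).sub ((ik2 h).const_mul _)).const_mul _
  have jF : ∀ h, ∫ p, F h p ∂torusMeasure = gaussHessian α q h := fun h => by
    simp_rw [hFe]
    rw [integral_const_mul, integral_sub ((ik1 h).const_mul _) ((ik2 h).const_mul _), integral_const_mul,
      integral_const_mul, j1, j2, gaussHessian]
  -- Summability in L¹ allows the lattice sum and the torus integral to be exchanged, so that the
  -- pointwise bound `tsum_dynTerm_ge` can be integrated.
  have hsum : Summable fun h => ∫ p, ‖F h p‖ ∂torusMeasure := by
    have hs := (summable_pow_mul_exp_hexForm (c := Real.pi * (α * rStar ^ 2)) (by positivity) 2).mul_left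
      ((2 * Real.pi ^ 2 * α ^ 2 * (rStar ^ 2 * 2) + Real.pi * α) * edgeEnergy q)
    refine Summable.of_nonneg_of_le (fun h => integral_nonneg fun p => norm_nonneg _) (fun h => ?_) hs
    have s1 : ∫ p, ‖F h p‖ ∂torusMeasure ≤
        ∫ p, E h * (2 * Real.pi ^ 2 * α ^ 2 * k₁ h p + Real.pi * α * k₂ h p) ∂torusMeasure := by
      refine integral_mono (iF h).norm ((((ik1 h).const_mul _).add ((ik2 h).const_mul _)).const_mul _) fun p => ?_
      have n1 := nk1 h p
      have n2 := nk2 h p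
      simp only [hFe, norm_mul, Real.norm_eq_abs, Real.abs_exp, hE]
      refine mul_le_mul_of_nonneg_left ?_ (Real.exp_pos _).le
      refine (abs_sub _ _).trans_eq ?_
      rw [abs_of_nonneg (by positivity), abs_of_nonneg (by positivity)]
    refine s1.trans ?_
    rw [integral_const_mul, integral_add ((ik1 h).const_mul _) ((ik2 h).const_mul _), integral_const_mul,
      integral_const_mul, j1, j2]
    set R := (h.1 : ℝ) ^ 2 + (h.2 : ℝ) ^ 2 with hR
    have hR0 : 0 ≤ R := by positivity
    have l1 := incSq_le hq h
    have l2 := incPairSq_le hq h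
    have l3 : hexForm h.1 h.2 ≤ 2 * (1 + R) := by have := hexForm_le h.1 h.2; linarith
    have l4 := hexForm_nonneg h.1 h.2
    have l5 := incSq_nonneg q h
    have l6 : incSq q h ≤ (1 + R) * edgeEnergy q := l1.trans (mul_le_mul_of_nonneg_right (by linarith) hG)
    have l7 : incPairSq q h ≤ rStar ^ 2 * (2 * (1 + R)) * ((1 + R) * edgeEnergy q) := l2.trans (by gcongr)
    have l8 : incSq q h ≤ (1 + R) ^ 2 * edgeEnergy q := l6.trans (by gcongr; exact le_self_pow₀ (by linarith) two_ne_zero)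
    rw [hE]
    simp only
    rw [show -(Real.pi * (α * rStar ^ 2)) * hexForm h.1 h.2 = -(Real.pi * (α * rStar ^ 2) * hexForm h.1 h.2) by ring]
    calc _ ≤ Real.exp (-(Real.pi * (α * rStar ^ 2) * hexForm h.1 h.2)) *
        (2 * Real.pi ^ 2 * α ^ 2 * (rStar ^ 2 * (2 * (1 + R)) * ((1 + R) * edgeEnergy q)) +
          Real.pi * α * ((1 + R) ^ 2 * edgeEnergy q)) := by gcongr
      _ = _ := by ring
  have hS := hasSum_integral_of_summable_integral_norm iF hsum
  simp_rw [jF] at hS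
  refine ⟨hS.summable, ?_⟩
  rw [hS.tsum_eq, edgeEnergy_eq hq, ← integral_const_mul]
  have iW : Integrable (fun p => 2 * hexWeight p.1 p.2 * spectralDensity q Λ p) torusMeasure := by
    refine (((ik2 (1, 0)).add (ik2 (0, 1))).add (ik2 (1, -1))).congr (ae_of_all _ fun p => ?_)
    have e1 : charPhase (1, 0) p = 2 * Real.pi * p.1 := by simp [charPhase]
    have e2 : charPhase (0, 1) p = -(2 * Real.pi * p.2) := by simp [charPhase]
    have e3 : charPhase (1, -1) p = 2 * Real.pi * (p.1 + p.2) := by simp [charPhase]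
    simp only [Pi.add_apply, hk2, e1, e2, e3, hexWeight, Real.cos_neg]
    ring
  refine integral_mono (iW.const_mul _) ?_ fun p => ?_
  · refine integrable_tsum_of_summable_integral_norm iF hsum
  · have d1 := tsum_dynTerm_ge hα p.1 p.2 (A₁ p) (A₂ p)
    have d2 := tsum_dynTerm_ge hα p.1 p.2 (B₁ p) (B₂ p)
    have t : ∑' h, F h p = α ^ 2 * (∑' h, dynTerm (α * rStar ^ 2) p.1 p.2 (A₁ p) (A₂ p) h +
        ∑' h, dynTerm (α * rStar ^ 2) p.1 p.2 (B₁ p) (B₂ p) h) := by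
      rw [← (summable_dynTerm ha _ _ _ _).tsum_add (summable_dynTerm ha _ _ _ _), ← tsum_mul_left]
    simp only [t, spectralDensity, dualSq]
    rw [← hA1, ← hA2, ← hB1, ← hB2]
    have g := gaussGap_pos α
    have w := hexWeight_nonneg p.1 p.2
    have y1 : 0 ≤ A₁ p ^ 2 - A₁ p * A₂ p + A₂ p ^ 2 := by nlinarith [sq_nonneg (A₁ p - A₂ p)]
    have y2 : 0 ≤ B₁ p ^ 2 - B₁ p * B₂ p + B₂ p ^ 2 := by nlinarith [sq_nonneg (B₁ p - B₂ p)]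
    -- The constant 1/2000 absorbs the normalisation 4/(3 r⋆²) ≤ 2 of `dualSq`.
    have c1 : 1 / 2000 * (2 * (4 / (3 * rStar ^ 2))) ≤ 2 / 1000 := by
      have : 4 / (3 * rStar ^ 2) ≤ 2 := by rw [div_le_iff₀ (by positivity)]; linarith
      linarith
    calc 1 / 2000 * gaussGap α * (2 * hexWeight p.1 p.2 *
          (4 / (3 * rStar ^ 2) * (A₁ p ^ 2 - A₁ p * A₂ p + A₂ p ^ 2) +
            4 / (3 * rStar ^ 2) * (B₁ p ^ 2 - B₁ p * B₂ p + B₂ p ^ 2)))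
        = 1 / 2000 * (2 * (4 / (3 * rStar ^ 2))) * (gaussGap α * hexWeight p.1 p.2 *
          ((A₁ p ^ 2 - A₁ p * A₂ p + A₂ p ^ 2) + (B₁ p ^ 2 - B₁ p * B₂ p + B₂ p ^ 2))) := by ring
      _ ≤ 2 / 1000 * (gaussGap α * hexWeight p.1 p.2 *
          ((A₁ p ^ 2 - A₁ p * A₂ p + A₂ p ^ 2) + (B₁ p ^ 2 - B₁ p * B₂ p + B₂ p ^ 2))) := by gcongr
      _ ≤ _ := by linarith

/-! ### Third order lower bound for the Gaussian energy change. -/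

/-- The derivative of the difference is `g`, which is increasing and vanishes at 0, so the
difference has its minimum 0 there. Only this one-sided bound is needed, since the energy is bounded
from below. -/
lemma cubic_le_exp (u : ℝ) : 1 + u + u ^ 2 / 2 + u ^ 3 / 6 ≤ Real.exp u := by
  set g : ℝ → ℝ := fun u => Real.exp u - (1 + u + u ^ 2 / 2) with hg
  set f : ℝ → ℝ := fun u => Real.exp u - (1 + u + u ^ 2 / 2 + u ^ 3 / 6) with hf
  have dg : ∀ x, HasDerivAt g (Real.exp x - (1 + x)) x := fun x => by
    have := (Real.hasDerivAt_exp x).sub (((hasDerivAt_id x).const_add 1).add (((hasDerivAt_id x).pow 2).div_const 2))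
    refine HasDerivAt.congr_deriv (f := g) this ?_
    simp
  have df : ∀ x, HasDerivAt f (g x) x := fun x => by
    have := (Real.hasDerivAt_exp x).sub ((((hasDerivAt_id x).const_add 1).add
      (((hasDerivAt_id x).pow 2).div_const 2)).add (((hasDerivAt_id x).pow 3).div_const 6))
    refine HasDerivAt.congr_deriv (f := f) this ?_
    simp [hg]; ring
  have mg : Monotone g := monotone_of_deriv_nonneg (fun x => (dg x).differentiableAt) fun x => by
    rw [(dg x).deriv]; linarith [Real.add_one_le_exp x]
  have g0 : g 0 = 0 := by simp [hg]
  have f0 : f 0 = 0 := by simp [hf]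
  have cf : Continuous f := continuous_iff_continuousAt.mpr fun x => (df x).continuousAt
  have key : 0 ≤ f u := by
    rcases le_total 0 u with h | h
    · have : MonotoneOn f (Ici 0) := monotoneOn_of_deriv_nonneg (convex_Ici 0) cf.continuousOn
        (fun x _ => (df x).differentiableAt.differentiableWithinAt) fun x hx => by
          rw [interior_Ici] at hx
          rw [(df x).deriv, ← g0]; exact mg (le_of_lt hx)
      rw [← f0]; exact this self_mem_Ici h h
    · have : AntitoneOn f (Iic 0) := antitoneOn_of_deriv_nonpos (convex_Iic 0) cf.continuousOn
        (fun x _ => (df x).differentiableAt.differentiableWithinAt) fun x hx => by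
          rw [interior_Iic] at hx
          rw [(df x).deriv, ← g0]; exact mg (le_of_lt hx)
      rw [← f0]; exact this h self_mem_Iic h
  simp only [hf] at key
  linarith

/-- Third order lower bound for the exponential of a perturbed square length. -/
lemma exp_neg_perturbed_ge {a Q p s δ : ℝ} (ha : 0 ≤ a) (hQ : 1 ≤ Q) (hs : 0 ≤ s) (hp : p ^ 2 ≤ Q * s)
    (hδ : 0 ≤ δ) (hδ1 : δ ≤ 1) (hsδ : s ≤ δ ^ 2) :
    Real.exp (-(a * Q)) * (-(2 * a) * p + 2 * a ^ 2 * p ^ 2 - a * s -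
      δ * s * (2 * a ^ 2 * Q + 9 / 2 * a ^ 3 * Q ^ 2)) ≤
    Real.exp (-(a * (Q + 2 * p + s))) - Real.exp (-(a * Q)) := by
  obtain ⟨w, hw, rfl⟩ : ∃ w : ℝ, 0 ≤ w ∧ Q = w ^ 2 := ⟨√Q, Real.sqrt_nonneg _, (Real.sq_sqrt (by linarith)).symm⟩
  obtain ⟨v, hv, rfl⟩ : ∃ v : ℝ, 0 ≤ v ∧ s = v ^ 2 := ⟨√s, Real.sqrt_nonneg _, (Real.sq_sqrt hs).symm⟩
  have hw1 : 1 ≤ w := by nlinarith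
  have hvδ : v ≤ δ := by nlinarith
  have hpv : |p| ≤ w * v := by
    rw [← mul_pow] at hp
    exact abs_le_of_sq_le_sq hp (by positivity)
  obtain ⟨hp1, hp2⟩ := abs_le.mp hpv
  set u := -(a * (2 * p + v ^ 2)) with hu
  have e : Real.exp (-(a * (w ^ 2 + 2 * p + v ^ 2))) = Real.exp (-(a * w ^ 2)) * Real.exp u := by
    rw [← Real.exp_add]; congr 1; rw [hu]; ring
  have hc := cubic_le_exp u
  have hvw : v ^ 2 ≤ w * v := by nlinarith
  have hu3 : |u| ≤ 3 * a * (w * v) := by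
    rw [hu, abs_neg, abs_mul, abs_of_nonneg ha]
    have : |2 * p + v ^ 2| ≤ 3 * (w * v) := by
      rw [abs_le]; constructor <;> nlinarith
    nlinarith
  -- Here 27 = 3³; divided by the 6 of the cubic Taylor term it gives the 9/2 in the statement.
  have hu3' : -(27 * a ^ 3 * (w * v) ^ 3) ≤ u ^ 3 := by
    have h1 : |u| ^ 3 ≤ (3 * a * (w * v)) ^ 3 := pow_le_pow_left₀ (abs_nonneg _) hu3 3
    have h2 := neg_abs_le (u ^ 3)
    rw [abs_pow] at h2
    nlinarith
  have hcube : (w * v) ^ 3 ≤ δ * v ^ 2 * (w ^ 2) ^ 2 := by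
    have : (w * v) ^ 3 = w ^ 3 * (v * v ^ 2) := by ring
    rw [this]
    have h1 : w ^ 3 ≤ (w ^ 2) ^ 2 := by
      rw [← pow_mul]; exact pow_le_pow_right₀ hw1 (by norm_num)
    calc w ^ 3 * (v * v ^ 2) ≤ (w ^ 2) ^ 2 * (δ * v ^ 2) := by gcongr
      _ = _ := by ring
  have hsq : 2 * a ^ 2 * p ^ 2 - 2 * a ^ 2 * (δ * v ^ 2 * w ^ 2) ≤ u ^ 2 / 2 := by
    have h1 : u ^ 2 / 2 = 2 * a ^ 2 * p ^ 2 + 2 * a ^ 2 * (p * v ^ 2) + a ^ 2 * v ^ 4 / 2 := by rw [hu]; ring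
    have h2 : -(δ * v ^ 2 * w ^ 2) ≤ p * v ^ 2 := by
      have : w * v ≤ δ * w ^ 2 := by
        calc w * v ≤ w * (δ * w) := by gcongr; nlinarith
          _ = _ := by ring
      nlinarith [sq_nonneg v]
    have h3 : 0 ≤ a ^ 2 * v ^ 4 / 2 := by positivity
    nlinarith [sq_nonneg a]
  have h4 : a ^ 3 * (w * v) ^ 3 ≤ a ^ 3 * (δ * v ^ 2 * (w ^ 2) ^ 2) := by gcongr
  rw [e, ← mul_sub_one]
  refine mul_le_mul_of_nonneg_left ?_ (Real.exp_pos _).le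
  have : u = -(2 * a) * p - a * v ^ 2 := by rw [hu]; ring
  linarith

/-- The change of the Gaussian interaction of a pair of lattice points at separation `h` when the
separation is changed by `y`. -/
def gaussInc (α : ℝ) (h : ℤ × ℤ) (y : ℝ × ℝ) : ℝ :=
  Real.exp (-(Real.pi * α * (rStar ^ 2 * hexForm h.1 h.2 + 2 * dualPair h y + dualSq y))) -
    Real.exp (-(Real.pi * α * (rStar ^ 2 * hexForm h.1 h.2)))

lemma gaussInc_zero (α : ℝ) (h : ℤ × ℤ) : gaussInc α h 0 = 0 := by
  simp [gaussInc, dualPair, dualSq]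

/-- The first order term of the energy vanishes, because translation by h does not change the sum of
a finitely supported function. -/
lemma tsum_dualPair_increment {q : ℤ × ℤ → ℝ × ℝ} {Λ : Finset (ℤ × ℤ)} (hq : ∀ x, x ∉ Λ → q x = 0) (h : ℤ × ℤ) :
    ∑' x, dualPair h (q (x + h) - q x) = 0 := by
  have s1 : Summable fun x => dualPair h (q x) :=
    summable_of_ne_finset_zero (s := Λ) fun x hx => by simp [hq x hx, dualPair]
  have s2 : Summable fun x => dualPair h (q (x + h)) := (Equiv.addRight h).summable_iff.mpr s1
  have t : ∑' x, dualPair h (q (x + h)) = ∑' x, dualPair h (q x) := (Equiv.addRight h).tsum_eq (fun x => dualPair h (q x))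
  have e : ∀ x, dualPair h (q (x + h) - q x) = dualPair h (q (x + h)) - dualPair h (q x) := fun x => by
    simp only [dualPair, Prod.fst_sub, Prod.snd_sub]; ring
  simp_rw [e]
  rw [s2.tsum_sub s1, t, sub_self]

lemma one_le_rStar_sq_mul_hexForm {h : ℤ × ℤ} (hh : h ≠ 0) : 1 ≤ rStar ^ 2 * hexForm h.1 h.2 := by
  nlinarith [one_le_rStar_sq, one_le_hexForm hh]

/-- Lower bound for the change of the Gaussian interactions in the direction `h`. -/
lemma exists_gaussHessian_sub_le_tsum_gaussInc :
    ∃ C : ℝ, 0 ≤ C ∧ ∀ (α δ : ℝ) (q : ℤ × ℤ → ℝ × ℝ) (Λ : Finset (ℤ × ℤ)) (h : ℤ × ℤ), 0 < α → 0 ≤ δ → δ ≤ 1 →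
      (∀ x, x ∉ Λ → q x = 0) → (∀ x y, dualSq (q x - q y) ≤ δ ^ 2) → h ≠ 0 →
      gaussHessian α q h - δ * C * edgeEnergy q * Real.exp (-(Real.pi * α / 2 * (rStar ^ 2 * hexForm h.1 h.2))) ≤
        ∑' x, gaussInc α h (q (x + h) - q x) := by
  obtain ⟨C, hC, hC'⟩ := one_add_pow_mul_exp_neg_le Real.pi_pos 3
  have hpi := Real.pi_pos
  -- The leading 2 comes from bounding `incSq q h` by 2 Q times the edge energy. The error times Q
  -- is a cubic polynomial in α Q, and `C` pays for it with half of the Gaussian decay, uniformly in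
  -- α.
  refine ⟨2 * ((2 * Real.pi ^ 2 + 9 / 2 * Real.pi ^ 3) * C), by positivity, ?_⟩
  intro α δ q Λ h hα hδ hδ1 hq hd hh
  set Q := rStar ^ 2 * hexForm h.1 h.2 with hQ
  have hQ1 : 1 ≤ Q := one_le_rStar_sq_mul_hexForm hh
  have hG := edgeEnergy_nonneg q
  set K := δ * (2 * (Real.pi * α) ^ 2 * Q + 9 / 2 * (Real.pi * α) ^ 3 * Q ^ 2) with hK
  have hK0 : 0 ≤ K := by positivity
  have s1 := summable_increment hq h (g := fun y => dualPair h y) (by simp [dualPair])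
  have s2 := summable_increment hq h (g := fun y => dualPair h y ^ 2) (by simp [dualPair])
  have s3 := summable_increment hq h (g := dualSq) (by simp [dualSq])
  have s4 := summable_increment hq h (g := gaussInc α h) (gaussInc_zero α h)
  have p1 : ∀ x, Real.exp (-(Real.pi * α * Q)) * (-(2 * (Real.pi * α)) * dualPair h (q (x + h) - q x) +
      2 * (Real.pi * α) ^ 2 * dualPair h (q (x + h) - q x) ^ 2 - (Real.pi * α + K) * dualSq (q (x + h) - q x)) ≤
      gaussInc α h (q (x + h) - q x) := fun x => by
    have := exp_neg_perturbed_ge (a := Real.pi * α) (by positivity) hQ1 (dualSq_nonneg (q (x + h) - q x))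
      (dualPair_sq_le h _) hδ hδ1 (hd _ _)
    refine le_trans (le_of_eq ?_) this
    rw [hK]; ring
  have sL := ((s1.mul_left (-(2 * (Real.pi * α)))).add (s2.mul_left (2 * (Real.pi * α) ^ 2))).sub
    (s3.mul_left (Real.pi * α + K))
  have t := (sL.mul_left (Real.exp (-(Real.pi * α * Q)))).tsum_le_tsum p1 s4
  rw [tsum_mul_left, ((s1.mul_left (-(2 * (Real.pi * α)))).add (s2.mul_left (2 * (Real.pi * α) ^ 2))).tsum_sub
    (s3.mul_left (Real.pi * α + K)), (s1.mul_left (-(2 * (Real.pi * α)))).tsum_add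
    (s2.mul_left (2 * (Real.pi * α) ^ 2)), tsum_mul_left, tsum_mul_left, tsum_mul_left,
    tsum_dualPair_increment hq, mul_zero, zero_add] at t
  refine le_trans ?_ t
  change _ ≤ Real.exp (-(Real.pi * α * Q)) * (2 * (Real.pi * α) ^ 2 * incPairSq q h - (Real.pi * α + K) * incSq q h)
  have e1 : gaussHessian α q h = Real.exp (-(Real.pi * α * Q)) *
      (2 * (Real.pi * α) ^ 2 * incPairSq q h - Real.pi * α * incSq q h) := by
    unfold gaussHessian
    rw [hQ, show -(Real.pi * (α * rStar ^ 2)) * hexForm h.1 h.2 = -(Real.pi * α * (rStar ^ 2 * hexForm h.1 h.2)) by ring]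
    ring
  rw [e1]
  have l1 : incSq q h ≤ 2 * Q * edgeEnergy q := by
    refine (incSq_le hq h).trans (mul_le_mul_of_nonneg_right ?_ hG)
    have := half_le_hexForm h.1 h.2
    have := hexForm_nonneg h.1 h.2
    nlinarith [one_le_rStar_sq]
  have l2 : Real.exp (-(Real.pi * α * Q)) * (K * incSq q h) ≤ δ * (2 * ((2 * Real.pi ^ 2 + 9 / 2 * Real.pi ^ 3) * C)) *
      edgeEnergy q * Real.exp (-(Real.pi * α / 2 * Q)) := by
    set Z := α * Q with hZ
    have hZ0 : 0 ≤ Z := by positivity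
    have h1 := hC' Z hZ0
    rw [show -(Real.pi / 2) * Z = -(Real.pi * α / 2 * Q) by rw [hZ]; ring,
      show -Real.pi * Z = -(Real.pi * α * Q) by rw [hZ]; ring] at h1
    have h2 : K * Q ≤ δ * ((2 * Real.pi ^ 2 + 9 / 2 * Real.pi ^ 3) * (1 + Z) ^ 3) := by
      have : K * Q = δ * (2 * Real.pi ^ 2 * Z ^ 2 + 9 / 2 * Real.pi ^ 3 * Z ^ 3) := by rw [hK, hZ]; ring
      rw [this]
      refine mul_le_mul_of_nonneg_left ?_ hδ
      have z2 : Z ^ 2 ≤ (1 + Z) ^ 3 := by nlinarith [pow_nonneg hZ0 3, pow_nonneg hZ0 2]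
      have z3 : Z ^ 3 ≤ (1 + Z) ^ 3 := by gcongr; linarith
      rw [add_mul]
      gcongr
    calc Real.exp (-(Real.pi * α * Q)) * (K * incSq q h) ≤
        Real.exp (-(Real.pi * α * Q)) * (K * (2 * Q * edgeEnergy q)) := by gcongr
      _ = 2 * edgeEnergy q * (Real.exp (-(Real.pi * α * Q)) * (K * Q)) := by ring
      _ ≤ 2 * edgeEnergy q * (Real.exp (-(Real.pi * α * Q)) *
          (δ * ((2 * Real.pi ^ 2 + 9 / 2 * Real.pi ^ 3) * (1 + Z) ^ 3))) := by gcongr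
      _ = 2 * edgeEnergy q * δ * (2 * Real.pi ^ 2 + 9 / 2 * Real.pi ^ 3) *
          ((1 + Z) ^ 3 * Real.exp (-(Real.pi * α * Q))) := by ring
      _ ≤ 2 * edgeEnergy q * δ * (2 * Real.pi ^ 2 + 9 / 2 * Real.pi ^ 3) *
          (C * Real.exp (-(Real.pi * α / 2 * Q))) := by gcongr
      _ = _ := by ring
  linarith

/-- From s ≤ 1/16 and Q ≥ 1 it follows that |p| ≤ Q/4. Perturbed Gaussians are thus dominated by
unperturbed ones with exponent halved, which is the origin of the α/2 in `gaussLoss`. -/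
lemma half_le_perturbed {Q p s : ℝ} (hQ : 1 ≤ Q) (hs : 0 ≤ s) (hp : p ^ 2 ≤ Q * s) (hs' : s ≤ (1 / 4) ^ 2) :
    Q / 2 ≤ Q + 2 * p + s := by
  have h1 : p ^ 2 ≤ (Q / 4) ^ 2 := hp.trans (by nlinarith)
  have := (abs_le.mp (abs_le_of_sq_le_sq h1 (by linarith))).1
  linarith

lemma abs_gaussInc_le {α : ℝ} (hα : 0 ≤ α) {h : ℤ × ℤ} (hh : h ≠ 0) {y : ℝ × ℝ} (hy : dualSq y ≤ (1 / 4) ^ 2) :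
    |gaussInc α h y| ≤ Real.exp (-(Real.pi * α / 2 * (rStar ^ 2 * hexForm h.1 h.2))) := by
  have hQ1 := one_le_rStar_sq_mul_hexForm hh
  have h1 := half_le_perturbed hQ1 (dualSq_nonneg y) (dualPair_sq_le h y) hy
  have hpa : 0 ≤ Real.pi * α := by positivity
  unfold gaussInc
  refine abs_sub_le_of_nonneg_of_le (Real.exp_pos _).le ?_ (Real.exp_pos _).le ?_
  · apply Real.exp_le_exp.mpr; nlinarith
  · apply Real.exp_le_exp.mpr; nlinarith

/-- The change of the Gaussian interactions in the direction `h` under a displacement `q`. -/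
def gaussTotal (α : ℝ) (q : ℤ × ℤ → ℝ × ℝ) (h : ℤ × ℤ) : ℝ :=
  if h = 0 then 0 else ∑' x, gaussInc α h (q (x + h) - q x)

lemma tsum_increment_eq_sum {q : ℤ × ℤ → ℝ × ℝ} {Λ : Finset (ℤ × ℤ)} (hq : ∀ x, x ∉ Λ → q x = 0)
    (h : ℤ × ℤ) {g : ℝ × ℝ → ℝ} (hg : g 0 = 0) :
    ∑' x, g (q (x + h) - q x) = ∑ x ∈ Λ ∪ Λ.image (· - h), g (q (x + h) - q x) := by
  refine tsum_eq_sum fun x hx => ?_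
  rw [Finset.mem_union, not_or] at hx
  have h1 : x + h ∉ Λ := fun h' => hx.2 (Finset.mem_image.mpr ⟨_, h', by simp⟩)
  rw [hq x hx.1, hq _ h1, sub_zero, hg]

lemma card_union_image_sub_le (Λ : Finset (ℤ × ℤ)) (h : ℤ × ℤ) : (Λ ∪ Λ.image (· - h)).card ≤ 2 * Λ.card := by
  have := Finset.card_union_le Λ (Λ.image (· - h))
  have := Finset.card_image_le (s := Λ) (f := (· - h))
  omega

/-- A crude bound depending on the size of the support; it serves only to justify exchanging sums
and integrals. -/
lemma abs_gaussTotal_le {α : ℝ} (hα : 0 ≤ α) {q : ℤ × ℤ → ℝ × ℝ} {Λ : Finset (ℤ × ℤ)} (hq : ∀ x, x ∉ Λ → q x = 0)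
    (hd : ∀ x y, dualSq (q x - q y) ≤ (1 / 4) ^ 2) (h : ℤ × ℤ) :
    |gaussTotal α q h| ≤ 2 * Λ.card *
      (if h = 0 then 0 else Real.exp (-(Real.pi * α / 2 * (rStar ^ 2 * hexForm h.1 h.2)))) := by
  unfold gaussTotal
  split_ifs with hh
  · simp
  rw [tsum_increment_eq_sum hq h (gaussInc_zero α h)]
  refine (Finset.abs_sum_le_sum_abs _ _).trans ?_
  refine (Finset.sum_le_card_nsmul _ _ _ fun x _ => abs_gaussInc_le hα hh (hd _ _)).trans ?_
  rw [nsmul_eq_mul]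
  refine mul_le_mul_of_nonneg_right ?_ (Real.exp_pos _).le
  exact_mod_cast card_union_image_sub_le Λ h

lemma summable_exp_half {α : ℝ} (hα : 0 < α) : Summable fun h : ℤ × ℤ =>
    (if h = 0 then 0 else Real.exp (-(Real.pi * α / 2 * (rStar ^ 2 * hexForm h.1 h.2)))) := by
  have hr := rStar_pos
  refine Summable.of_nonneg_of_le (fun h => by split_ifs <;> positivity) (fun h => ?_)
    (summable_exp_neg_hexForm (c := Real.pi * α / 2 * rStar ^ 2) (by positivity))
  split_ifs
  · positivity
  · rw [← mul_assoc, neg_mul]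

/-- The Gaussian energy change is bounded below in terms of the edge energy. -/
lemma exists_le_tsum_gaussTotal : ∃ C : ℝ, 0 ≤ C ∧ ∀ (α δ : ℝ) (q : ℤ × ℤ → ℝ × ℝ) (Λ : Finset (ℤ × ℤ)),
    0 < α → 0 ≤ δ → δ ≤ 1 / 4 → (∀ x, x ∉ Λ → q x = 0) → (∀ x y, dualSq (q x - q y) ≤ δ ^ 2) →
    (1 / 2000 * gaussGap α - δ * C * gaussLoss α) * edgeEnergy q ≤ ∑' h, gaussTotal α q h := by
  obtain ⟨C₁, hC₁, h₁⟩ := exists_gaussHessian_sub_le_tsum_gaussInc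
  obtain ⟨C₂, hC₂, h₂⟩ := exists_tsum_exp_le_gaussLoss
  refine ⟨C₁ * C₂, by positivity, fun α δ q Λ hα hδ hδ1 hq hd => ?_⟩
  have hG := edgeEnergy_nonneg q
  obtain ⟨sH, hH⟩ := hasSum_gaussHessian hα hq
  have sE := summable_exp_half hα
  have hd' : ∀ x y, dualSq (q x - q y) ≤ (1 / 4) ^ 2 := fun x y => (hd x y).trans (by gcongr)
  have sT : Summable (gaussTotal α q) :=
    Summable.of_norm_bounded (sE.mul_left (2 * (Λ.card : ℝ))) fun h => abs_gaussTotal_le hα.le hq hd' h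
  have key : ∀ h, gaussHessian α q h - δ * C₁ * edgeEnergy q *
      (if h = 0 then 0 else Real.exp (-(Real.pi * α / 2 * (rStar ^ 2 * hexForm h.1 h.2)))) ≤ gaussTotal α q h := by
    intro h
    unfold gaussTotal
    split_ifs with hh
    · subst hh
      simp [gaussHessian, incPairSq, incSq, dualPair, dualSq]
    · exact h₁ α δ q Λ h hα hδ (by linarith) hq hd hh
  have := (sH.sub (sE.mul_left (δ * C₁ * edgeEnergy q))).tsum_le_tsum key sT
  rw [sH.tsum_sub (sE.mul_left _), tsum_mul_left] at this
  have h3 := h₂ α hα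
  have h4 : δ * C₁ * edgeEnergy q * ∑' h : ℤ × ℤ,
      (if h = 0 then 0 else Real.exp (-(Real.pi * α / 2 * (rStar ^ 2 * hexForm h.1 h.2)))) ≤
      δ * C₁ * edgeEnergy q * (C₂ * gaussLoss α) := mul_le_mul_of_nonneg_left h3 (by positivity)
  linarith

/-! ### Integration against a mixture measure -/

/-- An atom of W at 0 would make the integral of α⁻¹ infinite. Almost every α is therefore positive
and the Gaussian estimates apply. -/
lemma ae_ne_zero_of_ratioNum {W : Measure ℝ≥0} (hL : ratioNum W 1 1 ≠ ⊤) :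
    ∀ᵐ α ∂W, α ≠ 0 := by
  have h1 : ∫⁻ α in Iic (1 : ℝ≥0), (α : ℝ≥0∞)⁻¹ ∂W ≠ ⊤ := fun h => hL (by simp [ratioNum, h])
  have h2 : Measurable fun α : ℝ≥0 => (α : ℝ≥0∞)⁻¹ := measurable_coe_nnreal_ennreal.inv
  have h3 := ae_lt_top h2 h1
  rw [ae_restrict_iff' measurableSet_Iic] at h3
  filter_upwards [h3] with α hα h0
  simp [h0] at hα

lemma measurable_gaussLoss : Measurable fun α : ℝ≥0 => gaussLoss α := by
  unfold gaussLoss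
  refine Measurable.ite (measurableSet_le (by fun_prop) measurable_const) (by fun_prop) (by fun_prop)

lemma measurable_gaussGap : Measurable fun α : ℝ≥0 => gaussGap α := by
  unfold gaussGap; fun_prop

lemma lintegral_gaussLoss_le (W : Measure ℝ≥0) :
    ∫⁻ α, ENNReal.ofReal (gaussLoss α) ∂W ≤ ratioNum W 1 1 := by
  have e : ∫⁻ α, ENNReal.ofReal (gaussLoss α) ∂W = ∫⁻ α in Ioi (1 : ℝ≥0), ENNReal.ofReal (gaussLoss α) ∂W +
      ∫⁻ α in Iic (1 : ℝ≥0), ENNReal.ofReal (gaussLoss α) ∂W := by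
    rw [← compl_Ioi]
    exact (lintegral_add_compl _ measurableSet_Ioi).symm
  rw [e, ratioNum]
  refine add_le_add ?_ ?_
  · refine le_trans (le_of_eq (setLIntegral_congr_fun measurableSet_Ioi fun α hα => ?_))
      (lintegral_mono_set Ioi_subset_Ici_self)
    have : ¬ ((α : ℝ) ≤ 1) := by exact_mod_cast not_le.mpr hα
    simp only [gaussLoss, if_neg this]
  · refine setLIntegral_mono' measurableSet_Iic fun α hα => ?_
    have : ((α : ℝ) ≤ 1) := by exact_mod_cast hα
    simp only [gaussLoss, if_pos this]
    -- At α = 0 the real inverse in `gaussLoss` is 0 while the extended one is ∞, which only helps.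
    rcases eq_or_ne α 0 with rfl | h
    · simp
    · rw [← NNReal.coe_inv, ENNReal.ofReal_coe_nnreal, ENNReal.coe_inv h]

/-- On each of the two ranges the integrand of `ratioDen` is `gaussGap`. Each integral is bounded by
the full one, hence the factor 2. -/
lemma ratioDen_le (W : Measure ℝ≥0) : ratioDen W ≤ 2 * ∫⁻ α, ENNReal.ofReal (gaussGap α) ∂W := by
  rw [ratioDen, two_mul]
  refine add_le_add ?_ ?_
  · refine le_trans (le_of_eq (setLIntegral_congr_fun measurableSet_Ici fun α hα => ?_))
      (setLIntegral_le_lintegral (Ici 1) _)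
    have h1 : (1 : ℝ) ≤ α := by exact_mod_cast hα
    have : max (α : ℝ) (α : ℝ)⁻¹ = α := max_eq_left ((inv_le_one_of_one_le₀ h1).trans h1)
    simp only [gaussGap, this]
    congr 3; ring
  · refine le_trans (le_of_eq (setLIntegral_congr_fun measurableSet_Ioc fun α hα => ?_))
      (setLIntegral_le_lintegral (Ioc 0 1) _)
    have h0 : (0 : ℝ) < α := by exact_mod_cast hα.1
    have h1 : (α : ℝ) ≤ 1 := by exact_mod_cast hα.2
    have : max (α : ℝ) (α : ℝ)⁻¹ = (α : ℝ)⁻¹ := max_eq_right (h1.trans ((one_le_inv₀ h0).mpr h1))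
    simp only [gaussGap, this]
    congr 3; field_simp

lemma integrable_gaussGap {W : Measure ℝ≥0} {f : ℝ → ℝ} (hW : IsMixtureMeasure W f) :
    Integrable (fun α : ℝ≥0 => gaussGap α) W := by
  refine (hW rStar rStar_pos).1.mono' measurable_gaussGap.aestronglyMeasurable (ae_of_all _ fun α => ?_)
  rw [Real.norm_of_nonneg (gaussGap_pos _).le, gaussGap]
  apply Real.exp_le_exp.mpr
  have := le_max_left (α : ℝ) (α : ℝ)⁻¹
  have h2 := Real.pi_pos
  have h3 := rStar_pos
  have : Real.pi * rStar ^ 2 * α ≤ Real.pi * rStar ^ 2 * max (α : ℝ) (α : ℝ)⁻¹ := by gcongr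
  linarith

lemma integrable_gaussLoss {W : Measure ℝ≥0} (hL : ratioNum W 1 1 ≠ ⊤) :
    Integrable (fun α : ℝ≥0 => gaussLoss α) W := by
  refine ⟨measurable_gaussLoss.aestronglyMeasurable, ?_⟩
  rw [hasFiniteIntegral_iff_ofReal (ae_of_all _ fun α => gaussLoss_nonneg α.2)]
  exact (lintegral_gaussLoss_le W).trans_lt hL.lt_top

lemma IsMixtureMeasure.integrable_exp {W : Measure ℝ≥0} {f : ℝ → ℝ} (hW : IsMixtureMeasure W f) {Q : ℝ} (hQ : 0 < Q) :
    Integrable (fun α : ℝ≥0 => Real.exp (-(Real.pi * α * Q))) W := by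
  have := (hW (√Q) (Real.sqrt_pos.mpr hQ)).1
  rwa [Real.sq_sqrt hQ.le] at this

lemma IsMixtureMeasure.integral_exp {W : Measure ℝ≥0} {f : ℝ → ℝ} (hW : IsMixtureMeasure W f) {Q : ℝ} (hQ : 0 < Q) :
    ∫ α : ℝ≥0, Real.exp (-(Real.pi * α * Q)) ∂W = f (√Q) := by
  have := (hW (√Q) (Real.sqrt_pos.mpr hQ)).2
  rwa [Real.sq_sqrt hQ.le] at this

lemma IsMixtureMeasure.nonneg {W : Measure ℝ≥0} {f : ℝ → ℝ} (hW : IsMixtureMeasure W f) {r : ℝ} (hr : 0 < r) :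
    0 ≤ f r := by
  rw [← (hW r hr).2]; exact integral_nonneg fun _ => (Real.exp_pos _).le

/-- The interaction is summable over the lattice, with room to spare, if the numerator is finite. -/
lemma summable_interaction {W : Measure ℝ≥0} {f : ℝ → ℝ} (hW : IsMixtureMeasure W f) (hL : ratioNum W 1 1 ≠ ⊤) :
    Summable fun h : ℤ × ℤ => if h = 0 then 0 else f (√(rStar ^ 2 * hexForm h.1 h.2 / 2)) := by
  obtain ⟨C₂, hC₂, h₂⟩ := exists_tsum_exp_le_gaussLoss
  have h0 := ae_ne_zero_of_ratioNum hL
  set F : ℤ × ℤ → ℝ≥0 → ℝ := fun h α =>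
    if h = 0 then 0 else Real.exp (-(Real.pi * α / 2 * (rStar ^ 2 * hexForm h.1 h.2))) with hF
  have hF0 : ∀ h α, 0 ≤ F h α := fun h α => by simp only [hF]; split_ifs <;> positivity
  have hFi : ∀ h, Integrable (F h) W := fun h => by
    by_cases hh : h = 0
    · simp [hF, hh]
    · have := hW.integrable_exp (Q := rStar ^ 2 * hexForm h.1 h.2 / 2) (by linarith [one_le_rStar_sq_mul_hexForm hh])
      refine this.congr (ae_of_all _ fun α => ?_)
      simp only [hF, if_neg hh]; congr 1; ring
  have hFf : ∀ h : ℤ × ℤ, (if h = 0 then 0 else f (√(rStar ^ 2 * hexForm h.1 h.2 / 2))) = ∫ α, F h α ∂W := fun h => by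
    split_ifs with hh
    · simp [hF, hh]
    · rw [← hW.integral_exp (Q := rStar ^ 2 * hexForm h.1 h.2 / 2) (by linarith [one_le_rStar_sq_mul_hexForm hh])]
      refine integral_congr_ae (ae_of_all _ fun α => ?_)
      simp only [hF, if_neg hh]; congr 1; ring
  simp_rw [hFf]
  have hfin : ∑' h, ∫⁻ α, ENNReal.ofReal (F h α) ∂W ≠ ⊤ := by
    rw [← lintegral_tsum fun h => ((hFi h).1.aemeasurable).ennreal_ofReal]
    have : ∫⁻ α, ∑' h, ENNReal.ofReal (F h α) ∂W ≤ ∫⁻ α, ENNReal.ofReal (C₂ * gaussLoss α) ∂W := by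
      refine lintegral_mono_ae ?_
      filter_upwards [h0] with α hα
      have hα' : 0 < (α : ℝ) := by positivity
      rw [← ENNReal.ofReal_tsum_of_nonneg (fun h => hF0 h α) (summable_exp_half hα')]
      exact ENNReal.ofReal_le_ofReal (h₂ α hα')
    refine (this.trans_lt ?_).ne
    have := ((integrable_gaussLoss hL).const_mul C₂).lintegral_lt_top
    exact this
  have h5 := ENNReal.summable_toReal hfin
  refine h5.congr fun h => ?_
  rw [integral_eq_lintegral_of_nonneg_ae (ae_of_all _ (hF0 h)) (hFi h).1]

/-- The energy of a finitely supported perturbation of the hexagonal lattice is at least that of the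
lattice, as soon as the perturbation is small compared with the ratio of the integrals of
`gaussGap` and `gaussLoss`. -/
lemma exists_tsum_interaction_nonneg : ∃ c : ℝ, 0 < c ∧ ∀ (W : Measure ℝ≥0) (f : ℝ → ℝ) (K δ : ℝ)
    (q : ℤ × ℤ → ℝ × ℝ) (Λ : Finset (ℤ × ℤ)), IsMixtureMeasure W f → ratioNum W 1 1 ≠ ⊤ → 0 ≤ K →
    ratioNum W 1 1 ≤ ENNReal.ofReal K * ratioDen W → 0 ≤ δ → δ ≤ 1 / 4 → δ * K ≤ c →
    (∀ x, x ∉ Λ → q x = 0) → (∀ x y, dualSq (q x - q y) ≤ δ ^ 2) →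
    (Summable fun h : ℤ × ℤ => if h = 0 then 0 else
      ∑' x, (f (√(rStar ^ 2 * hexForm h.1 h.2 + 2 * dualPair h (q (x + h) - q x) + dualSq (q (x + h) - q x))) -
        f (√(rStar ^ 2 * hexForm h.1 h.2)))) ∧
    0 ≤ ∑' h : ℤ × ℤ, if h = 0 then 0 else
      ∑' x, (f (√(rStar ^ 2 * hexForm h.1 h.2 + 2 * dualPair h (q (x + h) - q x) + dualSq (q (x + h) - q x))) -
        f (√(rStar ^ 2 * hexForm h.1 h.2))) := by
  obtain ⟨C, hC, hC'⟩ := exists_le_tsum_gaussTotal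
  -- With ∫ loss ≤ 2K ∫ gap, the integrated bound is nonnegative once 2 δ C K ≤ 1/2000.
  refine ⟨1 / (4000 * (C + 1)), by positivity, ?_⟩
  intro W f K δ q Λ hW hL hK hLK hδ hδ1 hδK hq hd
  have hd' : ∀ x y, dualSq (q x - q y) ≤ (1 / 4) ^ 2 := fun x y => (hd x y).trans (by gcongr)
  have hG := edgeEnergy_nonneg q
  have h0 := ae_ne_zero_of_ratioNum hL
  have hInc : ∀ h : ℤ × ℤ, h ≠ 0 → ∀ y, dualSq y ≤ (1 / 4) ^ 2 →
      Integrable (fun α : ℝ≥0 => gaussInc α h y) W ∧ ∫ α : ℝ≥0, gaussInc α h y ∂W =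
        f (√(rStar ^ 2 * hexForm h.1 h.2 + 2 * dualPair h y + dualSq y)) - f (√(rStar ^ 2 * hexForm h.1 h.2)) := by
    intro h hh y hy
    have hQ1 := one_le_rStar_sq_mul_hexForm hh
    have hQ2 := half_le_perturbed hQ1 (dualSq_nonneg y) (dualPair_sq_le h y) hy
    have i1 := hW.integrable_exp (Q := rStar ^ 2 * hexForm h.1 h.2) (by linarith)
    have i2 := hW.integrable_exp (Q := rStar ^ 2 * hexForm h.1 h.2 + 2 * dualPair h y + dualSq y) (by linarith)
    refine ⟨i2.sub i1, ?_⟩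
    unfold gaussInc
    rw [integral_sub i2 i1, hW.integral_exp (by linarith), hW.integral_exp (by linarith)]
  have hTot : ∀ h : ℤ × ℤ, Integrable (fun α : ℝ≥0 => gaussTotal α q h) W ∧ ∫ α : ℝ≥0, gaussTotal α q h ∂W =
      if h = 0 then 0 else
      ∑' x, (f (√(rStar ^ 2 * hexForm h.1 h.2 + 2 * dualPair h (q (x + h) - q x) + dualSq (q (x + h) - q x))) -
        f (√(rStar ^ 2 * hexForm h.1 h.2))) := by
    intro h
    unfold gaussTotal
    split_ifs with hh
    · simp
    have e : ∀ α : ℝ≥0, ∑' x, gaussInc α h (q (x + h) - q x) =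
        ∑ x ∈ Λ ∪ Λ.image (· - h), gaussInc α h (q (x + h) - q x) := fun α =>
      tsum_increment_eq_sum hq h (gaussInc_zero α h)
    simp_rw [e]
    refine ⟨integrable_finsetSum _ fun x _ => (hInc h hh _ (hd' _ _)).1, ?_⟩
    rw [integral_finsetSum _ fun x _ => (hInc h hh _ (hd' _ _)).1, tsum_increment_eq_sum hq h
      (g := fun y => f (√(rStar ^ 2 * hexForm h.1 h.2 + 2 * dualPair h y + dualSq y)) - f (√(rStar ^ 2 * hexForm h.1 h.2)))
      (by simp [dualPair, dualSq])]
    exact Finset.sum_congr rfl fun x _ => (hInc h hh _ (hd' _ _)).2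
  -- Domination by the interaction at distances shrunk by √2, summable because `ratioNum W 1 1` is
  -- finite.
  have hsum : Summable fun h => ∫ α : ℝ≥0, ‖gaussTotal α q h‖ ∂W := by
    refine Summable.of_nonneg_of_le (fun h => integral_nonneg fun α => norm_nonneg _) (fun h => ?_)
      ((summable_interaction hW hL).mul_left (2 * (Λ.card : ℝ)))
    split_ifs with hh
    · simp [gaussTotal, hh]
    · have i := hW.integrable_exp (Q := rStar ^ 2 * hexForm h.1 h.2 / 2) (by linarith [one_le_rStar_sq_mul_hexForm hh])
      rw [← hW.integral_exp (by linarith [one_le_rStar_sq_mul_hexForm hh]), ← integral_const_mul]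
      refine integral_mono (hTot h).1.norm (i.const_mul _) fun α => ?_
      refine (abs_gaussTotal_le α.2 hq hd' h).trans (le_of_eq ?_)
      rw [if_neg hh, NNReal.val_eq_coe]
      congr 2; ring
  have hS := hasSum_integral_of_summable_integral_norm (fun h => (hTot h).1) hsum
  simp_rw [fun h => (hTot h).2] at hS
  refine ⟨hS.summable, ?_⟩
  rw [hS.tsum_eq]
  have iT := integrable_tsum_of_summable_integral_norm (fun h => (hTot h).1) hsum
  have iGap := integrable_gaussGap hW
  have iLoss := integrable_gaussLoss hL
  have step : ∫ α : ℝ≥0, (1 / 2000 * gaussGap α - δ * C * gaussLoss α) * edgeEnergy q ∂W ≤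
      ∫ α : ℝ≥0, ∑' h, gaussTotal α q h ∂W := by
    refine integral_mono_ae (((iGap.const_mul _).sub (iLoss.const_mul _)).mul_const _) iT ?_
    filter_upwards [h0] with α hα
    exact hC' α δ q Λ (by positivity) hδ hδ1 hq hd
  refine le_trans ?_ step
  rw [integral_mul_const, integral_sub (iGap.const_mul _) (iLoss.const_mul _), integral_const_mul, integral_const_mul]
  refine mul_nonneg ?_ hG
  have hI : ∫ α : ℝ≥0, gaussLoss α ∂W ≤ K * (2 * ∫ α : ℝ≥0, gaussGap α ∂W) := by
    have nG : 0 ≤ ∫ α : ℝ≥0, gaussGap α ∂W := integral_nonneg fun α => (gaussGap_pos _).le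
    rw [← ENNReal.ofReal_le_ofReal_iff (by positivity), ENNReal.ofReal_mul hK, ENNReal.ofReal_mul zero_le_two,
      ofReal_integral_eq_lintegral_ofReal iLoss (ae_of_all _ fun α => gaussLoss_nonneg α.2),
      ofReal_integral_eq_lintegral_ofReal iGap (ae_of_all _ fun α => (gaussGap_pos _).le), ENNReal.ofReal_ofNat]
    refine (lintegral_gaussLoss_le W).trans (hLK.trans ?_)
    gcongr
    exact ratioDen_le W
  have nG : 0 ≤ ∫ α : ℝ≥0, gaussGap α ∂W := integral_nonneg fun α => (gaussGap_pos _).le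
  have h6 : δ * C * ∫ α : ℝ≥0, gaussLoss α ∂W ≤ δ * C * (K * (2 * ∫ α : ℝ≥0, gaussGap α ∂W)) :=
    mul_le_mul_of_nonneg_left hI (by positivity)
  have h7 : δ * K * C ≤ 1 / 4000 := by
    calc δ * K * C ≤ 1 / (4000 * (C + 1)) * C := by gcongr
      _ ≤ 1 / 4000 := by rw [div_mul_eq_mul_div, div_le_div_iff₀ (by positivity) (by norm_num)]; linarith
  nlinarith

/-! ### The hexagonal lattice in the plane, in coordinates. -/

/-- The point of the hexagonal lattice with given integral coordinates. -/
def hexPoint (h : ℤ × ℤ) : Plane := h.1 • hexSigma + h.2 • hexTau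

/-- The inner products of a vector with the basis of the hexagonal lattice. -/
def dualCoord (v : Plane) : ℝ × ℝ := (inner ℝ hexSigma v, inner ℝ hexTau v)

lemma dualCoord_eq (v : Plane) : dualCoord v = (rStar * v 0, rStar * (v 0 / 2 + √3 / 2 * v 1)) := by
  simp only [dualCoord, hexSigma, hexTau, inner_smul_left, PiLp.inner_apply, Fin.sum_univ_two]
  simp
  ring_nf
  simp

lemma dualCoord_sub (v w : Plane) : dualCoord (v - w) = dualCoord v - dualCoord w := by
  simp [dualCoord, inner_sub_right]

lemma dualCoord_zero : dualCoord 0 = 0 := by simp [dualCoord]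

lemma norm_sq_plane (v : Plane) : ‖v‖ ^ 2 = v 0 ^ 2 + v 1 ^ 2 := by
  rw [EuclideanSpace.norm_sq_eq, Fin.sum_univ_two]; simp

lemma dualSq_dualCoord (v : Plane) : dualSq (dualCoord v) = ‖v‖ ^ 2 := by
  have h3 : (√3 : ℝ) ^ 2 = 3 := Real.sq_sqrt (by norm_num)
  have hr := rStar_pos
  rw [dualCoord_eq, norm_sq_plane, dualSq]
  field_simp
  linear_combination 4 * (v 1) ^ 2 * h3

lemma hexPoint_apply_zero (h : ℤ × ℤ) : hexPoint h 0 = rStar * (h.1 + h.2 / 2) := by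
  simp [hexPoint, hexSigma, hexTau]; ring

lemma hexPoint_apply_one (h : ℤ × ℤ) : hexPoint h 1 = rStar * (√3 / 2 * h.2) := by
  simp [hexPoint, hexSigma, hexTau]; ring

lemma norm_sq_hexPoint (h : ℤ × ℤ) : ‖hexPoint h‖ ^ 2 = rStar ^ 2 * hexForm h.1 h.2 := by
  have h3 : (√3 : ℝ) ^ 2 = 3 := Real.sq_sqrt (by norm_num)
  rw [norm_sq_plane, hexPoint_apply_zero, hexPoint_apply_one, hexForm]
  linear_combination rStar ^ 2 * (h.2 : ℝ) ^ 2 / 4 * h3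

lemma norm_hexPoint (h : ℤ × ℤ) : ‖hexPoint h‖ = √(rStar ^ 2 * hexForm h.1 h.2) := by
  rw [← norm_sq_hexPoint, Real.sqrt_sq (norm_nonneg _)]

lemma norm_sq_hexPoint_add (h : ℤ × ℤ) (v : Plane) : ‖hexPoint h + v‖ ^ 2 =
    rStar ^ 2 * hexForm h.1 h.2 + 2 * dualPair h (dualCoord v) + dualSq (dualCoord v) := by
  have h3 : (√3 : ℝ) ^ 2 = 3 := Real.sq_sqrt (by norm_num)
  rw [dualSq_dualCoord, ← norm_sq_hexPoint, norm_sq_plane, norm_sq_plane, norm_sq_plane, dualCoord_eq, dualPair]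
  simp only [PiLp.add_apply, hexPoint_apply_zero, hexPoint_apply_one]
  ring

lemma norm_hexPoint_add (h : ℤ × ℤ) (v : Plane) : ‖hexPoint h + v‖ =
    √(rStar ^ 2 * hexForm h.1 h.2 + 2 * dualPair h (dualCoord v) + dualSq (dualCoord v)) := by
  rw [← norm_sq_hexPoint_add, Real.sqrt_sq (norm_nonneg _)]

lemma hexPoint_add (h k : ℤ × ℤ) : hexPoint (h + k) = hexPoint h + hexPoint k := by
  simp only [hexPoint, Prod.fst_add, Prod.snd_add, add_smul]; abel

lemma one_le_norm_hexPoint {h : ℤ × ℤ} (hh : h ≠ 0) : 1 ≤ ‖hexPoint h‖ := by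
  rw [norm_hexPoint]
  exact Real.one_le_sqrt.mpr (one_le_rStar_sq_mul_hexForm hh)

lemma hexPoint_zero : hexPoint 0 = 0 := by simp [hexPoint]

lemma hexPoint_mem (h : ℤ × ℤ) : hexPoint h ∈ hexLattice := ⟨h.1, h.2, rfl⟩

lemma hexLattice_eq_range : hexLattice = Set.range hexPoint := by
  ext x
  constructor
  · rintro ⟨m, n, rfl⟩; exact ⟨(m, n), rfl⟩
  · rintro ⟨h, rfl⟩; exact hexPoint_mem h

lemma perturbedLattice_eq_range (p : hexLattice → Plane) :
    perturbedLattice p = Set.range fun h : ℤ × ℤ => hexPoint h + p ⟨hexPoint h, hexPoint_mem h⟩ := by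
  ext x
  constructor
  · rintro ⟨⟨y, hy⟩, rfl⟩
    rw [hexLattice_eq_range] at hy
    obtain ⟨h, rfl⟩ := hy
    exact ⟨h, rfl⟩
  · rintro ⟨h, rfl⟩; exact ⟨⟨hexPoint h, hexPoint_mem h⟩, rfl⟩

/-! ### Counting lattice points -/

lemma finite_setOf_hexForm_le (c : ℝ) : {h : ℤ × ℤ | rStar ^ 2 * hexForm h.1 h.2 ≤ c}.Finite := by
  have hr := one_le_rStar_sq
  obtain ⟨N, hN⟩ := exists_nat_ge (2 * c)
  refine ((Set.finite_Icc (-(N : ℤ)) N).prod (Set.finite_Icc (-(N : ℤ)) N)).subset fun h hh => ?_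
  have h1 := half_le_hexForm h.1 h.2
  have h2 : hexForm h.1 h.2 ≤ c := by
    have := hexForm_nonneg h.1 h.2
    have hh' : rStar ^ 2 * hexForm h.1 h.2 ≤ c := hh
    nlinarith
  have h3 : ((h.1 : ℝ)) ^ 2 + (h.2 : ℝ) ^ 2 ≤ N := by linarith
  have h4 : h.1 ^ 2 + h.2 ^ 2 ≤ (N : ℤ) := by exact_mod_cast h3
  have k1 : h.1 ^ 2 ≤ N := by nlinarith [sq_nonneg h.2]
  have k2 : h.2 ^ 2 ≤ N := by nlinarith [sq_nonneg h.1]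
  simp only [Set.mem_prod, Set.mem_Icc]
  refine ⟨⟨?_, ?_⟩, ⟨?_, ?_⟩⟩ <;> nlinarith [Int.le_self_sq h.1, Int.le_self_sq h.2, Int.le_self_sq (-h.1), Int.le_self_sq (-h.2)]

/-- Lattice points in dilates of an ellipse are asymptotically counted by area: the form is
homogeneous of degree two and its sublevel set is bounded and convex, so its boundary is a null set.
The value of the density plays no role. -/
lemma exists_tendsto_ncard_hexForm_le : ∃ κ : ℝ, 0 < κ ∧
    Tendsto (fun c : ℝ => ({h : ℤ × ℤ | rStar ^ 2 * hexForm h.1 h.2 ≤ c}.ncard : ℝ) / c) atTop (𝓝 κ) := by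
  set b := Pi.basisFun ℝ (Fin 2)
  set L : Submodule ℤ (Fin 2 → ℝ) := Submodule.span ℤ (Set.range b) with hL
  set F : (Fin 2 → ℝ) → ℝ := fun x => rStar ^ 2 * hexForm (x 0) (x 1) with hF
  have hr := one_le_rStar_sq
  have hFc : Continuous F := by simp only [hF, hexForm]; fun_prop
  set S : Set (Fin 2 → ℝ) := {x | x ∈ (univ : Set (Fin 2 → ℝ)) ∧ F x ≤ 1} with hS
  have hSm : MeasurableSet S := by
    simp only [hS, mem_univ, true_and]
    exact measurableSet_le hFc.measurable measurable_const
  have hSb : Bornology.IsBounded S := by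
    refine (Metric.isBounded_closedBall (x := (0 : Fin 2 → ℝ)) (r := 2)).subset fun x hx => ?_
    have hx : rStar ^ 2 * hexForm (x 0) (x 1) ≤ 1 := hx.2
    have h1 := half_le_hexForm (x 0) (x 1)
    have h2 := hexForm_nonneg (x 0) (x 1)
    have h3 : x 0 ^ 2 + x 1 ^ 2 ≤ 2 := by nlinarith
    rw [mem_closedBall_zero_iff, pi_norm_le_iff_of_nonneg zero_le_two, Fin.forall_fin_two]
    constructor <;> rw [Real.norm_eq_abs] <;> apply abs_le_of_sq_le_sq _ zero_le_two <;> nlinarith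
  have hSc : Convex ℝ S := by
    intro x hx y hy s t hs ht hst
    refine ⟨mem_univ _, ?_⟩
    have hx : F x ≤ 1 := hx.2
    have hy : F y ≤ 1 := hy.2
    have e : F (s • x + t • y) = s * F x + t * F y - s * t * (rStar ^ 2 * hexForm (x 0 - y 0) (x 1 - y 1)) := by
      obtain rfl : t = 1 - s := by linarith
      simp only [hF, hexForm, Pi.add_apply, Pi.smul_apply, smul_eq_mul]; ring
    have h1 := hexForm_nonneg (x 0 - y 0) (x 1 - y 1)
    have h2 : 0 ≤ s * t * (rStar ^ 2 * hexForm (x 0 - y 0) (x 1 - y 1)) := by positivity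
    rw [e]
    nlinarith
  have hT := ZLattice.covolume.tendsto_card_le_div L (X := univ) (F := F) (fun _ _ _ _ => mem_univ _)
    (fun x r _ => by simp only [hF, hexForm, Pi.smul_apply, smul_eq_mul, Fintype.card_fin]; ring) hSb hSm
    (hSc.addHaar_frontier _)
  refine ⟨_, ?_, hT.congr fun c => ?_⟩
  · refine div_pos ?_ (ZLattice.covolume_pos L volume)
    refine ENNReal.toReal_pos (Measure.measure_pos_of_mem_nhds volume (x := 0) ?_).ne' hSb.measure_lt_top.ne
    refine mem_of_superset ((isOpen_lt hFc continuous_const).mem_nhds (?_ : F 0 < 1)) fun x hx => ⟨mem_univ _, le_of_lt hx⟩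
    simp [hF, hexForm]
  · congr 2
    rw [Nat.card_coe_set_eq]
    have hinj : Function.Injective fun h : ℤ × ℤ => (![(h.1 : ℝ), (h.2 : ℝ)] : Fin 2 → ℝ) := by
      intro x y hxy
      have h0 := congrFun hxy 0
      have h1 := congrFun hxy 1
      simp at h0 h1
      exact Prod.ext h0 h1
    rw [← Set.ncard_image_of_injective _ hinj]
    congr 1
    ext x
    simp only [mem_inter_iff, mem_univ, true_and, Set.mem_ofPred_eq, SetLike.mem_coe, hL,
      Module.Basis.mem_span_iff_repr_mem, Set.mem_image]
    constructor
    · rintro ⟨h1, h2⟩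
      obtain ⟨m, hm⟩ := h2 0
      obtain ⟨n, hn⟩ := h2 1
      simp [b] at hm hn
      refine ⟨(m, n), ?_, ?_⟩
      · simpa [hF, ← hm, ← hn] using h1
      · ext i; fin_cases i <;> simp [hm, hn]
    · rintro ⟨h, hh, rfl⟩
      refine ⟨by simpa [hF] using hh, fun i => ?_⟩
      fin_cases i <;> simp [b]

/-- The number of lattice points in a disk. -/
def discCount (R : ℝ) : ℕ := {h : ℤ × ℤ | ‖hexPoint h‖ ≤ R}.ncard

lemma finite_disc (R : ℝ) : {h : ℤ × ℤ | ‖hexPoint h‖ ≤ R}.Finite := by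
  refine (finite_setOf_hexForm_le (R ^ 2)).subset fun h hh => ?_
  have hh : ‖hexPoint h‖ ≤ R := hh
  rw [Set.mem_ofPred_eq, ← norm_sq_hexPoint]
  gcongr

/-- The same density for every fixed change c of the radius; annuli of bounded width are thus
negligible. -/
lemma exists_tendsto_discCount : ∃ κ : ℝ, 0 < κ ∧
    ∀ c : ℝ, Tendsto (fun R : ℝ => (discCount (R + c) : ℝ) / R ^ 2) atTop (𝓝 κ) := by
  obtain ⟨κ, hκ, h⟩ := exists_tendsto_ncard_hexForm_le
  refine ⟨κ, hκ, fun c => ?_⟩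
  have h1 : Tendsto (fun R : ℝ => (R + c) ^ 2) atTop atTop :=
    (tendsto_pow_atTop two_ne_zero).comp (tendsto_atTop_add_const_right _ c tendsto_id)
  have h2 : Tendsto (fun R : ℝ => ((R + c) / R) ^ 2) atTop (𝓝 1) := by
    have h3 : Tendsto (fun R : ℝ => 1 + c / R) atTop (𝓝 (1 + 0)) :=
      tendsto_const_nhds.add (tendsto_const_nhds.div_atTop tendsto_id)
    rw [add_zero] at h3
    have h4 := h3.pow 2
    rw [one_pow] at h4
    refine h4.congr' ?_
    filter_upwards [eventually_gt_atTop 0] with R hR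
    field_simp
  have h5 := (h.comp h1).mul h2
  rw [mul_one] at h5
  refine h5.congr' ?_
  filter_upwards [eventually_gt_atTop 0, eventually_gt_atTop (-c)] with R hR hR'
  have hRc : 0 < R + c := by linarith
  have e : {h : ℤ × ℤ | rStar ^ 2 * hexForm h.1 h.2 ≤ (R + c) ^ 2} = {h | ‖hexPoint h‖ ≤ R + c} := by
    ext h
    rw [Set.mem_ofPred_eq, Set.mem_ofPred_eq, ← norm_sq_hexPoint, sq_le_sq₀ (norm_nonneg _) hRc.le]
  simp only [Function.comp, e, discCount]
  field_simp

lemma finite_perturbed_disc {P : ℤ × ℤ → Plane} {ε : ℝ} (hP : ∀ x, ‖P x‖ ≤ ε) (R : ℝ) :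
    {x | ‖hexPoint x + P x‖ ≤ R}.Finite := by
  refine (finite_disc (R + ε)).subset fun x hx => ?_
  have hx : ‖hexPoint x + P x‖ ≤ R := hx
  have h1 : ‖hexPoint x‖ ≤ ‖hexPoint x + P x‖ + ‖P x‖ := by
    simpa using norm_sub_le (hexPoint x + P x) (P x)
  exact h1.trans (add_le_add hx (hP x))

/-- The index set of the points of the perturbed lattice in a disk. -/
def discIndex {P : ℤ × ℤ → Plane} {ε : ℝ} (hP : ∀ x, ‖P x‖ ≤ ε) (R : ℝ) : Finset (ℤ × ℤ) :=
  (finite_perturbed_disc hP R).toFinset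

lemma mem_discIndex {P : ℤ × ℤ → Plane} {ε : ℝ} (hP : ∀ x, ‖P x‖ ≤ ε) (R : ℝ) (x : ℤ × ℤ) :
    x ∈ discIndex hP R ↔ ‖hexPoint x + P x‖ ≤ R := by simp [discIndex]

/-- The part of `J` that is moved out of `J` by the translation by `h`. -/
def exitSet (J : Finset (ℤ × ℤ)) (h : ℤ × ℤ) : Finset (ℤ × ℤ) := {x ∈ J | x + h ∉ J}

/-- The part of `J` that is moved into `J` by the translation by `h`. -/
def staySet (J : Finset (ℤ × ℤ)) (h : ℤ × ℤ) : Finset (ℤ × ℤ) := {x ∈ J | x + h ∈ J}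

lemma card_staySet_add (J : Finset (ℤ × ℤ)) (h : ℤ × ℤ) : (staySet J h).card + (exitSet J h).card = J.card :=
  Finset.card_filter_add_card_filter_not _

lemma card_exitSet_le (J : Finset (ℤ × ℤ)) (h : ℤ × ℤ) : (exitSet J h).card ≤ J.card := Finset.card_filter_le _ _

lemma eventually_discIndex_card_pos {P : ℤ × ℤ → Plane} {ε : ℝ} (hP : ∀ x, ‖P x‖ ≤ ε) :
    ∀ᶠ R in atTop, 0 < (discIndex hP R).card := by
  filter_upwards [eventually_ge_atTop ε] with R hR
  refine Finset.card_pos.mpr ⟨0, ?_⟩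
  rw [mem_discIndex, hexPoint_zero, zero_add]
  exact (hP 0).trans hR

/-- Disks form a Følner sequence. -/
lemma tendsto_card_exitSet {P : ℤ × ℤ → Plane} {ε : ℝ} (hP : ∀ x, ‖P x‖ ≤ ε) (h : ℤ × ℤ) :
    Tendsto (fun R => ((exitSet (discIndex hP R) h).card : ℝ) / (discIndex hP R).card) atTop (𝓝 0) := by
  obtain ⟨κ, hκ, hT⟩ := exists_tendsto_discCount
  have hε : 0 ≤ ε := (norm_nonneg _).trans (hP 0)
  set c := ε + ‖hexPoint h‖ with hc
  have t : Tendsto (fun R : ℝ => ((discCount (R + c) : ℝ) / R ^ 2 - (discCount (R + -c) : ℝ) / R ^ 2) /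
      ((discCount (R + -c) : ℝ) / R ^ 2)) atTop (𝓝 ((κ - κ) / κ)) := ((hT c).sub (hT (-c))).div (hT (-c)) hκ.ne'
  rw [sub_self, zero_div] at t
  refine squeeze_zero' (Eventually.of_forall fun R => by positivity) ?_ t
  have hpos := (hT (-c)).eventually (lt_mem_nhds hκ)
  filter_upwards [hpos, eventually_gt_atTop 0] with R hR hR0
  have hn : 0 < (discCount (R + -c) : ℝ) := by
    by_contra hcon
    have : (discCount (R + -c) : ℝ) = 0 := le_antisymm (not_lt.mp hcon) (by positivity)
    rw [this, zero_div] at hR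
    exact lt_irrefl _ hR
  rw [← sub_div, div_div_div_cancel_right₀ (by positivity)]
  -- The index set contains all lattice points of the disk of radius R - c, and the exit set lies in
  -- the annulus between R - c and R + c.
  set A := (finite_disc (R + c)).toFinset with hA
  set B := (finite_disc (R + -c)).toFinset with hB
  have eA : (A.card : ℝ) = discCount (R + c) := by
    rw [hA, discCount, Set.ncard_eq_toFinset_card _ (finite_disc (R + c))]
  have eB : (B.card : ℝ) = discCount (R + -c) := by
    rw [hB, discCount, Set.ncard_eq_toFinset_card _ (finite_disc (R + -c))]
  have mA : ∀ x, x ∈ A ↔ ‖hexPoint x‖ ≤ R + c := fun x => by simp [hA]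
  have mB : ∀ x, x ∈ B ↔ ‖hexPoint x‖ ≤ R + -c := fun x => by simp [hB]
  have hh0 := norm_nonneg (hexPoint h)
  have hBJ : B ⊆ discIndex hP R := fun x hx => by
    rw [mB] at hx
    rw [mem_discIndex]
    refine (norm_add_le _ _).trans ?_
    linarith [hP x]
  have hBA : B ⊆ A := fun x hx => by
    rw [mB] at hx
    rw [mA]; linarith
  have hE : exitSet (discIndex hP R) h ⊆ A \ B := fun x hx => by
    rw [exitSet, Finset.mem_filter, mem_discIndex, mem_discIndex] at hx
    rw [Finset.mem_sdiff, mA, mB]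
    constructor
    · have h1 : ‖hexPoint x‖ ≤ ‖hexPoint x + P x‖ + ‖P x‖ := by
        simpa using norm_sub_le (hexPoint x + P x) (P x)
      linarith [hP x]
    · intro hx'
      apply hx.2
      rw [hexPoint_add]
      refine (norm_add_le _ _).trans ?_
      have := norm_add_le (hexPoint x) (hexPoint h)
      linarith [hP (x + h)]
  have c1 : ((exitSet (discIndex hP R) h).card : ℝ) ≤ discCount (R + c) - discCount (R + -c) := by
    rw [← eA, ← eB, ← Nat.cast_sub (Finset.card_le_card hBA), ← Finset.card_sdiff_of_subset hBA]
    exact_mod_cast Finset.card_le_card hE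
  have c2 : (discCount (R + -c) : ℝ) ≤ (discIndex hP R).card := by
    rw [← eB]; exact_mod_cast Finset.card_le_card hBJ
  exact div_le_div₀ (le_trans (by positivity) c1) c1 hn c2

/-! ### Energies as sums over differences -/

/-- The sum of the pair interactions inside `J` at index separation `h`. -/
def sepSum (J : Finset (ℤ × ℤ)) (g : ℤ × ℤ → ℤ × ℤ → ℝ) (h : ℤ × ℤ) : ℝ :=
  if h = 0 then 0 else ∑ x ∈ staySet J h, g x (x + h)

lemma hasSum_sepSum (J : Finset (ℤ × ℤ)) (g : ℤ × ℤ → ℤ × ℤ → ℝ) :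
    HasSum (sepSum J g) (∑ z ∈ J.offDiag, g z.1 z.2) := by
  set D := J.offDiag.image fun z => z.2 - z.1 with hD
  have hsupp : ∀ h, h ∉ D → sepSum J g h = 0 := by
    intro h hh
    unfold sepSum
    split_ifs with h0
    · rfl
    · refine Finset.sum_eq_zero fun x hx => absurd ?_ hh
      rw [staySet, Finset.mem_filter] at hx
      rw [hD, Finset.mem_image]
      exact ⟨(x, x + h), by simp [Finset.mem_offDiag, hx.1, hx.2, h0], by simp⟩
  have : HasSum (sepSum J g) (∑ h ∈ D, sepSum J g h) := hasSum_sum_of_ne_finset_zero hsupp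
  convert this using 1
  rw [← Finset.sum_fiberwise_of_maps_to (s := J.offDiag) (t := D) (g := fun z => z.2 - z.1)
    (fun z hz => Finset.mem_image_of_mem _ hz)]
  refine Finset.sum_congr rfl fun h hh => ?_
  have h0 : h ≠ 0 := by
    rw [hD, Finset.mem_image] at hh
    obtain ⟨z, hz, rfl⟩ := hh
    rw [Finset.mem_offDiag] at hz
    exact sub_ne_zero.mpr (Ne.symm hz.2.2)
  rw [sepSum, if_neg h0]
  refine Finset.sum_bij' (fun z _ => z.1) (fun x _ => (x, x + h)) ?_ ?_ ?_ ?_ ?_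
  · intro z hz
    rw [Finset.mem_filter, Finset.mem_offDiag] at hz
    rw [staySet, Finset.mem_filter, ← hz.2]
    simp [hz.1.1, hz.1.2.1]
  · intro x hx
    rw [staySet, Finset.mem_filter] at hx
    simp [Finset.mem_offDiag, hx.1, hx.2, h0]
  · intro z hz
    rw [Finset.mem_filter] at hz
    ext <;> simp [← hz.2]
  · intro x hx; rfl
  · intro z hz
    rw [Finset.mem_filter] at hz
    rw [← hz.2]; simp

/-- Distinct lattice points are at distance at least 1 and move by at most 1/8 each. Point counts
and sums over pairs can therefore be transferred to indices. -/
lemma perturbed_injective {P : ℤ × ℤ → Plane} {ε : ℝ} (hP : ∀ x, ‖P x‖ ≤ ε) (hε : ε ≤ 1 / 8) :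
    Function.Injective fun x => hexPoint x + P x := by
  intro x y hxy
  have hxy : hexPoint x + P x = hexPoint y + P y := hxy
  by_contra hne
  have h1 := one_le_norm_hexPoint (sub_ne_zero.mpr hne)
  have h2 : hexPoint x = hexPoint (x - y) + hexPoint y := by rw [← hexPoint_add, sub_add_cancel]
  have h3 : hexPoint (x - y) = P y - P x := by
    rw [h2] at hxy
    have h4 : hexPoint (x - y) + hexPoint y + P x - (hexPoint y + P x) = hexPoint y + P y - (hexPoint y + P x) := by
      rw [hxy]
    simpa [add_sub_add_left_eq_sub, add_assoc] using h4
  rw [h3] at h1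
  have := norm_sub_le (P y) (P x)
  linarith [hP x, hP y]

lemma energy_eq_liminf (f : ℝ → ℝ) {P : ℤ × ℤ → Plane} {ε : ℝ} (hP : ∀ x, ‖P x‖ ≤ ε) (hε : ε ≤ 1 / 8) :
    energy f (Set.range fun x => hexPoint x + P x) = liminf (fun R : ℝ =>
      (((∑ z ∈ (discIndex hP R).offDiag, f ‖hexPoint (z.2 - z.1) + (P z.2 - P z.1)‖) /
        ((discIndex hP R).card : ℝ) : ℝ) : EReal)) atTop := by
  unfold energy
  congr 1
  funext R
  set u := fun x => hexPoint x + P x with hu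
  have hinj : Function.Injective u := perturbed_injective hP hε
  have hX : Set.range u ∩ Metric.closedBall 0 R = ((discIndex hP R).image u : Finset Plane) := by
    ext y
    simp only [Set.mem_inter_iff, Set.mem_range, mem_closedBall_zero_iff, Finset.coe_image, Set.mem_image,
      Finset.mem_coe, mem_discIndex]
    constructor
    · rintro ⟨⟨x, rfl⟩, hx⟩; exact ⟨x, hx, rfl⟩
    · rintro ⟨x, hx, rfl⟩; exact ⟨⟨x, rfl⟩, hx⟩
  rw [hX, Set.ncard_coe_finset, Finset.card_image_of_injective _ hinj, ← Finset.coe_offDiag,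
    finsum_mem_coe_finset]
  congr 2
  refine (Finset.sum_bij (fun z _ => (u z.1, u z.2)) ?_ ?_ ?_ ?_).symm
  · intro z hz
    rw [Finset.mem_offDiag] at hz ⊢
    exact ⟨Finset.mem_image_of_mem _ hz.1, Finset.mem_image_of_mem _ hz.2.1, fun h => hz.2.2 (hinj h)⟩
  · intro z _ w _ h
    exact Prod.ext (hinj (congrArg Prod.fst h)) (hinj (congrArg Prod.snd h))
  · intro w hw
    rw [Finset.mem_offDiag, Finset.mem_image, Finset.mem_image] at hw
    obtain ⟨⟨x, hx, hx'⟩, ⟨y, hy, hy'⟩, hne⟩ := hw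
    refine ⟨(x, y), ?_, Prod.ext hx' hy'⟩
    rw [Finset.mem_offDiag]
    refine ⟨hx, hy, fun h => hne ?_⟩
    rw [← hx', ← hy']; exact congrArg u h
  · intro z _
    rw [dist_comm, dist_eq_norm]
    congr 2
    have : hexPoint z.2 = hexPoint (z.2 - z.1) + hexPoint z.1 := by rw [← hexPoint_add, sub_add_cancel]
    simp only [hu]
    rw [this]; abel

lemma IsMixtureMeasure.antitone {W : Measure ℝ≥0} {f : ℝ → ℝ} (hW : IsMixtureMeasure W f) {r s : ℝ}
    (hr : 0 < r) (hrs : r ≤ s) : f s ≤ f r := by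
  rw [← (hW r hr).2, ← (hW s (hr.trans_le hrs)).2]
  refine integral_mono (hW s (hr.trans_le hrs)).1 (hW r hr).1 fun α => ?_
  apply Real.exp_le_exp.mpr
  have := Real.pi_pos
  have : Real.pi * α * r ^ 2 ≤ Real.pi * α * s ^ 2 := by gcongr
  linarith

/-- The interaction of the hexagonal lattice at index separation `h`. -/
def latticeTerm (f : ℝ → ℝ) (h : ℤ × ℤ) : ℝ := if h = 0 then 0 else f ‖hexPoint h‖

/-- An upper bound for the interactions at index separation `h` after a small perturbation. -/
def halfTerm (f : ℝ → ℝ) (h : ℤ × ℤ) : ℝ := if h = 0 then 0 else f (√(rStar ^ 2 * hexForm h.1 h.2 / 2))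

lemma half_hexForm_pos {h : ℤ × ℤ} (hh : h ≠ 0) : 0 < rStar ^ 2 * hexForm h.1 h.2 / 2 := by
  linarith [one_le_rStar_sq_mul_hexForm hh]

lemma latticeTerm_nonneg {W : Measure ℝ≥0} {f : ℝ → ℝ} (hW : IsMixtureMeasure W f) (h : ℤ × ℤ) :
    0 ≤ latticeTerm f h := by
  unfold latticeTerm
  split_ifs with hh
  · exact le_rfl
  · exact hW.nonneg (by linarith [one_le_norm_hexPoint hh])

lemma halfTerm_nonneg {W : Measure ℝ≥0} {f : ℝ → ℝ} (hW : IsMixtureMeasure W f) (h : ℤ × ℤ) :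
    0 ≤ halfTerm f h := by
  unfold halfTerm
  split_ifs with hh
  · exact le_rfl
  · exact hW.nonneg (Real.sqrt_pos.mpr (half_hexForm_pos hh))

lemma interaction_le_half {W : Measure ℝ≥0} {f : ℝ → ℝ} (hW : IsMixtureMeasure W f) {h : ℤ × ℤ} (hh : h ≠ 0)
    {y : ℝ × ℝ} (hy : dualSq y ≤ (1 / 4) ^ 2) :
    0 ≤ f (√(rStar ^ 2 * hexForm h.1 h.2 + 2 * dualPair h y + dualSq y)) ∧
    f (√(rStar ^ 2 * hexForm h.1 h.2 + 2 * dualPair h y + dualSq y)) ≤ halfTerm f h := by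
  have h1 := half_le_perturbed (one_le_rStar_sq_mul_hexForm hh) (dualSq_nonneg y) (dualPair_sq_le h y) hy
  have h2 := half_hexForm_pos hh
  refine ⟨hW.nonneg (Real.sqrt_pos.mpr (h2.trans_le h1)), ?_⟩
  rw [halfTerm, if_neg hh]
  exact hW.antitone (Real.sqrt_pos.mpr h2) (Real.sqrt_le_sqrt h1)

lemma latticeTerm_le_halfTerm {W : Measure ℝ≥0} {f : ℝ → ℝ} (hW : IsMixtureMeasure W f) (h : ℤ × ℤ) :
    latticeTerm f h ≤ halfTerm f h := by
  by_cases hh : h = 0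
  · simp [latticeTerm, halfTerm, hh]
  · have := (interaction_le_half hW hh (y := 0) (by simp [dualSq])).2
    rw [latticeTerm, if_neg hh, norm_hexPoint]
    simpa [dualPair, dualSq] using this

lemma summable_halfTerm {W : Measure ℝ≥0} {f : ℝ → ℝ} (hW : IsMixtureMeasure W f) (hL : ratioNum W 1 1 ≠ ⊤) :
    Summable (halfTerm f) := summable_interaction hW hL

lemma summable_latticeTerm {W : Measure ℝ≥0} {f : ℝ → ℝ} (hW : IsMixtureMeasure W f) (hL : ratioNum W 1 1 ≠ ⊤) :
    Summable (latticeTerm f) :=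
  Summable.of_nonneg_of_le (latticeTerm_nonneg hW) (latticeTerm_le_halfTerm hW) (summable_halfTerm hW hL)

lemma hexLattice_eq_perturbed : hexLattice = Set.range fun x => hexPoint x + (0 : ℤ × ℤ → Plane) x := by
  simp [hexLattice_eq_range]

/-- At every radius a given separation occurs at most once per point, so each quotient is at most
the full lattice sum. For the unperturbed lattice this upper bound is all that is needed. -/
lemma energy_hexLattice_le {W : Measure ℝ≥0} {f : ℝ → ℝ} (hW : IsMixtureMeasure W f) (hL : ratioNum W 1 1 ≠ ⊤) :
    energy f hexLattice ≤ ((∑' h, latticeTerm f h : ℝ) : EReal) := by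
  have hP : ∀ x, ‖(0 : ℤ × ℤ → Plane) x‖ ≤ (0 : ℝ) := fun x => by simp
  rw [hexLattice_eq_perturbed, energy_eq_liminf f hP (by norm_num)]
  refine liminf_le_of_frequently_le' (Frequently.of_forall fun R => ?_)
  rw [EReal.coe_le_coe_iff]
  have hS := summable_latticeTerm hW hL
  have h0 : 0 ≤ ∑' h, latticeTerm f h := tsum_nonneg (latticeTerm_nonneg hW)
  set J := discIndex hP R
  refine div_le_of_le_mul₀ (by positivity) h0 ?_
  have h1 := hasSum_sepSum J fun x y => f ‖hexPoint (y - x) + ((0 : ℤ × ℤ → Plane) y - (0 : ℤ × ℤ → Plane) x)‖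
  rw [← h1.tsum_eq, mul_comm, ← tsum_mul_left]
  refine h1.summable.tsum_le_tsum (fun h => ?_) (hS.mul_left _)
  by_cases hh : h = 0
  · simp [sepSum, latticeTerm, hh]
  · rw [sepSum, if_neg hh, latticeTerm, if_neg hh]
    simp only [add_sub_cancel_left, Pi.zero_apply, sub_self, add_zero, Finset.sum_const, nsmul_eq_mul]
    have h2 := hW.nonneg (r := ‖hexPoint h‖) (by linarith [one_le_norm_hexPoint hh])
    refine mul_le_mul_of_nonneg_right ?_ h2
    exact_mod_cast Finset.card_filter_le _ _

lemma dualSq_dualCoord_le {v : Plane} {δ : ℝ} (hv : ‖v‖ ≤ δ) : dualSq (dualCoord v) ≤ δ ^ 2 := by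
  rw [dualSq_dualCoord]
  exact pow_le_pow_left₀ (norm_nonneg _) hv 2

/-- The energy of the perturbed lattice inside a finite window, up to a boundary term. -/
lemma exists_sum_offDiag_ge : ∃ c : ℝ, 0 < c ∧ ∀ (W : Measure ℝ≥0) (f : ℝ → ℝ) (K ε : ℝ) (P : ℤ × ℤ → Plane)
    (J : Finset (ℤ × ℤ)), IsMixtureMeasure W f → ratioNum W 1 1 ≠ ⊤ → 0 ≤ K →
    ratioNum W 1 1 ≤ ENNReal.ofReal K * ratioDen W → ε ≤ 1 / 8 → ε * K ≤ c → (∀ x, ‖P x‖ ≤ ε) →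
    J.card * ∑' h, latticeTerm f h - 3 * ∑' h, halfTerm f h * (exitSet J h).card ≤
      ∑ z ∈ J.offDiag, f ‖hexPoint (z.2 - z.1) + (P z.2 - P z.1)‖ := by
  obtain ⟨c, hc, hc'⟩ := exists_tsum_interaction_nonneg
  refine ⟨c / 2, by positivity, ?_⟩
  intro W f K ε P J hW hL hK hLK hε hεK hP
  have hε0 : 0 ≤ ε := (norm_nonneg _).trans (hP 0)
  -- The displacement is set to zero outside the window, to make it finitely supported; increments
  -- of it are bounded by 2 ε.
  set q : ℤ × ℤ → ℝ × ℝ := fun x => if x ∈ J then dualCoord (P x) else 0 with hq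
  have hq0 : ∀ x, x ∉ J → q x = 0 := fun x hx => by simp [hq, hx]
  have hqv : ∀ x, ∃ v : Plane, ‖v‖ ≤ ε ∧ q x = dualCoord v := fun x => by
    by_cases hx : x ∈ J
    · exact ⟨P x, hP x, by simp [hq, hx]⟩
    · exact ⟨0, by simpa using hε0, by simp [hq, hx, dualCoord_zero]⟩
  have hd : ∀ x y, dualSq (q x - q y) ≤ (2 * ε) ^ 2 := fun x y => by
    obtain ⟨v, hv, hv'⟩ := hqv x
    obtain ⟨w, hw, hw'⟩ := hqv y
    rw [hv', hw', ← dualCoord_sub]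
    exact dualSq_dualCoord_le ((norm_sub_le _ _).trans (by linarith))
  have hd' : ∀ x y, dualSq (q x - q y) ≤ (1 / 4) ^ 2 := fun x y => (hd x y).trans (by gcongr; linarith)
  obtain ⟨sT, hT⟩ := hc' W f K (2 * ε) q J hW hL hK hLK (by positivity) (by linarith) (by linarith) hq0 hd
  set T : ℤ × ℤ → ℝ := fun h => if h = 0 then 0 else
      ∑' x, (f (√(rStar ^ 2 * hexForm h.1 h.2 + 2 * dualPair h (q (x + h) - q x) + dualSq (q (x + h) - q x))) -
        f (√(rStar ^ 2 * hexForm h.1 h.2))) with hTdef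
  have hA := hasSum_sepSum J fun x y => f ‖hexPoint (y - x) + (P y - P x)‖
  set A := sepSum J fun x y => f ‖hexPoint (y - x) + (P y - P x)‖ with hAdef
  have sF := summable_halfTerm hW hL
  have sf := summable_latticeTerm hW hL
  have sB : Summable fun h => halfTerm f h * (exitSet J h).card := by
    refine Summable.of_nonneg_of_le (fun h => mul_nonneg (halfTerm_nonneg hW h) (by positivity)) (fun h => ?_)
      (sF.mul_right (J.card : ℝ))
    refine mul_le_mul_of_nonneg_left ?_ (halfTerm_nonneg hW h)
    exact_mod_cast card_exitSet_le J h
  -- At separation h, pairs inside J give `A h` minus their lattice energy. The 2|exit| pairs with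
  -- one end in J cost at most `halfTerm` each, and replacing |stay| by |J| costs one more |exit|
  -- term: hence the 3.
  have key : ∀ h, T h ≤ A h - J.card * latticeTerm f h + 3 * (halfTerm f h * (exitSet J h).card) := by
    intro h
    by_cases hh : h = 0
    · simp [hTdef, hAdef, sepSum, latticeTerm, halfTerm, hh]
    have e1 : T h = ∑ x ∈ J ∪ J.image (· - h),
        (f (√(rStar ^ 2 * hexForm h.1 h.2 + 2 * dualPair h (q (x + h) - q x) + dualSq (q (x + h) - q x))) -
        f (√(rStar ^ 2 * hexForm h.1 h.2))) := by
      simp only [hTdef, if_neg hh]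
      exact tsum_increment_eq_sum hq0 h
        (g := fun y => f (√(rStar ^ 2 * hexForm h.1 h.2 + 2 * dualPair h y + dualSq y)) - f (√(rStar ^ 2 * hexForm h.1 h.2)))
        (by simp [dualPair, dualSq])
    have hsub : staySet J h ⊆ J ∪ J.image (· - h) :=
      (Finset.filter_subset _ _).trans Finset.subset_union_left
    rw [e1, ← Finset.sum_sdiff hsub]
    have hI : J ∩ J.image (· - h) = staySet J h := by
      ext x
      simp only [staySet, Finset.mem_inter, Finset.mem_image, Finset.mem_filter]
      refine and_congr_right fun _ => ⟨?_, fun hx => ⟨_, hx, by simp⟩⟩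
      rintro ⟨y, hy, rfl⟩
      simpa using hy
    have hcard : ((J ∪ J.image (· - h)) \ staySet J h).card = 2 * (exitSet J h).card := by
      have h1 := Finset.card_union_add_card_inter J (J.image (· - h))
      rw [hI, Finset.card_image_of_injective _ sub_left_injective] at h1
      have h2 := card_staySet_add J h
      rw [Finset.card_sdiff_of_subset hsub]
      omega
    have hl : latticeTerm f h = f (√(rStar ^ 2 * hexForm h.1 h.2)) := by
      rw [latticeTerm, if_neg hh, norm_hexPoint]
    have hl0 := latticeTerm_nonneg hW h
    have b1 : ∑ x ∈ (J ∪ J.image (· - h)) \ staySet J h,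
        (f (√(rStar ^ 2 * hexForm h.1 h.2 + 2 * dualPair h (q (x + h) - q x) + dualSq (q (x + h) - q x))) -
        f (√(rStar ^ 2 * hexForm h.1 h.2))) ≤ 2 * (exitSet J h).card * halfTerm f h := by
      refine (Finset.sum_le_card_nsmul _ _ (halfTerm f h) fun x _ => ?_).trans (le_of_eq ?_)
      · have := (interaction_le_half hW hh (hd' (x + h) x)).2
        rw [hl] at hl0
        linarith
      · rw [hcard, nsmul_eq_mul]; push_cast; ring
    have b2 : ∑ x ∈ staySet J h,
        (f (√(rStar ^ 2 * hexForm h.1 h.2 + 2 * dualPair h (q (x + h) - q x) + dualSq (q (x + h) - q x))) -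
        f (√(rStar ^ 2 * hexForm h.1 h.2))) = A h - (staySet J h).card * latticeTerm f h := by
      rw [Finset.sum_sub_distrib, Finset.sum_const, nsmul_eq_mul, ← hl, hAdef, sepSum, if_neg hh]
      congr 1
      refine Finset.sum_congr rfl fun x hx => ?_
      rw [staySet, Finset.mem_filter] at hx
      rw [add_sub_cancel_left, norm_hexPoint_add, dualCoord_sub]
      simp only [hq, if_pos hx.1, if_pos hx.2]
    have h3 : ((staySet J h).card : ℝ) + (exitSet J h).card = J.card := by exact_mod_cast card_staySet_add J h
    have h4 := latticeTerm_le_halfTerm hW h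
    have h5 : (exitSet J h).card * latticeTerm f h ≤ (exitSet J h).card * halfTerm f h := by gcongr
    rw [b2, ← h3]
    linarith
  have := sT.tsum_le_tsum key ((hA.summable.sub (sf.mul_left (J.card : ℝ))).add (sB.mul_left 3))
  rw [(hA.summable.sub (sf.mul_left (J.card : ℝ))).tsum_add (sB.mul_left 3), hA.summable.tsum_sub (sf.mul_left _),
    tsum_mul_left, tsum_mul_left, hA.tsum_eq] at this
  linarith

/-- A perturbation of the hexagonal lattice that is small compared with the ratio of the integrals of
the mixture measure does not decrease the energy. -/
lemma exists_energy_le_of_ratio : ∃ c : ℝ, 0 < c ∧ ∀ (W : Measure ℝ≥0) (f : ℝ → ℝ) (K ε : ℝ) (P : ℤ × ℤ → Plane),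
    IsMixtureMeasure W f → ratioNum W 1 1 ≠ ⊤ → 0 ≤ K →
    ratioNum W 1 1 ≤ ENNReal.ofReal K * ratioDen W → ε ≤ 1 / 8 → ε * K ≤ c → (∀ x, ‖P x‖ ≤ ε) →
    energy f hexLattice ≤ energy f (Set.range fun x => hexPoint x + P x) := by
  obtain ⟨c, hc, hc'⟩ := exists_sum_offDiag_ge
  refine ⟨c, hc, ?_⟩
  intro W f K ε P hW hL hK hLK hε hεK hP
  refine (energy_hexLattice_le hW hL).trans ?_
  rw [energy_eq_liminf f hP hε]
  have sF := summable_halfTerm hW hL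
  -- For each h the boundary fraction tends to 0 and is at most 1, so the boundary term vanishes by
  -- dominated convergence.
  have hlim : Tendsto (fun R => ∑' h, halfTerm f h *
      (((exitSet (discIndex hP R) h).card : ℝ) / (discIndex hP R).card)) atTop (𝓝 (∑' h, halfTerm f h * 0)) := by
    refine tendsto_tsum_of_dominated_convergence sF (fun h => (tendsto_card_exitSet hP h).const_mul _) ?_
    refine Eventually.of_forall fun R h => ?_
    rw [norm_mul, Real.norm_of_nonneg (halfTerm_nonneg hW h), Real.norm_of_nonneg (by positivity)]
    refine mul_le_of_le_one_right (halfTerm_nonneg hW h) (div_le_one_of_le₀ ?_ (by positivity))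
    exact_mod_cast card_exitSet_le _ h
  simp only [mul_zero, tsum_zero] at hlim
  have hlim2 := (tendsto_const_nhds (x := ∑' h, latticeTerm f h)).sub (hlim.const_mul 3)
  rw [mul_zero, sub_zero] at hlim2
  have hlim3 := (continuous_coe_real_ereal.tendsto _).comp hlim2
  rw [← hlim3.liminf_eq]
  refine liminf_le_liminf ?_
  filter_upwards [eventually_discIndex_card_pos hP] with R hR
  have hR' : (0 : ℝ) < (discIndex hP R).card := by exact_mod_cast hR
  simp only [Function.comp, EReal.coe_le_coe_iff]
  rw [le_div_iff₀ hR']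
  refine le_trans (le_of_eq ?_) (hc' W f K ε P (discIndex hP R) hW hL hK hLK hε hεK hP)
  have : ∑' h, halfTerm f h * (exitSet (discIndex hP R) h).card = (discIndex hP R).card *
      ∑' h, halfTerm f h * (((exitSet (discIndex hP R) h).card : ℝ) / (discIndex hP R).card) := by
    rw [← tsum_mul_left]
    refine tsum_congr fun h => ?_
    field_simp
  rw [this]; ring

/-! ### Divergent energies -/

/-- The perturbation at most doubles distances and f is decreasing. Each separation h thus
contributes at least f (2 ‖hexPoint h‖) per point in the limit, and finitely many separations
already exceed any bound. -/
lemma energy_perturbed_eq_top {W : Measure ℝ≥0} {f : ℝ → ℝ} (hW : IsMixtureMeasure W f)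
    (hns : ¬ Summable (latticeTerm fun r => f (2 * r))) {ε : ℝ} {P : ℤ × ℤ → Plane} (hε : ε ≤ 1 / 8)
    (hP : ∀ x, ‖P x‖ ≤ ε) : energy f (Set.range fun x => hexPoint x + P x) = ⊤ := by
  have hnn : ∀ h, 0 ≤ latticeTerm (fun r => f (2 * r)) h := fun h => by
    unfold latticeTerm
    split_ifs with hh
    · exact le_rfl
    · exact hW.nonneg (by linarith [one_le_norm_hexPoint hh])
  rw [energy_eq_liminf f hP hε, EReal.eq_top_iff_forall_lt]
  intro M
  obtain ⟨D, hD⟩ : ∃ D : Finset (ℤ × ℤ), M + 1 < ∑ h ∈ D, latticeTerm (fun r => f (2 * r)) h := by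
    by_contra hcon
    push Not at hcon
    exact hns (summable_of_sum_le hnn hcon)
  have hlim : Tendsto (fun R => ∑ h ∈ D, latticeTerm (fun r => f (2 * r)) h *
      (1 - ((exitSet (discIndex hP R) h).card : ℝ) / (discIndex hP R).card)) atTop
      (𝓝 (∑ h ∈ D, latticeTerm (fun r => f (2 * r)) h * (1 - 0))) :=
    tendsto_finsetSum _ fun h _ => (tendsto_const_nhds.sub (tendsto_card_exitSet hP h)).const_mul _
  simp only [sub_zero, mul_one] at hlim
  refine lt_of_lt_of_le (b := ((M + 1 : ℝ) : EReal)) (by exact_mod_cast lt_add_one M) ?_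
  refine le_liminf_of_le (by isBoundedDefault) ?_
  filter_upwards [hlim.eventually (lt_mem_nhds hD), eventually_discIndex_card_pos hP] with R hR1 hR2
  have hR' : (0 : ℝ) < (discIndex hP R).card := by exact_mod_cast hR2
  rw [EReal.coe_le_coe_iff]
  refine hR1.le.trans ?_
  rw [le_div_iff₀ hR', Finset.sum_mul]
  set J := discIndex hP R with hJ
  have hA := hasSum_sepSum J fun x y => f ‖hexPoint (y - x) + (P y - P x)‖
  have hterm : ∀ h, h ≠ 0 → ∀ x, 0 < ‖hexPoint h + (P (x + h) - P x)‖ ∧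
      ‖hexPoint h + (P (x + h) - P x)‖ ≤ 2 * ‖hexPoint h‖ := fun h hh x => by
    have h1 := one_le_norm_hexPoint hh
    have h2 : ‖P (x + h) - P x‖ ≤ 1 / 4 := (norm_sub_le _ _).trans (by linarith [hP x, hP (x + h)])
    have h3 := norm_sub_le (hexPoint h + (P (x + h) - P x)) (P (x + h) - P x)
    rw [add_sub_cancel_right] at h3
    exact ⟨by linarith, (norm_add_le _ _).trans (by linarith)⟩
  have hnonneg : ∀ h, 0 ≤ sepSum J (fun x y => f ‖hexPoint (y - x) + (P y - P x)‖) h := fun h => by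
    unfold sepSum
    split_ifs with hh
    · exact le_rfl
    · refine Finset.sum_nonneg fun x _ => ?_
      simp only [add_sub_cancel_left]
      exact hW.nonneg (hterm h hh x).1
  refine le_trans (Finset.sum_le_sum fun h _ => ?_) (sum_le_hasSum D (fun h _ => hnonneg h) hA)
  by_cases hh : h = 0
  · simp [hh, latticeTerm, sepSum]
  rw [sepSum, if_neg hh, latticeTerm, if_neg hh]
  have h3 : ((staySet J h).card : ℝ) + (exitSet J h).card = J.card := by exact_mod_cast card_staySet_add J h
  have h4 : (1 - ((exitSet J h).card : ℝ) / J.card) * J.card = (staySet J h).card := by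
    field_simp; linarith
  rw [mul_assoc, h4, mul_comm, ← nsmul_eq_mul]
  refine Finset.card_nsmul_le_sum _ _ _ fun x _ => ?_
  simp only [add_sub_cancel_left]
  exact hW.antitone (hterm h hh x).1 (hterm h hh x).2

/-- After Poisson summation only the zero term of the dual sum is kept. -/
lemma inv_four_mul_le_tsum_exp {α : ℝ} (hα : 0 < α) :
    1 / (4 * α) ≤ ∑' h : ℤ × ℤ, Real.exp (-(Real.pi * (α * (4 * rStar ^ 2))) * hexForm h.1 h.2) := by
  have hr := rStar_pos
  have h := tsum_exp_hexForm_mul_cos (a := α * (4 * rStar ^ 2)) (by positivity) 0 0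
  simp only [mul_zero, sub_zero, Real.cos_zero, mul_one, add_zero] at h
  rw [h]
  have e : 2 / (√3 * (α * (4 * rStar ^ 2))) = 1 / (4 * α) := by
    have := sqrt_three_mul_rStar_sq
    rw [show √3 * (α * (4 * rStar ^ 2)) = 4 * α * (√3 * rStar ^ 2) by ring, this]
    field_simp
  rw [e]
  refine le_mul_of_one_le_right (by positivity) ?_
  have hs := summable_exp_neg_hexForm (c := 4 * Real.pi / (3 * (α * (4 * rStar ^ 2)))) (by positivity)
  have := hs.le_tsum (0 : ℤ × ℤ) (fun h _ => (Real.exp_pos _).le)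
  simpa [hexForm_zero] using this

/-- For 0 < α ≤ 1/8 the previous bound is large enough to lose the term of the origin; for 1/8 ≤ α ≤
1 both α⁻¹ and the reciprocal of the last Gaussian are bounded; at α = 0 the sum has infinitely many
terms equal to 1. -/
lemma inv_le_tsum_exp {α : ℝ≥0} (hα : α ≤ 1) : (α : ℝ≥0∞)⁻¹ ≤
    8 * (∑' h : ℤ × ℤ, ENNReal.ofReal (if h = 0 then 0 else Real.exp (-(Real.pi * α * (2 * ‖hexPoint h‖) ^ 2)))) +
      ENNReal.ofReal (8 * Real.exp Real.pi) * ENNReal.ofReal (Real.exp (-(Real.pi * α * 1 ^ 2))) := by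
  have hpi := Real.pi_pos
  rcases eq_or_ne α 0 with rfl | h0
  · refine le_of_le_of_eq le_top (Eq.symm ?_)
    rw [ENNReal.add_eq_top]; left
    rw [ENNReal.mul_eq_top]; left
    refine ⟨by norm_num, ?_⟩
    have : Infinite {h : ℤ × ℤ // h ≠ 0} := by
      refine Infinite.of_injective (fun n : ℕ => ⟨((n : ℤ) + 1, 0), fun h => ?_⟩) fun m n hmn => ?_
      · have := congrArg Prod.fst h
        simp at this; omega
      · simpa using hmn
    refine top_unique ?_
    calc (⊤ : ℝ≥0∞) = ∑' _ : {h : ℤ × ℤ // h ≠ 0}, 1 := (ENNReal.tsum_const_eq_top_of_ne_zero one_ne_zero).symm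
      _ = ∑' h : {h : ℤ × ℤ // h ≠ 0}, ENNReal.ofReal (if (h : ℤ × ℤ) = 0 then 0 else
            Real.exp (-(Real.pi * (0 : ℝ≥0) * (2 * ‖hexPoint h‖) ^ 2))) := by
          refine tsum_congr fun h => ?_
          simp [h.2]
      _ ≤ _ := ENNReal.tsum_comp_le_tsum_of_injective Subtype.val_injective _
  have hpos : (0 : ℝ) < α := by positivity
  have h1 : (α : ℝ) ≤ 1 := by exact_mod_cast hα
  rw [← ENNReal.coe_inv h0, ← ENNReal.ofReal_coe_nnreal, NNReal.coe_inv]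
  rcases le_total (α : ℝ) (1 / 8) with h8 | h8
  · refine le_add_right ?_
    have hr := rStar_pos
    set g : ℤ × ℤ → ℝ := fun h => if h = 0 then 0 else Real.exp (-(Real.pi * α * (2 * ‖hexPoint h‖) ^ 2)) with hg
    have hs := summable_exp_neg_hexForm (c := Real.pi * (α * (4 * rStar ^ 2))) (by positivity)
    have e : ∀ h : ℤ × ℤ, Real.exp (-(Real.pi * (α * (4 * rStar ^ 2))) * hexForm h.1 h.2) =
        (if h = 0 then 1 else 0) + g h := fun h => by
      simp only [hg]
      split_ifs with hh
      · simp [hh, hexForm]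
      · rw [zero_add, mul_pow, norm_sq_hexPoint]; congr 1; ring
    have sg : Summable g := by
      have := hs.sub (summable_of_ne_finset_zero (s := {0}) (f := fun h : ℤ × ℤ => if h = 0 then (1 : ℝ) else 0)
        fun h hh => if_neg (by simpa using hh))
      refine this.congr fun h => ?_
      rw [e]; ring
    have h2 := inv_four_mul_le_tsum_exp hpos
    simp_rw [e] at h2
    rw [Summable.tsum_add (summable_of_ne_finset_zero (s := {0}) fun h hh => if_neg (by simpa using hh)) sg,
      tsum_ite_eq] at h2
    have g0 : ∀ h, 0 ≤ g h := fun h => by simp only [hg]; split_ifs <;> positivity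
    rw [← ENNReal.ofReal_tsum_of_nonneg g0 sg, ← ENNReal.ofReal_ofNat 8, ← ENNReal.ofReal_mul (by norm_num)]
    apply ENNReal.ofReal_le_ofReal
    have h3 : (α : ℝ)⁻¹ = 4 * (1 / (4 * α)) := by field_simp
    have h4 : 8 ≤ (α : ℝ)⁻¹ := by
      rw [le_inv_comm₀ (by norm_num) hpos]; linarith
    linarith
  · refine le_add_left ?_
    rw [← ENNReal.ofReal_mul (by positivity)]
    apply ENNReal.ofReal_le_ofReal
    have h2 : (α : ℝ)⁻¹ ≤ 8 := by rw [inv_le_comm₀ hpos (by norm_num)]; linarith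
    have h3 : 1 ≤ Real.exp Real.pi * Real.exp (-(Real.pi * α * 1 ^ 2)) := by
      rw [← Real.exp_add]
      apply Real.one_le_exp
      nlinarith
    rw [mul_assoc]
    exact h2.trans (le_mul_of_one_le_right (by norm_num) h3)

/-- The integral over [1, ∞) is always finite, since it is bounded by a value of f. If the lattice
sum converged, integrating `inv_le_tsum_exp` would bound the integral of α⁻¹ over [0, 1] as well. -/
lemma not_summable_of_ratioNum_eq_top {W : Measure ℝ≥0} {f : ℝ → ℝ} (hW : IsMixtureMeasure W f)
    (hL : ratioNum W 1 1 = ⊤) : ¬ Summable (latticeTerm fun r => f (2 * r)) := by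
  intro hs
  have hpi := Real.pi_pos
  have fin1 : ∀ r : ℝ, 0 < r → ∫⁻ α : ℝ≥0, ENNReal.ofReal (Real.exp (-(Real.pi * α * r ^ 2))) ∂W ≠ ⊤ := fun r hr =>
    (hW r hr).1.lintegral_lt_top.ne
  have fin2 : ∫⁻ α in Ici (1 : ℝ≥0), ENNReal.ofReal (Real.exp (-(Real.pi * α / 2 * rStar ^ 2))) ∂W ≠ ⊤ := by
    refine (lt_of_le_of_lt ((setLIntegral_le_lintegral _ _).trans (le_of_eq ?_))
      (fin1 (√(rStar ^ 2 / 2)) (Real.sqrt_pos.mpr (by have := rStar_pos; positivity))).lt_top).ne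
    refine lintegral_congr fun α => ?_
    rw [Real.sq_sqrt (by positivity)]
    congr 3; ring
  have fin3 : ∫⁻ α in Iic (1 : ℝ≥0), (α : ℝ≥0∞)⁻¹ ∂W ≠ ⊤ := by
    refine (lt_of_le_of_lt (setLIntegral_mono' measurableSet_Iic fun α hα => inv_le_tsum_exp hα) ?_).ne
    refine lt_of_le_of_lt (setLIntegral_le_lintegral _ _) ?_
    have m1 : ∀ h : ℤ × ℤ, Measurable fun α : ℝ≥0 =>
        ENNReal.ofReal (if h = 0 then 0 else Real.exp (-(Real.pi * α * (2 * ‖hexPoint h‖) ^ 2))) := fun h => by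
      split_ifs <;> fun_prop
    rw [lintegral_add_left ((Measurable.tsum m1).const_mul 8), lintegral_const_mul _ (Measurable.tsum m1),
      lintegral_const_mul _ (by fun_prop), lintegral_tsum fun h => (m1 h).aemeasurable]
    refine ENNReal.add_lt_top.mpr ⟨ENNReal.mul_lt_top (by norm_num) ?_,
      ENNReal.mul_lt_top ENNReal.ofReal_lt_top (fin1 1 one_pos).lt_top⟩
    have e : ∀ h : ℤ × ℤ, ∫⁻ α : ℝ≥0, ENNReal.ofReal (if h = 0 then 0 else
        Real.exp (-(Real.pi * α * (2 * ‖hexPoint h‖) ^ 2))) ∂W = ENNReal.ofReal (latticeTerm (fun r => f (2 * r)) h) := by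
      intro h
      by_cases hh : h = 0
      · simp [hh, latticeTerm]
      · have hp : 0 < 2 * ‖hexPoint h‖ := by linarith [one_le_norm_hexPoint hh]
        simp only [if_neg hh, latticeTerm]
        rw [← (hW _ hp).2, ofReal_integral_eq_lintegral_ofReal (hW _ hp).1 (ae_of_all _ fun α => (Real.exp_pos _).le)]
    simp_rw [e]
    exact hs.tsum_ofReal_lt_top
  exact (ENNReal.add_ne_top.mpr ⟨fin2, fin3⟩) hL

/-! ### Finite differences of completely monotonic functions -/

/-- The backward difference `g - g (· + τ)`. -/
def backDiff (τ : ℝ) (g : ℝ → ℝ) : ℝ → ℝ := fun x => g x - g (x + τ)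

lemma CompletelyMonotonic.contDiffAt {g : ℝ → ℝ} (hg : CompletelyMonotonic g) {x : ℝ} (hx : 0 < x) :
    ContDiffAt ℝ ∞ g x := (hg.1 x hx).contDiffAt (Ioi_mem_nhds hx)

lemma CompletelyMonotonic.differentiableAt_iteratedDeriv {g : ℝ → ℝ} (hg : CompletelyMonotonic g) (k : ℕ) {x : ℝ}
    (hx : 0 < x) : DifferentiableAt ℝ (iteratedDeriv k g) x := by
  have h1 := hg.1.differentiableOn_iteratedDerivWithin (m := k) (by exact_mod_cast WithTop.coe_lt_top _)
    (uniqueDiffOn_Ioi 0)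
  have h2 := (h1 x hx).differentiableAt (Ioi_mem_nhds hx)
  refine h2.congr_of_eventuallyEq ?_
  filter_upwards [Ioi_mem_nhds hx] with y hy
  exact (iteratedDerivWithin_of_isOpen isOpen_Ioi hy).symm

lemma CompletelyMonotonic.antitoneOn {g : ℝ → ℝ} (hg : CompletelyMonotonic g) (k : ℕ) :
    AntitoneOn (fun x => (-1 : ℝ) ^ k * iteratedDeriv k g x) (Ioi 0) := by
  have hd : ∀ x, 0 < x → DifferentiableAt ℝ (fun x => (-1 : ℝ) ^ k * iteratedDeriv k g x) x := fun x hx =>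
    (hg.differentiableAt_iteratedDeriv k hx).const_mul _
  refine antitoneOn_of_deriv_nonpos (convex_Ioi 0) (fun x hx => (hd x hx).continuousAt.continuousWithinAt)
    (fun x hx => ?_) fun x hx => ?_
  · rw [interior_Ioi] at hx
    exact (hd x hx).differentiableWithinAt
  · rw [interior_Ioi] at hx
    rw [deriv_const_mul _ (hg.differentiableAt_iteratedDeriv k hx), ← iteratedDeriv_succ]
    have := hg.2 (k + 1) x hx
    rw [pow_succ] at this
    linarith

/-- Each (-1)^k g^(k) is decreasing, so its backward difference is nonnegative. -/
lemma CompletelyMonotonic.backDiff {g : ℝ → ℝ} (hg : CompletelyMonotonic g) {τ : ℝ} (hτ : 0 ≤ τ) :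
    CompletelyMonotonic (backDiff τ g) := by
  have hs : ContDiffOn ℝ ∞ (fun x => g (x + τ)) (Ioi 0) :=
    hg.1.comp (contDiff_id.add contDiff_const).contDiffOn fun x hx => by
      have : 0 < x := hx
      exact (by linarith : 0 < x + τ)
  refine ⟨hg.1.sub hs, fun k t ht => ?_⟩
  have h1 : iteratedDeriv k (_root_.backDiff τ g) t = iteratedDeriv k g t - iteratedDeriv k g (t + τ) := by
    have c1 : ContDiffAt ℝ k g t := (hg.contDiffAt ht).of_le (by exact_mod_cast le_top)
    have c2 : ContDiffAt ℝ k (fun x => g (x + τ)) t :=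
      ((hs t ht).contDiffAt (Ioi_mem_nhds ht)).of_le (by exact_mod_cast le_top)
    have := iteratedDeriv_sub c1 c2
    rw [iteratedDeriv_comp_add_const] at this
    exact this
  rw [h1, mul_sub, sub_nonneg]
  exact hg.antitoneOn k ht (by show 0 < t + τ; linarith) (by linarith)

lemma CompletelyMonotonic.backDiff_iterate_nonneg {g : ℝ → ℝ} (hg : CompletelyMonotonic g) {τ : ℝ} (hτ : 0 ≤ τ)
    (m : ℕ) {x : ℝ} (hx : 0 < x) : 0 ≤ ((_root_.backDiff τ)^[m] g) x := by
  have : CompletelyMonotonic ((_root_.backDiff τ)^[m] g) := by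
    induction m with
    | zero => exact hg
    | succ m ih => rw [Function.iterate_succ_apply']; exact ih.backDiff hτ
  simpa using this.2 0 x hx

/-- Newton's formula for finite differences. -/
lemma sum_choose_mul_backDiff (τ : ℝ) (g : ℝ → ℝ) (n : ℕ) (x : ℝ) :
    ∑ m ∈ Finset.range (n + 1), (n.choose m : ℝ) * ((backDiff τ)^[n - m] g) (x + m * τ) = g x := by
  set E : Module.End ℝ (ℝ → ℝ) := LinearMap.funLeft ℝ ℝ (· + τ) with hE
  set D : Module.End ℝ (ℝ → ℝ) := 1 - E with hD
  have hEm : ∀ m : ℕ, ∀ u : ℝ → ℝ, ∀ y, (E ^ m) u y = u (y + m * τ) := by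
    intro m
    induction m with
    | zero => intro u y; simp
    | succ m ih =>
      intro u y
      rw [pow_succ, Module.End.mul_apply, ih]
      simp only [hE, LinearMap.funLeft_apply]
      congr 1; push_cast; ring
  have hDm : ∀ m : ℕ, ∀ u : ℝ → ℝ, (D ^ m) u = (backDiff τ)^[m] u := by
    intro m
    induction m with
    | zero => intro u; simp
    | succ m ih =>
      intro u
      rw [pow_succ, Module.End.mul_apply, ih, Function.iterate_succ_apply]
      rfl
  -- The shift E and the difference D = 1 - E commute, so the formula is the binomial expansion of
  -- (E + D)^n = 1.
  have hc : Commute E D := (Commute.one_right E).sub_right (Commute.refl E)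
  have h := hc.add_pow n
  rw [hD, add_sub_cancel, one_pow, ← hD] at h
  have h2 := congrFun (LinearMap.congr_fun h g) x
  rw [Module.End.one_apply, LinearMap.sum_apply, Finset.sum_apply] at h2
  rw [h2]
  refine Finset.sum_congr rfl fun m _ => ?_
  rw [Module.End.mul_apply, Module.End.natCast_apply, Module.End.mul_apply, map_nsmul, map_nsmul, Pi.smul_apply, hEm, hDm,
    nsmul_eq_mul]

/-- The weights of the discrete approximations of the representing measure. -/
def bernsteinWeight (τ : ℝ) (g : ℝ → ℝ) (t : ℝ) (N j : ℕ) : ℝ :=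
  (N.choose j : ℝ) * ((backDiff τ)^[N - j] g) (t + j * τ)

lemma CompletelyMonotonic.bernsteinWeight_nonneg {g : ℝ → ℝ} (hg : CompletelyMonotonic g) {τ : ℝ} (hτ : 0 ≤ τ)
    {t : ℝ} (ht : 0 < t) (N j : ℕ) : 0 ≤ bernsteinWeight τ g t N j :=
  mul_nonneg (by positivity) (hg.backDiff_iterate_nonneg hτ _ (by positivity))

lemma sum_bernsteinWeight (τ : ℝ) (g : ℝ → ℝ) (t : ℝ) (N : ℕ) :
    ∑ j ∈ Finset.range (N + 1), bernsteinWeight τ g t N j = g t := sum_choose_mul_backDiff τ g N t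

/-- Factorial moments of the weights are exactly values of g: C(N,j) C(j,K) = C(N,K) C(N-K, j-K)
reduces the sum to Newton's formula of order N - K at t + K τ. -/
lemma sum_bernsteinWeight_mul_choose (τ : ℝ) (g : ℝ → ℝ) (t : ℝ) {N K : ℕ} (hK : K ≤ N) :
    ∑ j ∈ Finset.range (N + 1), bernsteinWeight τ g t N j * ((j.choose K : ℝ) / N.choose K) = g (t + K * τ) := by
  obtain ⟨n, rfl⟩ := Nat.exists_eq_add_of_le hK
  rw [← sum_choose_mul_backDiff τ g n (t + K * τ), add_assoc, Finset.sum_range_add]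
  rw [Finset.sum_eq_zero (fun j hj => by rw [Nat.choose_eq_zero_of_lt (Finset.mem_range.mp hj)]; simp), zero_add]
  refine Finset.sum_congr rfl fun m _ => ?_
  have h1 : (K + n).choose (K + m) * (K + m).choose K = (K + n).choose K * n.choose m := by
    have := Nat.choose_mul (n := K + n) (k := K + m) (s := K) (by omega)
    simpa using this
  have h2 : ((K + n).choose K : ℝ) ≠ 0 := by
    have := Nat.choose_pos (n := K + n) (k := K) (by omega)
    positivity
  have h3 : ((K + n).choose (K + m) : ℝ) * (K + m).choose K = (K + n).choose K * n.choose m := by exact_mod_cast h1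
  have e1 : K + n - (K + m) = n - m := by omega
  have e2 : t + ((K + m : ℕ) : ℝ) * τ = t + K * τ + m * τ := by push_cast; ring
  rw [bernsteinWeight, e1, e2]
  generalize ((backDiff τ)^[n - m] g) (t + K * τ + m * τ) = v
  field_simp
  linear_combination v * h3

/-- The ratio is a product of factors (j - i)/(N - i) with i < K, each within i/N of j/N, and all
quantities lie in [0, 1]; the errors add up. -/
lemma abs_choose_div_sub_pow_le {N : ℕ} (hN : 0 < N) {j : ℕ} (hj : j ≤ N) {K : ℕ} (hK : K ≤ N) :
    |((j.choose K : ℝ) / N.choose K) - ((j : ℝ) / N) ^ K| ≤ (K : ℝ) ^ 2 / N := by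
  have hN' : (0 : ℝ) < N := by exact_mod_cast hN
  have hjN : (j : ℝ) / N ≤ 1 := div_le_one_of_le₀ (by exact_mod_cast hj) hN'.le
  have hj0 : 0 ≤ (j : ℝ) / N := by positivity
  have e : ∀ K, (j.choose K : ℝ) / N.choose K = (j.descFactorial K : ℝ) / N.descFactorial K := by
    intro K
    rw [Nat.descFactorial_eq_factorial_mul_choose, Nat.descFactorial_eq_factorial_mul_choose]
    push_cast
    rw [mul_div_mul_left _ _ (by positivity)]
  rw [e]
  have main : ∀ K : ℕ, K ≤ N → (j.descFactorial K : ℝ) / N.descFactorial K ≤ 1 ∧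
      |(j.descFactorial K : ℝ) / N.descFactorial K - ((j : ℝ) / N) ^ K| ≤ (K : ℝ) ^ 2 / N := by
    intro K
    induction K with
    | zero => intro _; simp
    | succ K ih =>
      intro hK
      obtain ⟨h1, h2⟩ := ih (by omega)
      have hKN : (K : ℝ) + 1 ≤ N := by exact_mod_cast hK
      set a := (j.descFactorial K : ℝ) / N.descFactorial K with ha
      have ha0 : 0 ≤ a := by positivity
      have es : (j.descFactorial (K + 1) : ℝ) / N.descFactorial (K + 1) = ((j - K : ℕ) : ℝ) / ((N - K : ℕ) : ℝ) * a := by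
        rw [Nat.descFactorial_succ, Nat.descFactorial_succ]
        push_cast
        rw [mul_div_mul_comm]
      set b := ((j - K : ℕ) : ℝ) / ((N - K : ℕ) : ℝ) with hb
      have hNK : (0 : ℝ) < ((N - K : ℕ) : ℝ) := by
        have : 0 < N - K := by omega
        exact_mod_cast this
      have hb0 : 0 ≤ b := by positivity
      have hb1 : b ≤ 1 := by
        rw [hb, div_le_one hNK]; exact_mod_cast (by omega : j - K ≤ N - K)
      have hbd : |b - (j : ℝ) / N| ≤ (K : ℝ) / N := by
        rcases le_total K j with hKj | hKj
        · have hKj' : (K : ℝ) ≤ j := by exact_mod_cast hKj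
          have hjN' : (j : ℝ) ≤ N := by exact_mod_cast hj
          have hNK' : (0 : ℝ) < N - K := by linarith
          rw [hb, Nat.cast_sub hKj, Nat.cast_sub (by omega : K ≤ N), abs_le]
          have : ((j : ℝ) - K) / (N - K) - j / N = -((K : ℝ) / N * ((N - j) / (N - K))) := by field_simp; ring
          rw [this]
          have hq1 : ((N : ℝ) - j) / (N - K) ≤ 1 := by rw [div_le_one hNK']; linarith
          have hq0 : 0 ≤ ((N : ℝ) - j) / (N - K) := div_nonneg (by linarith) hNK'.le
          have hk0 : 0 ≤ (K : ℝ) / N := by positivity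
          constructor <;> nlinarith
        · have : b = 0 := by rw [hb, Nat.sub_eq_zero_of_le hKj]; simp
          rw [this, zero_sub, abs_neg, abs_of_nonneg hj0]
          gcongr
      rw [es]
      refine ⟨mul_le_one₀ hb1 ha0 h1, ?_⟩
      have hsplit : b * a - ((j : ℝ) / N) ^ (K + 1) = (b - (j : ℝ) / N) * a + (j : ℝ) / N * (a - ((j : ℝ) / N) ^ K) := by
        ring
      rw [hsplit]
      refine (abs_add_le _ _).trans ?_
      rw [abs_mul, abs_mul, abs_of_nonneg ha0, abs_of_nonneg hj0]
      calc |b - (j : ℝ) / N| * a + (j : ℝ) / N * |a - ((j : ℝ) / N) ^ K|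
          ≤ (K : ℝ) / N * 1 + 1 * ((K : ℝ) ^ 2 / N) := by gcongr
        _ ≤ ((K + 1 : ℕ) : ℝ) ^ 2 / N := by
          rw [mul_one, one_mul, ← add_div]
          gcongr
          push_cast
          nlinarith [(Nat.cast_nonneg K : (0 : ℝ) ≤ K)]
  exact (main K hK).2

/-- Ordinary moments replace factorial ones at a pointwise cost of K²/N; the weights are nonnegative
with total g t. -/
lemma CompletelyMonotonic.abs_sum_bernsteinWeight_sub_le {g : ℝ → ℝ} (hg : CompletelyMonotonic g) {τ : ℝ} (hτ : 0 ≤ τ)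
    {t : ℝ} (ht : 0 < t) {N K : ℕ} (hN : 0 < N) (hK : K ≤ N) :
    |∑ j ∈ Finset.range (N + 1), bernsteinWeight τ g t N j * ((j : ℝ) / N) ^ K - g (t + K * τ)| ≤
      g t * ((K : ℝ) ^ 2 / N) := by
  rw [← sum_bernsteinWeight_mul_choose τ g t hK, ← Finset.sum_sub_distrib, ← sum_bernsteinWeight τ g t N, Finset.sum_mul]
  refine (Finset.abs_sum_le_sum_abs _ _).trans (Finset.sum_le_sum fun j hj => ?_)
  rw [← mul_sub, abs_mul, abs_of_nonneg (hg.bernsteinWeight_nonneg hτ ht N j), abs_sub_comm]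
  refine mul_le_mul_of_nonneg_left ?_ (hg.bernsteinWeight_nonneg hτ ht N j)
  exact abs_choose_div_sub_pow_le hN (by have := Finset.mem_range.mp hj; omega) hK

/-! ### Weak limits of the discrete measures and Bernstein's theorem. -/

/-- The function `z ↦ z ^ s` on the unit interval. -/
def unitPow (s : ℝ) (hs : 0 ≤ s) : BoundedContinuousFunction unitInterval ℝ :=
  BoundedContinuousFunction.mkOfCompact
    ⟨fun z => (z : ℝ) ^ s, (Real.continuous_rpow_const hs).comp continuous_subtype_val⟩

lemma unitPow_apply (s : ℝ) (hs : 0 ≤ s) (z : unitInterval) : unitPow s hs z = (z : ℝ) ^ s := rfl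

/-- The discrete approximations of the representing measure, on the unit interval. -/
def bernsteinMeasure (g : ℝ → ℝ) (t : ℝ) (n : ℕ) : Measure unitInterval :=
  ∑ j ∈ Finset.range (8 ^ n + 1), ENNReal.ofReal (bernsteinWeight (1 / 2 ^ n) g t (8 ^ n) j / g t) •
    Measure.dirac (Set.projIcc (0 : ℝ) 1 zero_le_one (((j : ℝ) / (8 ^ n : ℕ)) ^ (2 ^ n)))

lemma integral_bernsteinMeasure {g : ℝ → ℝ} (hg : CompletelyMonotonic g) {t : ℝ} (ht : 0 < t) (n : ℕ)
    (F : BoundedContinuousFunction unitInterval ℝ) :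
    ∫ z, F z ∂(bernsteinMeasure g t n) = ∑ j ∈ Finset.range (8 ^ n + 1),
      bernsteinWeight (1 / 2 ^ n) g t (8 ^ n) j / g t *
        F (Set.projIcc (0 : ℝ) 1 zero_le_one (((j : ℝ) / (8 ^ n : ℕ)) ^ (2 ^ n))) := by
  have hgt : 0 ≤ g t := by simpa using hg.2 0 t ht
  unfold bernsteinMeasure
  rw [integral_finsetSum_measure fun j _ => Integrable.smul_measure (integrable_dirac (by simp)) ENNReal.ofReal_ne_top]
  refine Finset.sum_congr rfl fun j _ => ?_
  rw [integral_smul_measure, integral_dirac, ENNReal.toReal_ofReal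
    (div_nonneg (hg.bernsteinWeight_nonneg (by positivity) ht _ _) hgt), smul_eq_mul]

lemma isProbabilityMeasure_bernsteinMeasure {g : ℝ → ℝ} (hg : CompletelyMonotonic g) {t : ℝ} (ht : 0 < t)
    (hgt : 0 < g t) (n : ℕ) : IsProbabilityMeasure (bernsteinMeasure g t n) := by
  constructor
  unfold bernsteinMeasure
  simp only [Measure.coe_finsetSum, Finset.sum_apply, Measure.smul_apply, measure_univ, smul_eq_mul, mul_one]
  rw [← ENNReal.ofReal_sum_of_nonneg fun j _ => div_nonneg (hg.bernsteinWeight_nonneg (by positivity) ht _ _) hgt.le,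
    ← Finset.sum_div, sum_bernsteinWeight, div_self hgt.ne', ENNReal.ofReal_one]

/-- The atoms are (j/N)^(2^n) with step 2^(-n), so at the exponent K/2^n the integrand is (j/N)^K, a
moment already controlled. With N = 8^n and K proportional to 2^n the error K²/N decays like 2^(-n).
-/
lemma tendsto_integral_bernsteinMeasure {g : ℝ → ℝ} (hg : CompletelyMonotonic g) {t : ℝ} (ht : 0 < t)
    (hgt : 0 < g t) (k m : ℕ) (hs : (0 : ℝ) ≤ k / 2 ^ m) :
    Tendsto (fun n => ∫ z, unitPow (k / 2 ^ m) hs z ∂(bernsteinMeasure g t n)) atTop (𝓝 (g (t + k / 2 ^ m) / g t)) := by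
  rw [tendsto_iff_norm_sub_tendsto_zero]
  have hlim : Tendsto (fun n : ℕ => ((k : ℝ) / 2 ^ m) ^ 2 * (1 / 2) ^ n) atTop (𝓝 0) := by
    have := (tendsto_pow_atTop_nhds_zero_of_lt_one (r := (1 / 2 : ℝ)) (by norm_num) (by norm_num)).const_mul
      (((k : ℝ) / 2 ^ m) ^ 2)
    rwa [mul_zero] at this
  refine squeeze_zero' (Eventually.of_forall fun n => norm_nonneg _) ?_ hlim
  filter_upwards [eventually_ge_atTop m, eventually_ge_atTop k] with n hn hk
  obtain ⟨d, rfl⟩ := Nat.exists_eq_add_of_le hn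
  set N := 8 ^ (m + d) with hN
  set K := k * 2 ^ d with hK
  have hKN : K ≤ N := by
    have h1 : k ≤ 2 ^ (m + d) := hk.trans Nat.lt_two_pow_self.le
    have h2 : 2 ^ d ≤ 2 ^ (m + d) := Nat.pow_le_pow_right (by norm_num) (by omega)
    calc K ≤ 2 ^ (m + d) * 2 ^ (m + d) := Nat.mul_le_mul h1 h2
      _ = 4 ^ (m + d) := by rw [← mul_pow]; norm_num
      _ ≤ N := Nat.pow_le_pow_left (by norm_num) _
  have hb := hg.abs_sum_bernsteinWeight_sub_le (τ := 1 / 2 ^ (m + d)) (by positivity) ht (N := N) (K := K)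
    (by positivity) hKN
  have hKr : (K : ℝ) = (k : ℝ) / 2 ^ m * 2 ^ (m + d) := by rw [hK, pow_add]; push_cast; field_simp
  have e1 : t + (K : ℝ) * (1 / 2 ^ (m + d)) = t + k / 2 ^ m := by rw [hKr]; field_simp
  have e2 : (K : ℝ) ^ 2 / N = ((k : ℝ) / 2 ^ m) ^ 2 * (1 / 2) ^ (m + d) := by
    rw [hKr, hN]
    push_cast
    rw [show (8 : ℝ) = 2 ^ 3 by norm_num, ← pow_mul, one_div, inv_pow, mul_pow]
    field_simp
    ring
  rw [e1, e2] at hb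
  rw [integral_bernsteinMeasure hg ht]
  have e3 : ∑ j ∈ Finset.range (N + 1), bernsteinWeight (1 / 2 ^ (m + d)) g t N j / g t *
      unitPow (k / 2 ^ m) hs (Set.projIcc (0 : ℝ) 1 zero_le_one (((j : ℝ) / (N : ℕ)) ^ (2 ^ (m + d)))) =
      (∑ j ∈ Finset.range (N + 1), bernsteinWeight (1 / 2 ^ (m + d)) g t N j * ((j : ℝ) / N) ^ K) / g t := by
    rw [Finset.sum_div]
    refine Finset.sum_congr rfl fun j hj => ?_
    have hj' : (j : ℝ) ≤ N := by
      have := Finset.mem_range.mp hj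
      exact_mod_cast (by omega : j ≤ N)
    have hx0 : 0 ≤ (j : ℝ) / N := by positivity
    have hx1 : (j : ℝ) / N ≤ 1 := div_le_one_of_le₀ hj' (by positivity)
    rw [unitPow_apply, Set.projIcc_of_mem zero_le_one ⟨pow_nonneg hx0 _, pow_le_one₀ hx0 hx1⟩]
    have : (((j : ℝ) / N) ^ (2 ^ (m + d))) ^ ((k : ℝ) / 2 ^ m) = ((j : ℝ) / N) ^ K := by
      rw [← Real.rpow_natCast, ← Real.rpow_mul hx0, ← Real.rpow_natCast _ K, hKr]
      congr 1; push_cast; ring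
    simp only [this]
    ring
  rw [e3, ← sub_div, norm_div, Real.norm_eq_abs, Real.norm_of_nonneg hgt.le, div_le_iff₀ hgt]
  linarith

lemma CompletelyMonotonic.continuousAt {g : ℝ → ℝ} (hg : CompletelyMonotonic g) {x : ℝ} (hx : 0 < x) :
    ContinuousAt g x := (hg.contDiffAt hx).continuousAt

/-- Probability measures on a compact space are compact, so a limit exists along a free ultrafilter.
Its moments are known at dyadic exponents, and continuity on both sides extends them to all s > 0.
-/
lemma exists_probabilityMeasure_unitInterval {g : ℝ → ℝ} (hg : CompletelyMonotonic g) {t : ℝ} (ht : 0 < t)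
    (hgt : 0 < g t) : ∃ ν : Measure unitInterval, IsProbabilityMeasure ν ∧
      ∀ s : ℝ, 0 < s → ∫ z : unitInterval, (z : ℝ) ^ s ∂ν = g (t + s) / g t := by
  set μ : ℕ → ProbabilityMeasure unitInterval := fun n =>
    ⟨bernsteinMeasure g t n, isProbabilityMeasure_bernsteinMeasure hg ht hgt n⟩ with hμ
  obtain ⟨ν, -, hν⟩ := isCompact_univ.ultrafilter_le_nhds ((hyperfilter ℕ).map μ) (by simp)
  have hν' : Tendsto μ (hyperfilter ℕ : Filter ℕ) (𝓝 ν) := hν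
  rw [ProbabilityMeasure.tendsto_iff_forall_integral_tendsto] at hν'
  have hdy : ∀ k m : ℕ, ∫ z : unitInterval, (z : ℝ) ^ ((k : ℝ) / 2 ^ m) ∂(ν : Measure unitInterval) =
      g (t + k / 2 ^ m) / g t := fun k m => by
    have hs : (0 : ℝ) ≤ k / 2 ^ m := by positivity
    exact tendsto_nhds_unique (hν' (unitPow _ hs))
      ((tendsto_integral_bernsteinMeasure hg ht hgt k m hs).mono_left Nat.hyperfilter_le_atTop)
  refine ⟨ν, inferInstance, fun s hs => ?_⟩
  have hfl : Tendsto (fun n : ℕ => (⌊s * (2 : ℝ) ^ n⌋₊ : ℝ) / 2 ^ n) atTop (𝓝 s) :=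
    (tendsto_nat_floor_mul_div_atTop hs.le).comp (tendsto_pow_atTop_atTop_of_one_lt one_lt_two)
  have h1 : Tendsto (fun n : ℕ => ∫ z : unitInterval, (z : ℝ) ^ ((⌊s * (2 : ℝ) ^ n⌋₊ : ℝ) / 2 ^ n) ∂(ν : Measure unitInterval))
      atTop (𝓝 (∫ z : unitInterval, (z : ℝ) ^ s ∂(ν : Measure unitInterval))) := by
    refine tendsto_integral_of_dominated_convergence (fun _ => 1) (fun n => ?_) (integrable_const _) (fun n => ?_) ?_
    · exact ((Real.continuous_rpow_const (by positivity)).comp continuous_subtype_val).aestronglyMeasurable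
    · refine ae_of_all _ fun z => ?_
      rw [Real.norm_of_nonneg (Real.rpow_nonneg z.2.1 _)]
      exact Real.rpow_le_one z.2.1 z.2.2 (by positivity)
    · refine ae_of_all _ fun z => ?_
      exact (Real.continuousAt_const_rpow' hs.ne').tendsto.comp hfl
  have h2 : Tendsto (fun n : ℕ => g (t + (⌊s * (2 : ℝ) ^ n⌋₊ : ℝ) / 2 ^ n) / g t) atTop (𝓝 (g (t + s) / g t)) := by
    refine Tendsto.div_const ?_ _
    exact (hg.continuousAt (by linarith : 0 < t + s)).tendsto.comp (hfl.const_add t)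
  simp_rw [hdy] at h1
  exact tendsto_nhds_unique h1 h2

/-- Push the measure forward under z = exp (-π α). This requires no mass at z = 0: as s → 0+ the
moments tend to the mass of z > 0, and by continuity of g at t they tend to 1. -/
lemma exists_finiteMeasure_laplace {g : ℝ → ℝ} (hg : CompletelyMonotonic g) {t : ℝ} (ht : 0 < t) :
    ∃ ρ : Measure ℝ≥0, IsFiniteMeasure ρ ∧
      ∀ s : ℝ, 0 ≤ s → ∫ α : ℝ≥0, Real.exp (-(Real.pi * α * s)) ∂ρ = g (t + s) := by
  have hnn : ∀ x, 0 < x → 0 ≤ g x := fun x hx => by simpa using hg.2 0 x hx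
  have hanti : ∀ s, 0 ≤ s → g (t + s) ≤ g t := fun s hs => by
    simpa using hg.antitoneOn 0 (show t ∈ Ioi 0 from ht) (show t + s ∈ Ioi (0 : ℝ) from by
      show 0 < t + s; linarith) (by linarith)
  rcases (hnn t ht).eq_or_lt with h0 | hgt
  · refine ⟨0, inferInstance, fun s hs => ?_⟩
    have := hanti s hs
    have := hnn (t + s) (by linarith)
    rw [integral_zero_measure]
    linarith
  obtain ⟨ν, hνp, hν⟩ := exists_probabilityMeasure_unitInterval hg ht hgt
  have hpos : ∀ᵐ z : unitInterval ∂ν, 0 < (z : ℝ) := by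
    have h1 : Tendsto (fun n : ℕ => ∫ z : unitInterval, (z : ℝ) ^ (1 / ((n : ℝ) + 1)) ∂ν) atTop
        (𝓝 (∫ z : unitInterval, (if (z : ℝ) = 0 then 0 else 1) ∂ν)) := by
      refine tendsto_integral_of_dominated_convergence (fun _ => 1) (fun n => ?_) (integrable_const _) (fun n => ?_) ?_
      · exact ((Real.continuous_rpow_const (by positivity)).comp continuous_subtype_val).aestronglyMeasurable
      · refine ae_of_all _ fun z => ?_
        rw [Real.norm_of_nonneg (Real.rpow_nonneg z.2.1 _)]
        exact Real.rpow_le_one z.2.1 z.2.2 (by positivity)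
      · refine ae_of_all _ fun z => ?_
        split_ifs with hz
        · refine tendsto_const_nhds.congr fun n => ?_
          rw [hz, Real.zero_rpow (by positivity)]
        · have := (Real.continuousAt_const_rpow (b := 0) hz).tendsto.comp (tendsto_one_div_add_atTop_nhds_zero_nat (𝕜 := ℝ))
          rwa [Real.rpow_zero] at this
    have h2 : Tendsto (fun n : ℕ => g (t + 1 / ((n : ℝ) + 1)) / g t) atTop (𝓝 1) := by
      have h3 : Tendsto (fun n : ℕ => t + 1 / ((n : ℝ) + 1)) atTop (𝓝 (t + 0)) :=
        (tendsto_one_div_add_atTop_nhds_zero_nat (𝕜 := ℝ)).const_add t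
      rw [add_zero] at h3
      have h4 := ((hg.continuousAt ht).tendsto.comp h3).div_const (g t)
      rwa [div_self hgt.ne'] at h4
    have h5 : ∫ z : unitInterval, (if (z : ℝ) = 0 then (0 : ℝ) else 1) ∂ν = 1 := by
      refine tendsto_nhds_unique h1 (h2.congr fun n => ?_)
      rw [hν _ (by positivity)]
    have hm : MeasurableSet {z : unitInterval | (z : ℝ) = 0} :=
      measurableSet_eq_fun measurable_subtype_coe measurable_const
    have h6 : ∫ z : unitInterval, (if (z : ℝ) = 0 then (0 : ℝ) else 1) ∂ν = 1 - ν.real {z : unitInterval | (z : ℝ) = 0} := by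
      have e : ∀ z : unitInterval, (if (z : ℝ) = 0 then (0 : ℝ) else 1) =
          1 - {z : unitInterval | (z : ℝ) = 0}.indicator (fun _ => (1 : ℝ)) z := fun z => by
        by_cases hz : (z : ℝ) = 0
        · rw [if_pos hz, Set.indicator_of_mem (show z ∈ {z : unitInterval | (z : ℝ) = 0} from hz), sub_self]
        · rw [if_neg hz, Set.indicator_of_notMem (show z ∉ {z : unitInterval | (z : ℝ) = 0} from hz), sub_zero]
      simp_rw [e]
      rw [integral_sub (integrable_const _) ((integrable_const (1 : ℝ)).indicator hm), integral_indicator_const _ hm]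
      simp
    have h7 : ν.real {z : unitInterval | (z : ℝ) = 0} = 0 := by linarith
    have h8 : ν {z : unitInterval | (z : ℝ) = 0} = 0 := by
      rwa [measureReal_def, ENNReal.toReal_eq_zero_iff, or_iff_left (measure_ne_top _ _)] at h7
    rw [ae_iff]
    refine measure_mono_null (fun z hz => ?_) h8
    exact le_antisymm (not_lt.mp hz) z.2.1
  set ψ : unitInterval → ℝ≥0 := fun z => Real.toNNReal (-Real.log z / Real.pi) with hψ
  have hψm : Measurable ψ := by
    refine Measurable.real_toNNReal (Measurable.div_const (Measurable.neg ?_) _)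
    exact Real.measurable_log.comp measurable_subtype_coe
  refine ⟨ENNReal.ofReal (g t) • ν.map ψ, Measure.smul_finite _ ENNReal.ofReal_ne_top, fun s hs => ?_⟩
  rw [integral_smul_measure, integral_map hψm.aemeasurable (by fun_prop : Measurable _).aestronglyMeasurable,
    ENNReal.toReal_ofReal hgt.le, smul_eq_mul]
  have e : ∫ z : unitInterval, Real.exp (-(Real.pi * (ψ z : ℝ) * s)) ∂ν = ∫ z : unitInterval, (z : ℝ) ^ s ∂ν := by
    refine integral_congr_ae ?_
    filter_upwards [hpos] with z hz
    have hl : Real.log z ≤ 0 := Real.log_nonpos z.2.1 z.2.2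
    have : (ψ z : ℝ) = -Real.log z / Real.pi := by
      simp only [hψ]
      exact Real.coe_toNNReal _ (div_nonneg (by linarith) Real.pi_pos.le)
    rw [this, Real.rpow_def_of_pos hz]
    congr 1
    have := Real.pi_ne_zero
    field_simp
  rw [e]
  rcases hs.eq_or_lt with rfl | hs
  · simp
  · rw [hν s hs]; field_simp

/-- A finite measure on `[0, ∞)` is determined by its Laplace transform. -/
lemma ext_of_laplace {μ ν : Measure ℝ≥0} [IsFiniteMeasure μ] [IsFiniteMeasure ν]
    (h : ∀ s : ℝ, 0 ≤ s → ∫ α : ℝ≥0, Real.exp (-(Real.pi * α * s)) ∂μ = ∫ α : ℝ≥0, Real.exp (-(Real.pi * α * s)) ∂ν) :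
    μ = ν := by
  have hpi := Real.pi_pos
  set e : ℝ≥0 → BoundedContinuousFunction ℝ≥0 ℝ := fun s =>
    BoundedContinuousFunction.ofNormedAddCommGroup (fun α : ℝ≥0 => Real.exp (-(Real.pi * α * s))) (by fun_prop) 1
      (fun α => by
        rw [Real.norm_of_nonneg (Real.exp_pos _).le]
        exact Real.exp_le_one_iff.mpr (by rw [neg_nonpos]; positivity)) with he
  have he' : ∀ s α, e s α = Real.exp (-(Real.pi * α * s)) := fun s α => rfl
  -- Stone-Weierstrass: the algebra generated by the exponentials separates points, hence determines
  -- finite measures.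
  set A : StarSubalgebra ℝ (BoundedContinuousFunction ℝ≥0 ℝ) :=
    { Algebra.adjoin ℝ (Set.range e) with
      star_mem' := fun {a} ha => by
        have : star a = a := by ext; simp
        rw [this]; exact ha } with hA
  have hmem : ∀ f, f ∈ A ↔ f ∈ Algebra.adjoin ℝ (Set.range e) := fun f => Iff.rfl
  refine ext_of_forall_mem_subalgebra_integral_eq_of_polish (𝕜 := ℝ) (A := A) ?_ ?_
  · intro x y hxy
    refine ⟨e 1, ⟨_, ⟨e 1, ?_, rfl⟩, rfl⟩, ?_⟩
    · exact Algebra.subset_adjoin ⟨1, rfl⟩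
    · show e 1 x ≠ e 1 y
      rw [he', he']
      intro h
      apply hxy
      have := Real.exp_injective h
      simp at this
      exact this
  · intro f hf
    have hf' : f ∈ Submodule.span ℝ (Submonoid.closure (Set.range e) : Set (BoundedContinuousFunction ℝ≥0 ℝ)) := by
      rw [← Algebra.adjoin_eq_span]; exact hf
    -- Products of exponentials are exponentials, so the algebra is just their linear span.
    have hcl : ∀ u ∈ Submonoid.closure (Set.range e), ∃ s, u = e s := by
      intro u hu
      induction hu using Submonoid.closure_induction with
      | mem u hu => obtain ⟨s, rfl⟩ := hu; exact ⟨s, rfl⟩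
      | one => exact ⟨0, by ext α; rw [he']; simp⟩
      | mul u v _ _ hu hv =>
        obtain ⟨s, rfl⟩ := hu
        obtain ⟨s', rfl⟩ := hv
        refine ⟨s + s', ?_⟩
        ext α
        rw [BoundedContinuousFunction.mul_apply, he', he', he', ← Real.exp_add]
        congr 1; push_cast; ring
    clear hf
    induction hf' using Submodule.span_induction with
    | mem u hu =>
      obtain ⟨s, rfl⟩ := hcl u hu
      exact h s s.2
    | zero => simp
    | add u v _ _ hu hv =>
      simp only [BoundedContinuousFunction.coe_add, Pi.add_apply]
      rw [integral_add (u.integrable _) (v.integrable _), integral_add (u.integrable _) (v.integrable _), hu, hv]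
    | smul c u _ hu =>
      simp only [BoundedContinuousFunction.coe_smul]
      rw [integral_smul, integral_smul, hu]

lemma integrable_exp_neg_of_finite {ρ : Measure ℝ≥0} [IsFiniteMeasure ρ] {s : ℝ} (hs : 0 ≤ s) :
    Integrable (fun α : ℝ≥0 => Real.exp (-(Real.pi * α * s))) ρ := by
  refine Integrable.of_bound (by fun_prop : Measurable _).aestronglyMeasurable 1 (ae_of_all _ fun α => ?_)
  have := Real.pi_pos
  rw [Real.norm_of_nonneg (Real.exp_pos _).le]
  exact Real.exp_le_one_iff.mpr (by rw [neg_nonpos]; positivity)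

/-- **Bernstein's theorem**: a completely monotonic function is a Laplace transform. -/
theorem CompletelyMonotonic.exists_measure {g : ℝ → ℝ} (hg : CompletelyMonotonic g) :
    ∃ W : Measure ℝ≥0, ∀ t : ℝ, 0 < t → Integrable (fun α : ℝ≥0 => Real.exp (-(Real.pi * α * t))) W ∧
      ∫ α : ℝ≥0, Real.exp (-(Real.pi * α * t)) ∂W = g t := by
  have hpi := Real.pi_pos
  have hnn : ∀ x, 0 < x → 0 ≤ g x := fun x hx => by simpa using hg.2 0 x hx
  have lap : ∀ t, 0 < t → ∃ ρ : Measure ℝ≥0, IsFiniteMeasure ρ ∧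
      ∀ s : ℝ, 0 ≤ s → ∫⁻ α : ℝ≥0, ENNReal.ofReal (Real.exp (-(Real.pi * α * s))) ∂ρ = ENNReal.ofReal (g (t + s)) := by
    intro t ht
    obtain ⟨ρ, hρ, h⟩ := exists_finiteMeasure_laplace hg ht
    refine ⟨ρ, hρ, fun s hs => ?_⟩
    rw [← h s hs, ofReal_integral_eq_lintegral_ofReal (integrable_exp_neg_of_finite hs)
      (ae_of_all _ fun α => (Real.exp_pos _).le)]
  obtain ⟨ρ, hρ, h⟩ := lap 1 one_pos
  -- The finite measure ρ represents g (1 + ·); the factor exp (π α) undoes the translation by 1.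
  set W := ρ.withDensity fun α : ℝ≥0 => ENNReal.ofReal (Real.exp (Real.pi * α)) with hW
  have key : ∀ t : ℝ, 0 < t →
      ∫⁻ α : ℝ≥0, ENNReal.ofReal (Real.exp (-(Real.pi * α * t))) ∂W = ENNReal.ofReal (g t) := by
    intro t ht
    rw [hW, lintegral_withDensity_eq_lintegral_mul _ (by fun_prop) (by fun_prop)]
    simp only [Pi.mul_apply, ← ENNReal.ofReal_mul (Real.exp_pos _).le, ← Real.exp_add]
    rcases le_total 1 t with h1 | h1
    · have := h (t - 1) (by linarith)
      rw [add_sub_cancel] at this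
      rw [← this]
      refine lintegral_congr fun α => ?_
      congr 2; ring
    -- For t < 1 the finite measure based at t, damped by exp (-π α (1 - t)), has the Laplace
    -- transform of ρ, and so equals ρ by uniqueness.
    · obtain ⟨κ, hκ, hκ'⟩ := lap t ht
      have hm : Measurable fun α : ℝ≥0 => ENNReal.ofReal (Real.exp (-(Real.pi * α * (1 - t)))) := by fun_prop
      have hlap : ∀ s : ℝ, 0 ≤ s → ∫⁻ α : ℝ≥0, ENNReal.ofReal (Real.exp (-(Real.pi * α * s)))
          ∂(κ.withDensity fun α : ℝ≥0 => ENNReal.ofReal (Real.exp (-(Real.pi * α * (1 - t))))) =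
          ENNReal.ofReal (g (1 + s)) := by
        intro s hs
        rw [lintegral_withDensity_eq_lintegral_mul _ hm (by fun_prop), show 1 + s = t + (1 - t + s) by ring,
          ← hκ' _ (by linarith)]
        refine lintegral_congr fun α => ?_
        simp only [Pi.mul_apply, ← ENNReal.ofReal_mul (Real.exp_pos _).le, ← Real.exp_add]
        congr 2; ring
      have hfin : IsFiniteMeasure (κ.withDensity fun α : ℝ≥0 => ENNReal.ofReal (Real.exp (-(Real.pi * α * (1 - t))))) := by
        constructor
        have := hlap 0 le_rfl
        simp only [mul_zero, neg_zero, Real.exp_zero, ENNReal.ofReal_one, lintegral_const, one_mul] at this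
        rw [this]; exact ENNReal.ofReal_lt_top
      have heq : ρ = κ.withDensity fun α : ℝ≥0 => ENNReal.ofReal (Real.exp (-(Real.pi * α * (1 - t)))) := by
        refine ext_of_laplace fun s hs => ?_
        rw [integral_eq_lintegral_of_nonneg_ae (ae_of_all _ fun α => (Real.exp_pos _).le)
          (integrable_exp_neg_of_finite hs).1, integral_eq_lintegral_of_nonneg_ae
          (ae_of_all _ fun α => (Real.exp_pos _).le) (integrable_exp_neg_of_finite hs).1, h s hs, hlap s hs]
      rw [heq, lintegral_withDensity_eq_lintegral_mul _ hm (by fun_prop), show g t = g (t + 0) by rw [add_zero],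
        ← hκ' 0 le_rfl]
      refine lintegral_congr fun α => ?_
      simp only [Pi.mul_apply, ← ENNReal.ofReal_mul (Real.exp_pos _).le, ← Real.exp_add]
      congr 2; ring
  refine ⟨W, fun t ht => ?_⟩
  have hi : Integrable (fun α : ℝ≥0 => Real.exp (-(Real.pi * α * t))) W := by
    refine ⟨(by fun_prop : Measurable _).aestronglyMeasurable, ?_⟩
    rw [hasFiniteIntegral_iff_ofReal (ae_of_all _ fun α => (Real.exp_pos _).le), key t ht]
    exact ENNReal.ofReal_lt_top
  refine ⟨hi, ?_⟩
  rw [integral_eq_lintegral_of_nonneg_ae (ae_of_all _ fun α => (Real.exp_pos _).le) hi.1, key t ht,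
    ENNReal.toReal_ofReal (hnn t ht)]

lemma IsCMSD.exists_mixtureMeasure {f : ℝ → ℝ} (hf : IsCMSD f) : ∃ W : Measure ℝ≥0, IsMixtureMeasure W f := by
  obtain ⟨g, hg, hfg⟩ := hf
  obtain ⟨W, hW⟩ := hg.exists_measure
  refine ⟨W, fun r hr => ?_⟩
  rw [hfg r hr]
  exact hW (r ^ 2) (by positivity)

/-! ### The ratio of the integrals of the mixture measure -/

lemma ratioDen_ne_top {W : Measure ℝ≥0} {f : ℝ → ℝ} (hW : IsMixtureMeasure W f) : ratioDen W ≠ ⊤ :=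
  ((ratioDen_le W).trans_lt (ENNReal.mul_lt_top (by norm_num) (integrable_gaussGap hW).lintegral_lt_top)).ne

/-- The integrands of the denominator are positive on (0, ∞) and W has no atom at 0, so a zero
denominator forces W = 0. -/
lemma ratioNum_eq_zero {W : Measure ℝ≥0} (hL : ratioNum W 1 1 ≠ ⊤) (hD : ratioDen W = 0) : ratioNum W 1 1 = 0 := by
  have h0 := ae_ne_zero_of_ratioNum hL
  rw [ratioDen, add_eq_zero, lintegral_eq_zero_iff (by fun_prop), lintegral_eq_zero_iff (by fun_prop)] at hD
  obtain ⟨h1, h2⟩ := hD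
  rw [EventuallyEq, ae_restrict_iff' measurableSet_Ici] at h1
  rw [EventuallyEq, ae_restrict_iff' measurableSet_Ioc] at h2
  have : ∀ᵐ α ∂W, False := by
    filter_upwards [h0, h1, h2] with α a0 a1 a2
    rcases le_total 1 α with h | h
    · have := a1 h
      simp only [Pi.zero_apply, ENNReal.ofReal_eq_zero] at this
      exact absurd this (not_le.mpr (Real.exp_pos _))
    · have := a2 ⟨pos_iff_ne_zero.mpr a0, h⟩
      simp only [Pi.zero_apply, ENNReal.ofReal_eq_zero] at this
      exact absurd this (not_le.mpr (Real.exp_pos _))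
  have hW0 : W = 0 := by
    rw [ae_iff] at this
    simpa using this
  simp [hW0, ratioNum]

lemma exists_ratioNum_le {W : Measure ℝ≥0} {f : ℝ → ℝ} (hW : IsMixtureMeasure W f) (hL : ratioNum W 1 1 ≠ ⊤) :
    ∃ K : ℝ, 0 ≤ K ∧ ratioNum W 1 1 ≤ ENNReal.ofReal K * ratioDen W := by
  by_cases hD : ratioDen W = 0
  · exact ⟨0, le_rfl, by rw [ratioNum_eq_zero hL hD]; exact zero_le⟩
  · refine ⟨(ratioNum W 1 1 / ratioDen W).toReal, ENNReal.toReal_nonneg, ?_⟩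
    rw [ENNReal.ofReal_toReal (ENNReal.div_lt_top hL hD).ne, ENNReal.div_mul_cancel hD (ratioDen_ne_top hW)]

/-- The cut-offs in the numerator only matter up to a multiple of the denominator. -/
lemma exists_ratioNum_one_le {a : ℝ≥0} (ha : 0 < a) (b : ℝ≥0) : ∃ C : ℝ, 0 ≤ C ∧ ∀ W : Measure ℝ≥0,
    ratioNum W 1 1 ≤ ratioNum W a b + ENNReal.ofReal C * ratioDen W := by
  have hpi := Real.pi_pos
  have hr := rStar_pos
  have ha' : (0 : ℝ) < a := by exact_mod_cast ha
  -- These are bounds for the quotients of the numerator integrands by the denominator integrands on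
  -- the ranges 1 ≤ α < b and a < α ≤ 1 that the changed cut-offs leave out.
  set C := max (Real.exp (Real.pi * b / 2 * rStar ^ 2)) ((a : ℝ)⁻¹ * Real.exp (Real.pi / a * rStar ^ 2)) with hC
  have hC0 : 0 ≤ C := le_max_of_le_left (Real.exp_pos _).le
  refine ⟨C, hC0, fun W => ?_⟩
  have h1 : ∫⁻ α in Ici (1 : ℝ≥0), ENNReal.ofReal (Real.exp (-(Real.pi * α / 2 * rStar ^ 2))) ∂W ≤
      (∫⁻ α in Ici b, ENNReal.ofReal (Real.exp (-(Real.pi * α / 2 * rStar ^ 2))) ∂W) +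
      ENNReal.ofReal C * ∫⁻ α in Ici (1 : ℝ≥0), ENNReal.ofReal (Real.exp (-(Real.pi * α * rStar ^ 2))) ∂W := by
    have hsub : Ici (1 : ℝ≥0) ⊆ Ici b ∪ Ici 1 \ Ici b := fun x hx => by
      by_cases h : x ∈ Ici b
      · exact Or.inl h
      · exact Or.inr ⟨hx, h⟩
    refine (lintegral_mono_set hsub).trans ((lintegral_union_le _ _ _).trans (add_le_add le_rfl ?_))
    rw [← lintegral_const_mul _ (by fun_prop)]
    refine le_trans (setLIntegral_mono' (measurableSet_Ici.diff measurableSet_Ici) fun α hα => ?_)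
      (lintegral_mono_set sdiff_subset)
    rw [← ENNReal.ofReal_mul hC0]
    apply ENNReal.ofReal_le_ofReal
    have hαb : (α : ℝ) ≤ b := by
      have : α < b := not_le.mp hα.2
      exact_mod_cast this.le
    calc Real.exp (-(Real.pi * α / 2 * rStar ^ 2)) =
        Real.exp (Real.pi * α / 2 * rStar ^ 2) * Real.exp (-(Real.pi * α * rStar ^ 2)) := by
          rw [← Real.exp_add]; congr 1; ring
      _ ≤ C * Real.exp (-(Real.pi * α * rStar ^ 2)) := by
          refine mul_le_mul_of_nonneg_right (le_trans ?_ (le_max_left _ _)) (Real.exp_pos _).le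
          apply Real.exp_le_exp.mpr
          gcongr
  have h2 : ∫⁻ α in Iic (1 : ℝ≥0), (α : ℝ≥0∞)⁻¹ ∂W ≤ (∫⁻ α in Iic a, (α : ℝ≥0∞)⁻¹ ∂W) +
      ENNReal.ofReal C * ∫⁻ α in Ioc (0 : ℝ≥0) 1, ENNReal.ofReal (Real.exp (-(Real.pi / α * rStar ^ 2))) ∂W := by
    have hsub : Iic (1 : ℝ≥0) ⊆ Iic a ∪ Ioc 0 1 \ Iic a := fun x hx => by
      by_cases h : x ∈ Iic a
      · exact Or.inl h
      · exact Or.inr ⟨⟨ha.trans (not_le.mp h), hx⟩, h⟩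
    refine (lintegral_mono_set hsub).trans ((lintegral_union_le _ _ _).trans (add_le_add le_rfl ?_))
    rw [← lintegral_const_mul _ (by fun_prop)]
    refine le_trans (setLIntegral_mono' (measurableSet_Ioc.diff measurableSet_Iic) fun α hα => ?_)
      (lintegral_mono_set sdiff_subset)
    have haα : (a : ℝ) ≤ α := by
      have : a < α := not_le.mp hα.2
      exact_mod_cast this.le
    have hα0 : α ≠ 0 := hα.1.1.ne'
    rw [← ENNReal.ofReal_mul hC0, ← ENNReal.coe_inv hα0, ← ENNReal.ofReal_coe_nnreal, NNReal.coe_inv]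
    apply ENNReal.ofReal_le_ofReal
    calc (α : ℝ)⁻¹ = (α : ℝ)⁻¹ * Real.exp (Real.pi / α * rStar ^ 2) * Real.exp (-(Real.pi / α * rStar ^ 2)) := by
          rw [mul_assoc, ← Real.exp_add]; simp
      _ ≤ C * Real.exp (-(Real.pi / α * rStar ^ 2)) := by
          refine mul_le_mul_of_nonneg_right (le_trans ?_ (le_max_right _ _)) (Real.exp_pos _).le
          gcongr
  calc ratioNum W 1 1 ≤ _ := add_le_add h1 h2
    _ = _ := by rw [ratioNum, ratioDen]; ring

/-! ### Conclusion for one interaction and for families. -/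

lemma norm_le_of_perturbationSize_le {p : hexLattice → Plane} {ε : ℝ} (hε : 0 ≤ ε)
    (hp : perturbationSize p ≤ ENNReal.ofReal ε) (x : hexLattice) : ‖p x‖ ≤ ε := by
  have h1 : ‖p x‖ₑ ≤ ENNReal.ofReal ε := (le_iSup (fun x => ‖p x‖ₑ) x).trans hp
  rwa [← ofReal_norm, ENNReal.ofReal_le_ofReal_iff hε] at h1

theorem theorem2 :
    (∀ f : ℝ → ℝ, IsCMSD f →
      ∃ ε : ℝ, 0 < ε ∧ ∀ p : hexLattice → Plane, perturbationSize p ≤ ENNReal.ofReal ε →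
        energy f hexLattice ≤ energy f (perturbedLattice p)) ∧
    (∀ F : Set (ℝ → ℝ), (∀ f ∈ F, IsCMSD f) → UniformRatioCondition F →
      ∃ ε : ℝ, 0 < ε ∧ ∀ p : hexLattice → Plane, perturbationSize p ≤ ENNReal.ofReal ε →
        ∀ f ∈ F, energy f hexLattice ≤ energy f (perturbedLattice p)) := by
  obtain ⟨c, hc, hmain⟩ := exists_energy_le_of_ratio
  have step : ∀ K : ℝ, 0 ≤ K → ∃ ε : ℝ, 0 < ε ∧ ∀ p : hexLattice → Plane, perturbationSize p ≤ ENNReal.ofReal ε →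
      ∀ (f : ℝ → ℝ) (W : Measure ℝ≥0), IsMixtureMeasure W f → ratioNum W 1 1 ≠ ⊤ →
        ratioNum W 1 1 ≤ ENNReal.ofReal K * ratioDen W → energy f hexLattice ≤ energy f (perturbedLattice p) := by
    intro K hK
    refine ⟨min (1 / 8) (c / (K + 1)), by positivity, fun p hp f W hW hL hLK => ?_⟩
    have hε : 0 ≤ min (1 / 8) (c / (K + 1)) := by positivity
    rw [perturbedLattice_eq_range]
    refine hmain W f K _ _ hW hL hK hLK (min_le_left _ _) ?_ fun x => norm_le_of_perturbationSize_le hε hp _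
    calc min (1 / 8) (c / (K + 1)) * K ≤ c / (K + 1) * K := by gcongr; exact min_le_right _ _
      _ ≤ c := by rw [div_mul_eq_mul_div, div_le_iff₀ (by positivity)]; nlinarith
  refine ⟨fun f hf => ?_, fun F hF hU => ?_⟩
  · obtain ⟨W, hW⟩ := hf.exists_mixtureMeasure
    -- When the numerator is infinite, every small perturbation has energy +∞ and the comparison is
    -- trivial.
    by_cases hL : ratioNum W 1 1 = ⊤
    · refine ⟨1 / 8, by norm_num, fun p hp => ?_⟩
      rw [perturbedLattice_eq_range, energy_perturbed_eq_top hW (not_summable_of_ratioNum_eq_top hW hL) le_rfl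
        fun x => norm_le_of_perturbationSize_le (by norm_num) hp _]
      exact le_top
    · obtain ⟨K, hK, hLK⟩ := exists_ratioNum_le hW hL
      obtain ⟨ε, hε, h⟩ := step K hK
      exact ⟨ε, hε, fun p hp => h p hp f W hW hL hLK⟩
  · have hpos : ∀ᶠ q : ℝ≥0 × ℝ≥0 in 𝓝[>] 0 ×ˢ atTop, 0 < q.1 :=
      Filter.Eventually.prod_inl (p := fun x : ℝ≥0 => 0 < x) self_mem_nhdsWithin _
    -- The limit hypothesis enters only through one pair of cut-offs with quotient at most 1 for the
    -- whole family.
    obtain ⟨⟨a, b⟩, hab, ha⟩ := ((hU 1 one_pos).and hpos).exists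
    obtain ⟨C, hC, hC'⟩ := exists_ratioNum_one_le ha b
    obtain ⟨ε, hε, h⟩ := step (1 + C) (by positivity)
    refine ⟨ε, hε, fun p hp f hf => ?_⟩
    obtain ⟨W, hW⟩ := (hF f hf).exists_mixtureMeasure
    have hD := ratioDen_ne_top hW
    have h1 : ratioNum W a b ≤ ratioDen W := by
      have h2 := hab f hf W hW
      -- With zero denominator the extended quotient is ∞ unless the numerator vanishes too, so the
      -- bound forces a zero numerator.
      by_cases h0 : ratioDen W = 0
      · simp only [h0] at h2 ⊢
        by_contra hcon
        rw [ENNReal.div_zero (fun h3 => hcon h3.le)] at h2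
        exact absurd h2 (by simp)
      · have := (ENNReal.div_le_iff h0 hD).mp h2
        rwa [one_mul] at this
    have h3 : ratioNum W 1 1 ≤ ENNReal.ofReal (1 + C) * ratioDen W := by
      rw [ENNReal.ofReal_add zero_le_one hC, ENNReal.ofReal_one, add_mul, one_mul]
      exact (hC' W).trans (by gcongr)
    exact h p hp f W hW (ne_top_of_le_ne_top (ENNReal.mul_ne_top ENNReal.ofReal_ne_top hD) h3) h3

end
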